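/- Let $G=(V,E,\mathbf u)$ be a directed graph with $n$ vertices, $m$ arcs (parallel arcs allowed) and non-negative integer capacities $u_e$, and let $s\neq t$ be two vertices. An $s$-$t$ flow of value $F\ge 0$ is a vector $\mathbf f\in\mathbb R^{E}$ such that, at every vertex $v$, the total flow entering $v$ minus the total flow leaving $v$ equals $-F$ if $v=s$, $F$ if $v=t$, and $0$ otherwise; it is feasible if $0\le f_e\le u_e$ for every arc $e$, and integral if every $f_e$ is an integer. Then a feasible integral $s$-$t$ flow of value $\lfloor F\rfloor$ can be computed from a feasible fractional $s$-$t$ flow of value $F$ in $\tilde O(m)$ time. Precisely: there are a single deterministic random-access-machine program, a constant $\kappa$ and a function $T:\mathbb N\to\mathbb N$ with $T(m)=\tilde O(m)$, i.e. $T(m)=O(m\log^c m)$ for some constant $c$, such that for every such $G$, $s$, $t$ and every feasible (real-valued) $s$-$t$ flow $\mathbf f$ in $G$ of value $F$, the program, given $(G,s,t,\mathbf f)$, halts within $T(m)$ steps and outputs an integral $s$-$t$ flow $\mathbf f^*$ of value $\lfloor F\rfloor$ that is feasible in $G$. Here the machine has memory cells for real numbers, with unit-cost addition, subtraction, floor and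 comparison, and word cells for indices, with the usual unit-cost arithmetic, comparison and indirect addressing on integers in $\{0,\dots,W-1\}$, for any word range $W\ge (n+m+2)^{\kappa}$; all memory not holding the input is initially $0$. -/

import Mathlib

open Filter Asymptotics

/-! ### Flows in capacitated directed graphs -/

/-- A directed graph with vertex set `Fin n`, arc set `Fin m` (an arc is given by its tail and its
head; parallel arcs are allowed) and non-negative integer capacities. -/
structure FlowNetwork (n m : ℕ) where
  tail : Fin m → Fin n
  head : Fin m → Fin n
  cap : Fin m → ℕ

namespace FlowNetwork

variable {n m : ℕ}

/-- Total flow entering `v` minus total flow leaving `v`. -/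
def netInflow (G : FlowNetwork n m) (f : Fin m → ℝ) (v : Fin n) : ℝ :=
  (∑ e with G.head e = v, f e) - ∑ e with G.tail e = v, f e

/-- `f` satisfies the flow conservation constraints with demand vector `d`. -/
def IsFlow (G : FlowNetwork n m) (d : Fin n → ℝ) (f : Fin m → ℝ) : Prop :=
  ∀ v, G.netInflow f v = d v

/-- The demand vector with `-1` at `s`, `1` at `t` and `0` elsewhere (used for `s ≠ t`). -/
def stDemand (s t : Fin n) (v : Fin n) : ℝ :=
  if v = s then -1 else if v = t then 1 else 0

/-- `f` is an `s`-`t` flow of value `F`. -/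
def IsSTFlow (G : FlowNetwork n m) (s t : Fin n) (f : Fin m → ℝ) (F : ℝ) : Prop :=
  0 ≤ F ∧ G.IsFlow (fun v => F * stDemand s t v) f

/-- The non-negativity and capacity constraints. -/
def Feasible (G : FlowNetwork n m) (f : Fin m → ℝ) : Prop :=
  ∀ e, 0 ≤ f e ∧ f e ≤ G.cap e

end FlowNetwork

/-- All entries of the vector are integers. -/
def IsIntegralVec {m : ℕ} (f : Fin m → ℝ) : Prop :=
  ∀ e, ∃ z : ℤ, f e = z

/-! ### A random access machine with word memory and real memory

A program manipulates finitely many registers and arrays of two kinds. Words are integers in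
`{0, …, W - 1}`, with arithmetic modulo the word range `W`; only words can be used as array indices.
Real cells hold real numbers, on which the machine can only perform addition, subtraction, floor and
comparison. Every primitive instruction and every evaluation of a test takes one step. -/

namespace RealRAM

/-- Memory contents. Registers and arrays are named by natural numbers, and the names are fixed in
the program: `wArr a i` is the `i`-th cell of the word array `a`. -/
structure State where
  /-- word registers -/
  wReg : ℕ → ℕ
  /-- real registers -/
  rReg : ℕ → ℝ
  /-- word arrays -/
  wArr : ℕ → ℕ → ℕ
  /-- real arrays -/
  rArr : ℕ → ℕ → ℝ

/-- Primitive instructions. The letters `x y z` stand for register names and `a` for an array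
name. -/
inductive Instr where
  /-- `x := k` (word constant) -/
  | wConst (x k : ℕ)
  /-- `x := y` (words) -/
  | wCopy (x y : ℕ)
  /-- `x := y + z` modulo the word range -/
  | wAdd (x y z : ℕ)
  /-- `x := y - z`, and `0` if `y < z` -/
  | wSub (x y z : ℕ)
  /-- `x := y * z` modulo the word range -/
  | wMul (x y z : ℕ)
  /-- `x := ⌊y / z⌋`, and `0` if `z = 0` -/
  | wDiv (x y z : ℕ)
  /-- `x := a[y]` (word array) -/
  | wLoad (x a y : ℕ)
  /-- `a[y] := x` (word array) -/
  | wStore (a y x : ℕ)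
  /-- `x := k` (real register, integer constant) -/
  | rConst (x : ℕ) (k : ℤ)
  /-- `x := y` (reals) -/
  | rCopy (x y : ℕ)
  /-- `x := y + z` (reals) -/
  | rAdd (x y z : ℕ)
  /-- `x := y - z` (reals) -/
  | rSub (x y z : ℕ)
  /-- `x := ⌊y⌋` (reals) -/
  | rFloor (x y : ℕ)
  /-- `x := a[y]` (real array, indexed by a word register) -/
  | rLoad (x a y : ℕ)
  /-- `a[y] := x` (real array, indexed by a word register) -/
  | rStore (a y x : ℕ)

namespace State

/-- Write `v` to the word register `x`. -/
def setW (σ : State) (x v : ℕ) : State :=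
  { σ with wReg := Function.update σ.wReg x v }

/-- Write `v` to the real register `x`. -/
noncomputable def setR (σ : State) (x : ℕ) (v : ℝ) : State :=
  { σ with rReg := Function.update σ.rReg x v }

/-- Write `v` to cell `i` of the word array `a`. -/
def setWArr (σ : State) (a i v : ℕ) : State :=
  { σ with wArr := Function.update σ.wArr a (Function.update (σ.wArr a) i v) }

/-- Write `v` to cell `i` of the real array `a`. -/
noncomputable def setRArr (σ : State) (a i : ℕ) (v : ℝ) : State :=
  { σ with rArr := Function.update σ.rArr a (Function.update (σ.rArr a) i v) }

end State

/-- Effect of a primitive instruction on a machine with word range `W`. -/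
noncomputable def Instr.exec (W : ℕ) : Instr → State → State
  | .wConst x k, σ => σ.setW x (k % W)
  | .wCopy x y, σ => σ.setW x (σ.wReg y)
  | .wAdd x y z, σ => σ.setW x ((σ.wReg y + σ.wReg z) % W)
  | .wSub x y z, σ => σ.setW x (σ.wReg y - σ.wReg z)
  | .wMul x y z, σ => σ.setW x ((σ.wReg y * σ.wReg z) % W)
  | .wDiv x y z, σ => σ.setW x (σ.wReg y / σ.wReg z)
  | .wLoad x a y, σ => σ.setW x (σ.wArr a (σ.wReg y))
  | .wStore a y x, σ => σ.setWArr a (σ.wReg y) (σ.wReg x)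
  | .rConst x k, σ => σ.setR x (k : ℝ)
  | .rCopy x y, σ => σ.setR x (σ.rReg y)
  | .rAdd x y z, σ => σ.setR x (σ.rReg y + σ.rReg z)
  | .rSub x y z, σ => σ.setR x (σ.rReg y - σ.rReg z)
  | .rFloor x y, σ => σ.setR x ((⌊σ.rReg y⌋ : ℤ) : ℝ)
  | .rLoad x a y, σ => σ.setR x (σ.rArr a (σ.wReg y))
  | .rStore a y x, σ => σ.setRArr a (σ.wReg y) (σ.rReg x)

/-- Tests on two registers of the same kind. -/
inductive Test where
  | wLt (x y : ℕ)
  | wEq (x y : ℕ)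
  | rLt (x y : ℕ)
  | rEq (x y : ℕ)
  | neg (b : Test)

/-- Truth of a test in a state. -/
def Test.Holds (σ : State) : Test → Prop
  | .wLt x y => σ.wReg x < σ.wReg y
  | .wEq x y => σ.wReg x = σ.wReg y
  | .rLt x y => σ.rReg x < σ.rReg y
  | .rEq x y => σ.rReg x = σ.rReg y
  | .neg b => ¬ Test.Holds σ b

/-- Programs: finite texts built from instructions by sequencing, branching and iteration. -/
inductive Program where
  | skip
  | instr (i : Instr)
  | seq (p q : Program)
  | ite (b : Test) (p q : Program)
  | loop (b : Test) (p : Program)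

/-- `Run W p σ k τ`: on a machine with word range `W`, the program `p` started in state `σ` halts in
state `τ` after exactly `k` steps. (`loop b p` repeats `p` as long as `b` holds.) -/
inductive Run (W : ℕ) : Program → State → ℕ → State → Prop where
  | skip (σ : State) : Run W .skip σ 0 σ
  | instr (i : Instr) (σ : State) : Run W (.instr i) σ 1 (i.exec W σ)
  | seq {p q : Program} {σ τ ρ : State} {k l : ℕ}
      (hp : Run W p σ k τ) (hq : Run W q τ l ρ) : Run W (.seq p q) σ (k + l) ρ
  | ite_true {b : Test} {p q : Program} {σ τ : State} {k : ℕ}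
      (hb : b.Holds σ) (hp : Run W p σ k τ) : Run W (.ite b p q) σ (k + 1) τ
  | ite_false {b : Test} {p q : Program} {σ τ : State} {k : ℕ}
      (hb : ¬ b.Holds σ) (hq : Run W q σ k τ) : Run W (.ite b p q) σ (k + 1) τ
  | loop_done {b : Test} {p : Program} {σ : State}
      (hb : ¬ b.Holds σ) : Run W (.loop b p) σ 1 σ
  | loop_step {b : Test} {p : Program} {σ τ ρ : State} {k l : ℕ}
      (hb : b.Holds σ) (hp : Run W p σ k τ) (hl : Run W (.loop b p) τ l ρ) :
      Run W (.loop b p) σ (k + 1 + l) ρ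

/-- The input: the word registers `0, 1, 2, 3` hold `n, m, s, t`; the word arrays `0` and `1` hold the
tails and the heads of the `m` arcs; the real arrays `0` and `1` hold the capacities and the given
flow. All the other cells are `0`. -/
noncomputable def inputState {n m : ℕ} (G : FlowNetwork n m) (s t : Fin n) (f : Fin m → ℝ) :
    State where
  wReg x :=
    if x = 0 then n else if x = 1 then m else if x = 2 then (s : ℕ) else if x = 3 then (t : ℕ) else 0
  rReg _ := 0
  wArr a i :=
    if h : i < m then
      if a = 0 then (G.tail ⟨i, h⟩ : ℕ) else if a = 1 then (G.head ⟨i, h⟩ : ℕ) else 0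
    else 0
  rArr a i :=
    if h : i < m then
      if a = 0 then (G.cap ⟨i, h⟩ : ℝ) else if a = 1 then f ⟨i, h⟩ else 0
    else 0

/-- The output: the first `m` cells of the real array `2`. -/
def output (m : ℕ) (σ : State) (e : Fin m) : ℝ := σ.rArr 2 e

end RealRAM

/-- `T` is soft-O of `g`, that is `T = O(g log^c g)` for some constant `c`. -/
def IsSoftO (T g : ℕ → ℝ) : Prop :=
  ∃ c : ℕ, T =O[atTop] fun m => g m * Real.log (g m) ^ c

/-!
# Rounding a fractional flow in time `O(m log m)`

Subtracting the roundings, the task becomes the following. Each arc `e` carries a flow between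
`⌊f e⌋` and `⌈f e⌉`, and is *active* if both inequalities are strict. If the active arcs form a
forest (directions ignored) and the flow is a circulation, then no arc is active: at a leaf of the
forest the single active arc would carry an integer (`integral_of_acyc`). A return arc from the sink
to the source makes the given flow a circulation. Hence it suffices to insert the arcs one after
another while keeping the active ones acyclic: if a new arc closes a cycle with the forest, one
pushes flow around the cycle until one of its arcs becomes integral. The return arc is inserted last,
and its flow is then only decreased, so that its final value is `⌊F⌋`.

To find the cycles fast, the insertions are treated by divide and conquer. Before a block of `h` arcs
is inserted, the present forest is *compressed* with respect to the at most `2 h` endpoints of these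
arcs (the terminals): leaves that are not terminals are pruned, and maximal paths whose inner
vertices are neither terminals nor branching vertices are replaced by single arcs, with the minimal
residual capacities in both directions. At most `4 h` paths remain, and they are all that the block
needs to know about the forest (`Represents`, `compress_spec`). Within the block the same is done
recursively for the halves. When the block is finished, the change of flow on each path is
transferred to the arcs on it (`wbLoop_spec`). A path whose residual capacity is exhausted contains
an arc that is exhausted too, so that the forest stays a forest (`Represents.acyc_lift`,
`WriteBack`). A block of one arc has its two endpoints as the only terminals, and there is at most
one path between them; it is enough to mark one endpoint and to protect the other from being pruned
(`insertArc_spec`). The work at a block is linear in its size, which gives `O(m log m)` in total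
(`visit_spec`).

The machine has no recursion; the traversal of the blocks is a single loop with an explicit stack,
whose invariant is `Level`. The compression works in linear time with the degree and the sum of the
incident arcs of each vertex: at a vertex of degree one, the sum is the number of its only arc.
Acyclicity is expressed linearly, by the absence of nonzero circulations (`Acyc`), so that no walks
or cycles have to be handled.

The memory is used as follows. Word arrays: `0` tails, `1` heads, `2` degrees, `3` sums of incident
arcs, `4` marks of the terminals, `5` pending paths at the vertices, `6` the path through an arc, `7`
the direction of the arc on it, `8` and `9` the stack. Real arrays: `0` capacities, `1` the given
flow, `2` the output, `3` and `4` the amounts by which the flow may be increased and decreased, `5`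
the change of flow. Word registers: `0` to `3` the input, `4` the constant `1`, `5` the number of
arcs, padded to a power of two, `6` the depth, `7` the size of the current block, `8` the position,
`9` the first free number for paths, `10` the run flag, `11` to `14` the ranges of the arcs of the
current block, `16` and `17` the block to be entered, `18` the constant `0`, `19` the next path, `20`
the loop variable; those above are scratch.
-/

set_option linter.unusedSimpArgs false

local infixr:60 " ;; " => RealRAM.Program.seq

namespace FlowRounding

/-! ### Acyclic sets of arcs -/

/-- Incidence of the arc `e`, with tails and heads given by `E₀` and `E₁`, at the vertex `v`: `1` at
the head, `-1` at the tail, and `0` if `e` is a loop. -/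
def bd (E₀ E₁ : ℕ → ℕ) (e v : ℕ) : ℝ :=
  (if E₁ e = v then 1 else 0) - (if E₀ e = v then 1 else 0)

/-- The arcs in `S` contain no cycle, even when directions are ignored: the only circulation
supported on `S` is zero. -/
def Acyc (E₀ E₁ : ℕ → ℕ) (S : Finset ℕ) : Prop :=
  ∀ c : ℕ → ℝ, (∀ v, ∑ e ∈ S, c e * bd E₀ E₁ e v = 0) → ∀ e ∈ S, c e = 0

lemma Acyc.subset {E₀ E₁ : ℕ → ℕ} {S R : Finset ℕ} (h : Acyc E₀ E₁ S) (hR : R ⊆ S) :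
    Acyc E₀ E₁ R := by
  classical
  intro c hc e he
  have := h (fun e => if e ∈ R then c e else 0) (fun v => by
    rw [← Finset.sum_subset hR (fun x _ hx => by simp [hx])]
    exact (Finset.sum_congr rfl fun e he => by simp [he]).trans (hc v)) e (hR he)
  simpa [he] using this

lemma bd_congr {E₀ E₁ E₀' E₁' : ℕ → ℕ} {e : ℕ} (h₀ : E₀' e = E₀ e) (h₁ : E₁' e = E₁ e) (v : ℕ) :
    bd E₀' E₁' e v = bd E₀ E₁ e v := by rw [bd, bd, h₀, h₁]

lemma Acyc.congr {E₀ E₁ E₀' E₁' : ℕ → ℕ} {S : Finset ℕ} (h : Acyc E₀ E₁ S)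
    (h₀ : ∀ e ∈ S, E₀' e = E₀ e) (h₁ : ∀ e ∈ S, E₁' e = E₁ e) : Acyc E₀' E₁' S :=
  fun c hc => h c fun v => by
    rw [← hc v]
    exact Finset.sum_congr rfl fun e he => by rw [bd_congr (h₀ e he) (h₁ e he)]

lemma Acyc.ne {E₀ E₁ : ℕ → ℕ} {S : Finset ℕ} (h : Acyc E₀ E₁ S) {e : ℕ} (he : e ∈ S) :
    E₀ e ≠ E₁ e := by
  intro heq
  have := h.subset (Finset.singleton_subset_iff.2 he) (fun _ => 1)
    (fun v => by rw [Finset.sum_singleton, bd, heq, sub_self, mul_zero]) e (by simp)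
  simp at this

/-- The arcs of `R` incident to `v`. -/
def inc (E₀ E₁ : ℕ → ℕ) (R : Finset ℕ) (v : ℕ) : Finset ℕ :=
  R.filter fun e => E₀ e = v ∨ E₁ e = v

lemma mem_inc {E₀ E₁ : ℕ → ℕ} {R : Finset ℕ} {v e : ℕ} :
    e ∈ inc E₀ E₁ R v ↔ e ∈ R ∧ (E₀ e = v ∨ E₁ e = v) := by simp [inc]

lemma sum_bd_eq_zero {E₀ E₁ : ℕ → ℕ} {V : Finset ℕ} {e : ℕ} (h₀ : E₀ e ∈ V) (h₁ : E₁ e ∈ V) :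
    ∑ v ∈ V, bd E₀ E₁ e v = 0 := by
  simp [bd, Finset.sum_sub_distrib, h₀, h₁]

/-- A nonempty forest has a leaf other than any prescribed vertex. Otherwise it would have at least
as many arcs as vertices, while its incidence vectors, lying in the hyperplane of vectors with sum
zero, are linearly independent. -/
lemma Acyc.exists_leaf {E₀ E₁ : ℕ → ℕ} {R : Finset ℕ} (h : Acyc E₀ E₁ R) (hne : R.Nonempty)
    (v₀ : ℕ) : ∃ v, v ≠ v₀ ∧ (inc E₀ E₁ R v).card = 1 := by
  classical
  by_contra! hno
  set V : Finset ℕ := R.image E₀ ∪ R.image E₁ with hV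
  have h0 : ∀ e ∈ R, E₀ e ∈ V := fun e he => Finset.mem_union_left _ (Finset.mem_image_of_mem _ he)
  have h1 : ∀ e ∈ R, E₁ e ∈ V := fun e he => Finset.mem_union_right _ (Finset.mem_image_of_mem _ he)
  have hpos : ∀ v ∈ V, 1 ≤ (inc E₀ E₁ R v).card := by
    intro v hv
    rw [Nat.one_le_iff_ne_zero, Finset.card_ne_zero]
    rcases Finset.mem_union.1 hv with hv | hv
    · obtain ⟨e, he, rfl⟩ := Finset.mem_image.1 hv
      exact ⟨e, mem_inc.2 ⟨he, .inl rfl⟩⟩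
    · obtain ⟨e, he, rfl⟩ := Finset.mem_image.1 hv
      exact ⟨e, mem_inc.2 ⟨he, .inr rfl⟩⟩
  obtain ⟨r, hr, hr2⟩ : ∃ r ∈ V, ∀ v ∈ V, v ≠ r → 2 ≤ (inc E₀ E₁ R v).card := by
    have key : ∀ v ∈ V, v ≠ v₀ → 2 ≤ (inc E₀ E₁ R v).card := fun v hv hv0 => by
      have := hpos v hv; have := hno v hv0; omega
    by_cases hv : v₀ ∈ V
    · exact ⟨v₀, hv, key⟩
    · obtain ⟨e, he⟩ := hne
      exact ⟨E₀ e, h0 e he, fun v hvV _ => key v hvV (fun h => hv (h ▸ hvV))⟩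
  have hdeg : ∑ v ∈ V, (inc E₀ E₁ R v).card = 2 * R.card := by
    have : ∀ v, (inc E₀ E₁ R v).card = ∑ e ∈ R, ((if E₀ e = v then 1 else 0) +
        (if E₁ e = v then 1 else 0)) := by
      intro v
      rw [inc, Finset.card_filter]
      refine Finset.sum_congr rfl fun e he => ?_
      have := h.ne he
      by_cases a : E₀ e = v <;> by_cases b : E₁ e = v <;> simp_all
    simp_rw [this]
    rw [Finset.sum_comm, mul_comm, ← smul_eq_mul, ← Finset.sum_const]
    refine Finset.sum_congr rfl fun e he => ?_
    rw [Finset.sum_add_distrib]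
    simp [h0 e he, h1 e he]
  have hcard : (V.erase r).card < R.card := by
    have h2 : 2 * (V.erase r).card + 1 ≤ 2 * R.card := by
      rw [← hdeg, ← Finset.sum_erase_add V _ hr]
      refine add_le_add ?_ (hpos r hr)
      rw [mul_comm, ← smul_eq_mul, ← Finset.sum_const]
      exact Finset.sum_le_sum fun v hv =>
        hr2 v (Finset.mem_of_mem_erase hv) (Finset.ne_of_mem_erase hv)
    omega
  let f : (R → ℝ) →ₗ[ℝ] (↥(V.erase r) → ℝ) :=
    { toFun := fun c v => ∑ e : R, c e * bd E₀ E₁ e v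
      map_add' := fun a b => by ext v; simp [add_mul, Finset.sum_add_distrib]
      map_smul' := fun a b => by ext v; simp [Finset.mul_sum, mul_assoc] }
  have hker : LinearMap.ker f ≠ ⊥ := LinearMap.ker_ne_bot_of_finrank_lt
    (by simpa [-Finset.card_erase_of_mem, -Finset.mem_erase] using hcard)
  obtain ⟨c, hc, hc0⟩ := Submodule.exists_mem_ne_zero_of_ne_bot hker
  apply hc0
  let c' : ℕ → ℝ := fun e => if he : e ∈ R then c ⟨e, he⟩ else 0
  have hsum : ∀ v, ∑ e ∈ R, c' e * bd E₀ E₁ e v = ∑ e : R, c e * bd E₀ E₁ e v := by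
    intro v
    rw [← Finset.sum_coe_sort R]
    exact Finset.sum_congr rfl fun e _ => by simp [c']
  have hz : ∀ v, v ≠ r → ∑ e ∈ R, c' e * bd E₀ E₁ e v = 0 := by
    intro v hv
    by_cases hvV : v ∈ V
    · rw [hsum]
      exact congrFun (LinearMap.mem_ker.1 hc) ⟨v, Finset.mem_erase.2 ⟨hv, hvV⟩⟩
    · refine Finset.sum_eq_zero fun e he => ?_
      have a : E₀ e ≠ v := fun h => hvV (h ▸ h0 e he)
      have b : E₁ e ≠ v := fun h => hvV (h ▸ h1 e he)
      simp [bd, a, b]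
  have hall := h c' (fun v => by
    by_cases hv : v = r
    · subst hv
      have : ∑ w ∈ V, ∑ e ∈ R, c' e * bd E₀ E₁ e w = 0 := by
        rw [Finset.sum_comm]
        refine Finset.sum_eq_zero fun e he => ?_
        rw [← Finset.mul_sum, sum_bd_eq_zero (h0 e he) (h1 e he), mul_zero]
      rwa [Finset.sum_eq_single_of_mem v hr (fun w _ hw => hz w hw)] at this
    · exact hz v hv)
  ext e
  simpa [c'] using hall e e.2

end FlowRounding

namespace RealRAM

/-! ### Clocked weakest preconditions -/

/-- The program `p`, started in `σ` with the clock at `k`, halts in a state and at a time satisfying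
`Q`. -/
def WP (W : ℕ) (p : Program) (Q : State → ℕ → Prop) (σ : State) (k : ℕ) : Prop :=
  ∃ l τ, Run W p σ l τ ∧ Q τ (k + l)

variable {W : ℕ} {Q : State → ℕ → Prop} {σ : State} {k : ℕ}

lemma WP.mono {p : Program} {Q Q' : State → ℕ → Prop} (h : WP W p Q σ k)
    (hQ : ∀ τ l, Q τ l → Q' τ l) : WP W p Q' σ k := by
  obtain ⟨l, τ, hr, hq⟩ := h
  exact ⟨l, τ, hr, hQ _ _ hq⟩

lemma WP_skip : WP W .skip Q σ k ↔ Q σ k := by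
  constructor
  · rintro ⟨l, τ, hr, hq⟩; cases hr; exact hq
  · exact fun h => ⟨0, σ, .skip σ, h⟩

lemma WP_instr {i : Instr} : WP W (.instr i) Q σ k ↔ Q (i.exec W σ) (k + 1) := by
  constructor
  · rintro ⟨l, τ, hr, hq⟩; cases hr; exact hq
  · exact fun h => ⟨1, _, .instr i σ, h⟩

lemma WP_seq {p q : Program} : WP W (.seq p q) Q σ k ↔ WP W p (WP W q Q) σ k := by
  constructor
  · rintro ⟨l, τ, hr, hq⟩
    cases hr with
    | seq hp hq' => exact ⟨_, _, hp, _, _, hq', by rwa [add_assoc]⟩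
  · rintro ⟨_, _, hp, _, _, hq', h⟩
    exact ⟨_, _, .seq hp hq', by rwa [← add_assoc]⟩

lemma WP_ite {b : Test} {p q : Program} : WP W (.ite b p q) Q σ k ↔
    (b.Holds σ → WP W p Q σ (k + 1)) ∧ (¬ b.Holds σ → WP W q Q σ (k + 1)) := by
  constructor
  · rintro ⟨l, τ, hr, h⟩
    cases hr with
    | ite_true hb hp =>
      exact ⟨fun _ => ⟨_, _, hp, by rwa [add_assoc, add_comm 1]⟩, fun h => absurd hb h⟩
    | ite_false hb hp =>
      exact ⟨fun h => absurd h hb, fun _ => ⟨_, _, hp, by rwa [add_assoc, add_comm 1]⟩⟩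
  · rintro ⟨h1, h2⟩
    by_cases hb : b.Holds σ
    · obtain ⟨l, τ, hr, h⟩ := h1 hb
      exact ⟨_, _, .ite_true hb hr, by rwa [add_comm l, ← add_assoc]⟩
    · obtain ⟨l, τ, hr, h⟩ := h2 hb
      exact ⟨_, _, .ite_false hb hr, by rwa [add_comm l, ← add_assoc]⟩

lemma WP_loop {b : Test} {p : Program} : WP W (.loop b p) Q σ k ↔
    (b.Holds σ → WP W p (WP W (.loop b p) Q) σ (k + 1)) ∧ (¬ b.Holds σ → Q σ (k + 1)) := by
  constructor
  · rintro ⟨l, τ, hr, h⟩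
    cases hr with
    | loop_done hb => exact ⟨fun h => absurd h hb, fun _ => h⟩
    | loop_step hb hp hl =>
      refine ⟨fun _ => ⟨_, _, hp, _, _, hl, ?_⟩, fun h => absurd hb h⟩
      convert h using 1; ring
  · rintro ⟨h1, h2⟩
    by_cases hb : b.Holds σ
    · obtain ⟨l, τ, hr, l', τ', hr', h⟩ := h1 hb
      refine ⟨_, _, .loop_step hb hr hr', ?_⟩
      convert h using 1; ring
    · exact ⟨_, _, .loop_done hb, h2 hb⟩

/-! ### Reading memory after writes -/

@[simp] lemma setW_wReg (σ : State) (x v y : ℕ) :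
    (σ.setW x v).wReg y = if y = x then v else σ.wReg y := by
  simp [State.setW, Function.update_apply]
@[simp] lemma setW_rReg (σ : State) (x v : ℕ) : (σ.setW x v).rReg = σ.rReg := rfl
@[simp] lemma setW_wArr (σ : State) (x v : ℕ) : (σ.setW x v).wArr = σ.wArr := rfl
@[simp] lemma setW_rArr (σ : State) (x v : ℕ) : (σ.setW x v).rArr = σ.rArr := rfl
@[simp] lemma setR_rReg (σ : State) (x : ℕ) (v : ℝ) (y : ℕ) :
    (σ.setR x v).rReg y = if y = x then v else σ.rReg y := by
  simp [State.setR, Function.update_apply]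
@[simp] lemma setR_wReg (σ : State) (x : ℕ) (v : ℝ) : (σ.setR x v).wReg = σ.wReg := rfl
@[simp] lemma setR_wArr (σ : State) (x : ℕ) (v : ℝ) : (σ.setR x v).wArr = σ.wArr := rfl
@[simp] lemma setR_rArr (σ : State) (x : ℕ) (v : ℝ) : (σ.setR x v).rArr = σ.rArr := rfl
@[simp] lemma setWArr_wArr (σ : State) (a i v b : ℕ) : (σ.setWArr a i v).wArr b =
    if b = a then Function.update (σ.wArr a) i v else σ.wArr b := by
  simp [State.setWArr, Function.update_apply]
@[simp] lemma setWArr_wReg (σ : State) (a i v : ℕ) : (σ.setWArr a i v).wReg = σ.wReg := rfl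
@[simp] lemma setWArr_rReg (σ : State) (a i v : ℕ) : (σ.setWArr a i v).rReg = σ.rReg := rfl
@[simp] lemma setWArr_rArr (σ : State) (a i v : ℕ) : (σ.setWArr a i v).rArr = σ.rArr := rfl
@[simp] lemma setRArr_rArr (σ : State) (a i : ℕ) (v : ℝ) (b : ℕ) : (σ.setRArr a i v).rArr b =
    if b = a then Function.update (σ.rArr a) i v else σ.rArr b := by
  simp [State.setRArr, Function.update_apply]
@[simp] lemma setRArr_wReg (σ : State) (a i : ℕ) (v : ℝ) : (σ.setRArr a i v).wReg = σ.wReg := rfl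
@[simp] lemma setRArr_rReg (σ : State) (a i : ℕ) (v : ℝ) : (σ.setRArr a i v).rReg = σ.rReg := rfl
@[simp] lemma setRArr_wArr (σ : State) (a i : ℕ) (v : ℝ) : (σ.setRArr a i v).wArr = σ.wArr := rfl

end RealRAM

namespace RealRAM

/-! ### Loops over ranges of indices -/

/-- Two states agree on the word registers below `19`; the registers from `19` on are scratch. -/
def Fr (σ τ : State) : Prop := ∀ r < 19, τ.wReg r = σ.wReg r

lemma Fr.refl (σ : State) : Fr σ σ := fun _ _ => rfl
lemma Fr.trans {σ τ ρ : State} (h : Fr σ τ) (h' : Fr τ ρ) : Fr σ ρ :=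
  fun r hr => (h' r hr).trans (h r hr)
lemma Fr.setW {σ τ : State} (h : Fr σ τ) {x v : ℕ} (hx : 19 ≤ x) : Fr σ (τ.setW x v) :=
  fun r hr => by rw [setW_wReg, if_neg (by omega), h r hr]

@[simp] lemma Fr_setW {σ τ : State} {x v : ℕ} (hx : 19 ≤ x) : Fr σ (τ.setW x v) ↔ Fr σ τ := by
  refine forall₂_congr fun r hr => ?_
  rw [setW_wReg, if_neg (by omega)]
@[simp] lemma Fr_setR {σ τ : State} {x : ℕ} {v : ℝ} : Fr σ (τ.setR x v) ↔ Fr σ τ := Iff.rfl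
@[simp] lemma Fr_setWArr {σ τ : State} {a i v : ℕ} : Fr σ (τ.setWArr a i v) ↔ Fr σ τ := Iff.rfl
@[simp] lemma Fr_setRArr {σ τ : State} {a i : ℕ} {v : ℝ} : Fr σ (τ.setRArr a i v) ↔ Fr σ τ :=
  Iff.rfl

variable {W : ℕ}

lemma WP.shift {p : Program} {Q : State → ℕ → Prop} {σ : State} {k : ℕ} (a : ℕ)
    (h : WP W p (fun τ l => Q τ (l + a)) σ k) : WP W p Q σ (k + a) := by
  obtain ⟨l, τ, hr, hq⟩ := h
  exact ⟨l, τ, hr, by rwa [add_right_comm]⟩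

/-- Repeat `body` for the values of register `20` from its current one up to register `y`
(exclusive). Register `4` holds the constant `1`. -/
def forTo (y : ℕ) (body : Program) : Program :=
  .loop (.wLt 20 y) (body ;; .instr (.wAdd 20 20 4))

/-- Repeat `body` for register `20` running from register `x` up to register `y` (exclusive). -/
def forRange (x y : ℕ) (body : Program) : Program :=
  .instr (.wCopy 20 x) ;; forTo y body

/-- Repeat `body` for register `20` running through the two ranges delimited by the registers
`11, 12` and `13, 14`. -/
def forEl (body : Program) : Program :=
  forRange 11 12 body ;; forRange 13 14 body

/-- Rule for a range loop. The invariant `J` refers to the set of indices already treated and to the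
clock. -/
lemma WP_forRange {J : Finset ℕ → State → ℕ → Prop} {body : Program} {σ : State} {k x y lo hi : ℕ}
    {T₀ : Finset ℕ} (hy : y < 19) (hx' : σ.wReg x = lo) (hy' : σ.wReg y = hi)
    (h4 : σ.wReg 4 = 1) (hW : hi < W) (hle : lo ≤ hi) (hdis : ∀ i ∈ Finset.Ico lo hi, i ∉ T₀)
    (hset : ∀ T τ l v, J T τ l → J T (τ.setW 20 v) l) (h0 : J T₀ σ k)
    (hbody : ∀ T τ l id, Fr σ τ → id ∈ Finset.Ico lo hi → id ∉ T → T ⊆ T₀ ∪ Finset.Ico lo hi →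
      τ.wReg 20 = id → J T τ l →
      WP W body (fun τ' l' => Fr τ τ' ∧ τ'.wReg 20 = id ∧ J (insert id T) τ' (l' + 1)) τ (l + 1)) :
    WP W (forRange x y body)
      (fun τ k' => Fr σ τ ∧ ∃ l, J (T₀ ∪ Finset.Ico lo hi) τ l ∧ k' = l + 2) σ k := by
  rw [forRange, WP_seq, WP_instr]
  have key : ∀ n i τ l, i + n = hi → lo ≤ i → Fr σ τ → τ.wReg 20 = i →
      J (T₀ ∪ Finset.Ico lo i) τ l →
      WP W (forTo y body) (fun τ k' => Fr σ τ ∧ ∃ l, J (T₀ ∪ Finset.Ico lo hi) τ l ∧ k' = l + 2)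
        τ (l + 1) := by
    intro n
    induction n with
    | zero =>
      intro i τ l hi' hlo hfr h20 hJ
      rw [forTo, WP_loop]
      refine ⟨fun h => ?_, fun _ => ⟨hfr, l, ?_, rfl⟩⟩
      · have h2 : τ.wReg 20 < τ.wReg y := h
        rw [h20, hfr y hy, hy'] at h2; omega
      · rwa [show hi = i by omega]
    | succ n ih =>
      intro i τ l hi' hlo hfr h20 hJ
      rw [forTo, WP_loop]
      refine ⟨fun _ => ?_, fun h => absurd (show τ.wReg 20 < τ.wReg y by
        rw [h20, hfr y hy, hy']; omega) h⟩
      rw [WP_seq]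
      have hnot : i ∉ T₀ ∪ Finset.Ico lo i := by
        have := hdis i (Finset.mem_Ico.2 ⟨hlo, by omega⟩)
        simp [this]
      have := hbody (T₀ ∪ Finset.Ico lo i) τ l i hfr (Finset.mem_Ico.2 ⟨hlo, by omega⟩) hnot
        (Finset.union_subset_union_right (Finset.Ico_subset_Ico_right (by omega))) h20 hJ
      refine WP.shift 1 (WP.mono this fun τ' l' => ?_)
      rintro ⟨hfr', h20', hJ'⟩
      rw [WP_instr]
      have h44 : τ'.wReg 4 = 1 := by rw [hfr' 4 (by norm_num), hfr 4 (by norm_num), h4]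
      have he : (Instr.wAdd 20 20 4).exec W τ' = τ'.setW 20 (i + 1) := by
        simp only [Instr.exec]
        rw [h20', h44, Nat.mod_eq_of_lt (by omega)]
      rw [he]
      refine ih (i + 1) _ _ (by omega) (by omega) ((hfr.trans hfr').setW (by norm_num))
        (by simp) (hset _ _ _ _ ?_)
      have : insert i (T₀ ∪ Finset.Ico lo i) = T₀ ∪ Finset.Ico lo (i + 1) := by
        rw [← Finset.union_insert, Finset.insert_Ico_right_eq_Ico_add_one hlo]
      rwa [← this]
  refine key (hi - lo) lo _ k (by omega) le_rfl ((Fr.refl σ).setW (by norm_num)) ?_ ?_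
  · simp [Instr.exec, hx']
  · simpa [Instr.exec] using hset _ _ _ _ h0

/-- The indices in the two ranges delimited by the registers `11, 12` and `13, 14`. -/
def El (σ : State) : Finset ℕ :=
  Finset.Ico (σ.wReg 11) (σ.wReg 12) ∪ Finset.Ico (σ.wReg 13) (σ.wReg 14)

lemma El_congr {σ τ : State} (h : Fr σ τ) : El τ = El σ := by
  simp only [El]
  rw [h 11 (by norm_num), h 12 (by norm_num), h 13 (by norm_num), h 14 (by norm_num)]

/-- The rule for loops over the two ranges of the current block. -/
lemma WP_forEl {J : Finset ℕ → State → ℕ → Prop} {body : Program} {σ : State} {k : ℕ}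
    (h4 : σ.wReg 4 = 1) (h12 : σ.wReg 12 < W) (h14 : σ.wReg 14 < W)
    (h11 : σ.wReg 11 ≤ σ.wReg 12) (h13 : σ.wReg 13 ≤ σ.wReg 14) (hd : σ.wReg 14 ≤ σ.wReg 11)
    (hset : ∀ T τ l v, J T τ l → J T (τ.setW 20 v) l) (h0 : J ∅ σ k)
    (hbody : ∀ T τ l id, Fr σ τ → id ∈ El σ → id ∉ T → T ⊆ El σ → τ.wReg 20 = id → J T τ l →
      WP W body (fun τ' l' => Fr τ τ' ∧ τ'.wReg 20 = id ∧ J (insert id T) τ' (l' + 1)) τ (l + 1)) :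
    WP W (forEl body) (fun τ k' => Fr σ τ ∧ ∃ l, J (El σ) τ l ∧ k' = l + 4) σ k := by
  rw [forEl, WP_seq]
  refine WP.mono (WP_forRange (T₀ := ∅) (by norm_num) rfl rfl h4 h12 h11 (by simp) hset h0 ?_) ?_
  · intro T τ l id hfr hid hT hTs h20 hJ
    exact hbody T τ l id hfr (Finset.mem_union_left _ hid) hT
      (hTs.trans (by rw [Finset.empty_union]; exact Finset.subset_union_left)) h20 hJ
  · rintro τ k' ⟨hfr, l, hJ, hk'⟩
    subst hk'
    refine WP.shift 2 (WP.mono (WP_forRange (T₀ := Finset.Ico (σ.wReg 11) (σ.wReg 12))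
      (by norm_num) rfl rfl (by rw [hfr 4 (by norm_num), h4]) (by rwa [hfr 14 (by norm_num)])
      (by rwa [hfr 14 (by norm_num), hfr 13 (by norm_num)]) ?_ hset
      (by rwa [Finset.empty_union] at hJ) ?_) ?_)
    · intro i hi
      rw [hfr 14 (by norm_num), hfr 13 (by norm_num)] at hi
      simp only [Finset.mem_Ico] at hi ⊢
      omega
    · intro T τ' l id hfr' hid hT hTs h20 hJ
      rw [hfr 14 (by norm_num), hfr 13 (by norm_num)] at hid hTs
      exact hbody T τ' l id (hfr.trans hfr') (Finset.mem_union_right _ hid) hT hTs h20 hJ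
    · rintro τ' k' ⟨hfr', l', hJ', rfl⟩
      refine ⟨hfr.trans hfr', l', ?_, rfl⟩
      rwa [hfr 14 (by norm_num), hfr 13 (by norm_num)] at hJ'

end RealRAM

namespace RealRAM
open FlowRounding

/-! ### The program -/

/-- Write the content of register `x` to the marks of both endpoints of the arc in register `20`. -/
def markBody (x : ℕ) : Program :=
  .instr (.wLoad 21 0 20) ;; .instr (.wStore 4 21 x) ;;
  .instr (.wLoad 21 1 20) ;; .instr (.wStore 4 21 x)

/-- Load the residual capacities of the arc in word register `x` into the real registers `1`
(forward) and `2` (backward). -/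
def loadRes (x : ℕ) : Program :=
  .instr (.rLoad 3 3 x) ;; .instr (.rLoad 4 4 x) ;; .instr (.rLoad 5 5 x) ;;
  .instr (.rSub 1 3 5) ;; .instr (.rAdd 2 4 5)

/-- Count the arc in register `20` at its endpoint in register `21`. -/
def degAdd : Program :=
  .instr (.wLoad 22 2 21) ;; .instr (.wAdd 22 22 4) ;; .instr (.wStore 2 21 22) ;;
  .instr (.wLoad 22 3 21) ;; .instr (.wAdd 22 22 20) ;; .instr (.wStore 3 21 22)

/-- Count the arc in register `20` at both endpoints if it is active. -/
def degBody : Program :=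
  loadRes 20 ;; .instr (.rConst 0 0) ;;
  .ite (.rLt 0 1) (.ite (.rLt 0 2)
    (.instr (.wLoad 21 0 20) ;; degAdd ;; .instr (.wLoad 21 1 20) ;; degAdd) .skip) .skip

/-- Detach the only remaining arc at the vertex in register `21`. The arc goes to register `23`, its
other endpoint to register `24`, its residual capacities away from and towards the vertex in
register `21` to the real registers `1` and `2`. -/
def detach : Program :=
  .instr (.wLoad 23 3 21) ;; .instr (.wLoad 24 0 23) ;; loadRes 23 ;;
  .ite (.wEq 24 21)
    (.instr (.wLoad 24 1 23) ;; .instr (.wStore 7 23 18))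
    (.instr (.wStore 7 23 4) ;; .instr (.rCopy 6 1) ;; .instr (.rCopy 1 2) ;;
      .instr (.rCopy 2 6)) ;;
  .instr (.wStore 2 21 18) ;; .instr (.wStore 3 21 18) ;;
  .instr (.wLoad 25 2 24) ;; .instr (.wSub 25 25 4) ;; .instr (.wStore 2 24 25) ;;
  .instr (.wLoad 25 3 24) ;; .instr (.wSub 25 25 23) ;; .instr (.wStore 3 24 25)

/-- Register the path in register `27` at its new end, the vertex in register `24`. -/
def arrive : Program :=
  .instr (.wLoad 26 4 24) ;;
  .ite (.wEq 26 18)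
    (.instr (.wLoad 26 5 24) ;;
      .ite (.wEq 26 18) (.instr (.wStore 5 24 27))
        (.instr (.wStore 5 24 18) ;; .instr (.wStore 4 24 4)))
    .skip

/-- Start a new path with the arc in register `23` at the vertex in register `21`. -/
def startPath : Program :=
  .instr (.wCopy 27 19) ;; .instr (.wAdd 19 19 4) ;; .instr (.wStore 0 27 21) ;;
  .instr (.rStore 3 27 1) ;; .instr (.rStore 4 27 2) ;; .instr (.rConst 0 0) ;;
  .instr (.rStore 5 27 0) ;; .instr (.wStore 6 23 27) ;; .instr (.wStore 1 27 24)

/-- Extend the path in register `27`, ending at the vertex in register `21`, by the arc in register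
`23`. -/
def extendPath : Program :=
  .instr (.wStore 5 21 18) ;; .instr (.rLoad 3 3 27) ;;
  .ite (.rLt 1 3) (.instr (.rStore 3 27 1)) .skip ;; .instr (.rLoad 4 4 27) ;;
  .ite (.rLt 2 4) (.instr (.rStore 4 27 2)) .skip ;; .instr (.wStore 6 23 27) ;;
  .instr (.wStore 1 27 24)

/-- Append the arc in register `23` to a path. -/
def attach : Program :=
  .instr (.wLoad 26 4 21) ;;
  .ite (.wEq 26 18)
    (.instr (.wLoad 27 5 21) ;; .ite (.wEq 27 18) .skip (extendPath ;; arrive))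
    (startPath ;; arrive)

/-- Prune leaves, starting at the vertex in register `21`. -/
def chase : Program :=
  .instr (.wLoad 22 2 21) ;;
  .loop (.wEq 22 4) (detach ;; attach ;; .instr (.wCopy 21 24) ;; .instr (.wLoad 22 2 21))

/-- Prune leaves, starting at the endpoints of the arc in register `20`. -/
def scanBody : Program :=
  .instr (.wLoad 21 0 20) ;; chase ;; .instr (.wLoad 21 1 20) ;; chase

/-- Reset the marks and the pending paths at the endpoints of the arc in register `20`. -/
def cleanBody : Program :=
  .instr (.wLoad 21 0 20) ;; .instr (.wStore 4 21 18) ;; .instr (.wStore 5 21 18) ;;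
  .instr (.wLoad 21 1 20) ;; .instr (.wStore 4 21 18) ;; .instr (.wStore 5 21 18)

/-- Compress the forest of active arcs in the current ranges to its paths between marked
vertices. -/
def compress : Program := forEl degBody ;; forEl scanBody ;; forEl cleanBody

/-- Transfer the change of flow on a path to the arc in register `20`, if it lies on one. -/
def wbBody : Program :=
  .instr (.wLoad 21 6 20) ;;
  .ite (.wEq 21 18) .skip
    (.instr (.wStore 6 20 18) ;; .instr (.rLoad 1 5 20) ;; .instr (.rLoad 2 5 21) ;;
      .instr (.wLoad 22 7 20) ;;
      .ite (.wEq 22 18) (.instr (.rAdd 1 1 2)) (.instr (.rSub 1 1 2)) ;;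
      .instr (.rStore 5 20 1))

/-- Cancel the cycle formed by the arc in register `8` and the path in register `9`. -/
def push : Program :=
  .instr (.rLoad 1 3 9) ;; .instr (.rLoad 2 4 8) ;;
  .ite (.rLt 1 2) .skip (.instr (.rCopy 1 2)) ;;
  .instr (.rStore 5 9 1) ;; .instr (.rConst 0 0) ;; .instr (.rSub 3 0 1) ;;
  .instr (.rStore 5 8 3)

/-- Mark the tail of the arc in register `8`, and keep its head from becoming a leaf. -/
def markEnds : Program :=
  .instr (.wLoad 21 0 8) ;; .instr (.wStore 4 21 4) ;;
  .instr (.wLoad 21 1 8) ;; .instr (.wConst 22 2) ;; .instr (.wStore 2 21 22)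

/-- Undo `markEnds`. -/
def unmarkEnds : Program :=
  .instr (.wLoad 21 0 8) ;; .instr (.wStore 4 21 18) ;;
  .instr (.wLoad 21 1 8) ;; .instr (.wStore 2 21 18)

/-- If there is a path from the tail to the head of the arc in register `8`, cancel the cycle. -/
def tryPush : Program :=
  .ite (.wLt 9 19) (.instr (.wLoad 22 1 9) ;; .ite (.wEq 22 21) push .skip) .skip

/-- Insert the active arc in register `8` into the forest. -/
def insertArc : Program :=
  markEnds ;; compress ;; unmarkEnds ;; tryPush ;; .instr (.wAdd 14 14 4) ;; forEl wbBody

/-- Treat a block consisting of one arc. -/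
def leaf : Program :=
  (.instr (.rLoad 1 3 8) ;; .instr (.rLoad 2 4 8) ;; .instr (.rConst 0 0) ;;
    .ite (.rLt 0 1) (.ite (.rLt 0 2) insertArc .skip) .skip) ;; .instr (.wAdd 8 8 4)

/-- Compute the size of the next half of the current block (register `16`) and its end (`17`). -/
def downPrep : Program :=
  .instr (.wConst 22 2) ;; .instr (.wDiv 16 7 22) ;; .instr (.wAdd 17 8 16)

/-- Push the next half of the current block, together with the paths built for it, on the stack. -/
def downPost : Program :=
  .instr (.wAdd 6 6 4) ;; .instr (.wStore 8 6 9) ;; .instr (.wStore 9 6 8) ;;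
  .instr (.wCopy 7 16) ;; .instr (.wCopy 9 19)

/-- Build the compressed forest for the next half of the current block, and descend to it. -/
def down : Program :=
  downPrep ;; forRange 8 17 (markBody 4) ;; compress ;; forRange 8 17 (markBody 18) ;; downPost

/-- Pop a block from the stack, and load the ranges of the block containing it. -/
def upPrep : Program :=
  .instr (.wLoad 9 8 6) ;; .instr (.wSub 6 6 4) ;; .instr (.wLoad 11 8 6) ;;
  .instr (.wCopy 12 9) ;; .instr (.wLoad 13 9 6)

/-- Return from a block to the block containing it. -/
def up : Program := upPrep ;; forEl wbBody ;; .instr (.wAdd 7 7 7)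

/-- Load the ranges of the current block, and its end into register `22`. -/
def visitPrep : Program :=
  .instr (.wLoad 11 8 6) ;; .instr (.wCopy 12 9) ;; .instr (.wLoad 13 9 6) ;;
  .instr (.wCopy 14 8) ;; .instr (.wAdd 22 13 7)

/-- One step of the traversal of the blocks. -/
def visitBody : Program :=
  visitPrep ;;
  .ite (.wLt 8 22)
    (.instr (.wCopy 19 9) ;; .ite (.wEq 7 4) leaf down)
    (.ite (.wEq 6 18) (.instr (.wCopy 10 18)) up)

/-- The traversal of the blocks. -/
def visitAll : Program := .loop (.wLt 18 10) visitBody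

/-- Prepare the arc in register `20`: store its capacities up to the next and down to the previous
integer, or round it if it is a loop, and accumulate the net inflow at the sink in real register
`10`. -/
def prepBody : Program :=
  .instr (.rLoad 1 1 20) ;; .instr (.rFloor 2 1) ;; .instr (.rConst 0 0) ;;
  .instr (.rSub 3 0 1) ;; .instr (.rFloor 3 3) ;; .instr (.rSub 3 0 3) ;;
  .instr (.rSub 3 3 1) ;; .instr (.rSub 4 1 2) ;;
  .instr (.wLoad 21 0 20) ;; .instr (.wLoad 22 1 20) ;;
  .ite (.wEq 21 22) (.instr (.rStore 1 20 2))
    (.instr (.rStore 3 20 3) ;; .instr (.rStore 4 20 4) ;;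
      .ite (.wEq 22 3) (.instr (.rAdd 10 10 1)) .skip ;;
      .ite (.wEq 21 3) (.instr (.rSub 10 10 1)) .skip)

/-- Add an arc from the sink to the source, carrying the value of the flow in real register `10`. Its
number is the last one, `M - 1` for `M` in register `5`. -/
def returnArc : Program :=
  .instr (.rFloor 2 10) ;; .instr (.rConst 0 0) ;;
  .instr (.rSub 3 0 10) ;; .instr (.rFloor 3 3) ;; .instr (.rSub 3 0 3) ;;
  .instr (.rSub 3 3 10) ;; .instr (.rSub 4 10 2) ;;
  .instr (.wSub 20 5 4) ;; .instr (.wStore 0 20 3) ;; .instr (.wStore 1 20 2) ;;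
  .instr (.rStore 3 20 3) ;; .instr (.rStore 4 20 4)

/-- Compute in register `5` the least power of two greater than the number of arcs. -/
def powerOfTwo : Program :=
  .instr (.wConst 4 1) ;; .instr (.wCopy 5 4) ;; .instr (.wAdd 22 1 4) ;;
  .loop (.wLt 5 22) (.instr (.wAdd 5 5 5))

/-- Output the flow on the arc in register `20`. -/
def outBody : Program :=
  .instr (.rLoad 1 1 20) ;; .instr (.rLoad 2 5 20) ;; .instr (.rAdd 1 1 2) ;;
  .instr (.rStore 2 20 1)

/-- The rounding program. -/
def roundFlow : Program :=
  powerOfTwo ;; forRange 18 1 prepBody ;; returnArc ;;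
  .instr (.wCopy 7 5) ;; .instr (.wCopy 9 5) ;; .instr (.wStore 8 6 5) ;;
  .instr (.wCopy 10 4) ;; visitAll ;; forRange 18 1 outBody

/-! ### Counting degrees -/

variable {W : ℕ}

/-- The amount by which the flow on the arc `e` can be increased. -/
def upRes (σ : State) (e : ℕ) : ℝ := σ.rArr 3 e - σ.rArr 5 e

/-- The amount by which the flow on the arc `e` can be decreased. -/
def dnRes (σ : State) (e : ℕ) : ℝ := σ.rArr 4 e + σ.rArr 5 e

/-- The active arcs in `T`: those whose flow can be both increased and decreased. -/
noncomputable def actS (σ : State) (T : Finset ℕ) : Finset ℕ :=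
  T.filter fun e => 0 < upRes σ e ∧ 0 < dnRes σ e

lemma mem_actS {σ : State} {T : Finset ℕ} {e : ℕ} :
    e ∈ actS σ T ↔ e ∈ T ∧ 0 < upRes σ e ∧ 0 < dnRes σ e := by simp [actS]

lemma actS_congr {σ τ : State} (h : τ.rArr = σ.rArr) (T : Finset ℕ) : actS τ T = actS σ T := by
  simp [actS, upRes, dnRes, h]

/-- The part of the memory that counting degrees leaves alone. -/
def SameButDeg (σ τ : State) : Prop :=
  (∀ a, a ≠ 2 → a ≠ 3 → τ.wArr a = σ.wArr a) ∧ τ.rArr = σ.rArr ∧ τ.wReg 19 = σ.wReg 19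

lemma inc_insert {E₀ E₁ : ℕ → ℕ} {R : Finset ℕ} {e v : ℕ} :
    inc E₀ E₁ (insert e R) v = if E₀ e = v ∨ E₁ e = v then insert e (inc E₀ E₁ R v)
      else inc E₀ E₁ R v := by
  simp only [inc, Finset.filter_insert]

/-- Counting degrees, starting from the counters `fk`. -/
lemma degLoop_spec {σ : State} {k : ℕ} {fk : ℕ → ℕ} (h4 : σ.wReg 4 = 1) (h12 : σ.wReg 12 < W)
    (h14 : σ.wReg 14 < W) (h11 : σ.wReg 11 ≤ σ.wReg 12) (h13 : σ.wReg 13 ≤ σ.wReg 14)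
    (hd : σ.wReg 14 ≤ σ.wReg 11) (hdeg : σ.wArr 2 = fk) (hsum : σ.wArr 3 = fun _ => 0)
    (hloop : ∀ e ∈ actS σ (El σ), σ.wArr 0 e ≠ σ.wArr 1 e)
    (hWd : ∀ v, fk v + (El σ).card < W) (hWs : ∑ e ∈ El σ, e < W) :
    WP W (forEl degBody) (fun τ k' => Fr σ τ ∧ SameButDeg σ τ ∧
      (∀ v, τ.wArr 2 v = fk v + (inc (σ.wArr 0) (σ.wArr 1) (actS σ (El σ)) v).card) ∧
      (∀ v, τ.wArr 3 v = ∑ e ∈ inc (σ.wArr 0) (σ.wArr 1) (actS σ (El σ)) v, e) ∧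
      k' ≤ k + 24 * (El σ).card + 4) σ k := by
  let J : Finset ℕ → State → ℕ → Prop := fun T τ l => SameButDeg σ τ ∧
      (∀ v, τ.wArr 2 v = fk v + (inc (σ.wArr 0) (σ.wArr 1) (actS σ T) v).card) ∧
      (∀ v, τ.wArr 3 v = ∑ e ∈ inc (σ.wArr 0) (σ.wArr 1) (actS σ T) v, e) ∧
      l ≤ k + 24 * T.card
  refine WP.mono (WP_forEl (J := J) h4 h12 h14 h11 h13 hd ?_ ?_ ?_) ?_
  · rintro T τ l v ⟨⟨h1, h2, h3⟩, h4, h5, h6⟩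
    exact ⟨⟨h1, h2, by simpa using h3⟩, h4, h5, h6⟩
  · refine ⟨⟨fun _ _ _ => rfl, rfl, rfl⟩, ?_, ?_, by simp⟩ <;> intro v <;> simp [actS, inc, hdeg, hsum]
  · rintro T τ l e hfr he heT hTE h20 ⟨⟨ha, hr, h19⟩, hJ2, hJ3, hl⟩
    have hcard : (insert e T).card = T.card + 1 := Finset.card_insert_of_notMem heT
    have hle : (insert e T).card ≤ (El σ).card :=
      Finset.card_le_card (Finset.insert_subset he hTE)
    have hins : actS σ (insert e T) = if 0 < upRes σ e ∧ 0 < dnRes σ e then insert e (actS σ T)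
        else actS σ T := by simp only [actS, Finset.filter_insert]
    have hd1 : ∀ v, fk v + (inc (σ.wArr 0) (σ.wArr 1) (actS σ T) v).card + 1 < W := by
      intro v
      have : (inc (σ.wArr 0) (σ.wArr 1) (actS σ T) v).card ≤ T.card :=
        (Finset.card_filter_le _ _).trans (Finset.card_filter_le _ _)
      have := hWd v
      omega
    have hs1 : ∀ v, (∑ e ∈ inc (σ.wArr 0) (σ.wArr 1) (actS σ T) v, e) + e < W := by
      intro v
      refine lt_of_le_of_lt ?_ hWs
      rw [add_comm, ← Finset.sum_insert (f := fun e => e)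
        (show e ∉ inc (σ.wArr 0) (σ.wArr 1) (actS σ T) v from fun h =>
          heT (mem_actS.1 (mem_inc.1 h).1).1)]
      refine Finset.sum_le_sum_of_subset (Finset.insert_subset he ?_)
      exact ((Finset.filter_subset _ _).trans (Finset.filter_subset _ _)).trans hTE
    have h4' : τ.wReg 4 = 1 := by rw [hfr 4 (by norm_num), h4]
    have hE0 : τ.wArr 0 = σ.wArr 0 := ha 0 (by norm_num) (by norm_num)
    have hE1 : τ.wArr 1 = σ.wArr 1 := ha 1 (by norm_num) (by norm_num)
    simp only [degBody, loadRes, degAdd, WP_seq, WP_instr, WP_ite, WP_skip, Instr.exec, Test.Holds]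
    refine ⟨fun h1 => ⟨fun h2 => ?_, fun h2 => ?_⟩, fun h1 => ?_⟩
    · simp [h20, hr] at h1 h2
      have hact : 0 < upRes σ e ∧ 0 < dnRes σ e := ⟨by simpa [upRes] using h1, h2⟩
      rw [if_pos hact] at hins
      have hne := hloop e (mem_actS.2 ⟨he, hact⟩)
      have heI : ∀ v, e ∉ inc (σ.wArr 0) (σ.wArr 1) (actS σ T) v := fun v h =>
          heT (mem_actS.1 (mem_inc.1 h).1).1
      refine ⟨by simp [Fr.refl], by simp [h20], ⟨fun a h2 h3 => by simp [h2, h3, ha],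
        by simp [hr], by simp [h19]⟩, fun v => ?_, fun v => ?_, by omega⟩
      · have hm : ∀ v, (fk v + (inc (σ.wArr 0) (σ.wArr 1) (actS σ T) v).card + 1) % W =
          fk v + (inc (σ.wArr 0) (σ.wArr 1) (actS σ T) v).card + 1 :=
            fun v => Nat.mod_eq_of_lt (hd1 v)
        simp only [hins, inc_insert]
        by_cases hv : v = σ.wArr 1 e
        · simp [h20, hE0, hE1, h4', hJ2, hv, Function.update_apply, hne.symm, hm,
            Finset.card_insert_of_notMem (heI _), add_assoc]
          rw [← add_assoc, hm, add_assoc]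
        · by_cases hv' : v = σ.wArr 0 e
          · simp [h20, hE0, hE1, h4', hJ2, hv', Function.update_apply, hne, hm,
              Finset.card_insert_of_notMem (heI _), add_assoc]
            rw [← add_assoc, hm, add_assoc]
          · simp [h20, hE0, hE1, h4', hJ2, hv, hv', Function.update_apply, Ne.symm hv,
              Ne.symm hv']
      · have hm : ∀ v, ((∑ e ∈ inc (σ.wArr 0) (σ.wArr 1) (actS σ T) v, e) + e) % W =
          (∑ e ∈ inc (σ.wArr 0) (σ.wArr 1) (actS σ T) v, e) + e :=
            fun v => Nat.mod_eq_of_lt (hs1 v)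
        simp only [hins, inc_insert]
        by_cases hv : v = σ.wArr 1 e
        · simp [h20, hE0, hE1, h4', hJ3, hv, Function.update_apply, hne.symm, hm,
            Finset.sum_insert (heI _), add_comm]
          rw [add_comm, hm, add_comm]
        · by_cases hv' : v = σ.wArr 0 e
          · simp [h20, hE0, hE1, h4', hJ3, hv', Function.update_apply, hne, hm,
              Finset.sum_insert (heI _), add_comm]
            rw [add_comm, hm, add_comm]
          · simp [h20, hE0, hE1, h4', hJ3, hv, hv', Function.update_apply, Ne.symm hv,
              Ne.symm hv']
    · have hact : ¬ (0 < upRes σ e ∧ 0 < dnRes σ e) := fun h => h2 (by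
        simpa [h20, hr, dnRes] using h.2)
      rw [if_neg hact] at hins
      refine ⟨by simp [Fr.refl], by simp [h20], ⟨fun a h2 h3 => by simp [h2, h3, ha],
        by simp [hr], by simp [h19]⟩, fun v => ?_, fun v => ?_, by omega⟩
      · simp [hJ2, hins]
      · simp [hJ3, hins]
    · have hact : ¬ (0 < upRes σ e ∧ 0 < dnRes σ e) := fun h => h1 (by
        simpa [h20, hr, upRes] using h.1)
      rw [if_neg hact] at hins
      refine ⟨by simp [Fr.refl], by simp [h20], ⟨fun a h2 h3 => by simp [h2, h3, ha],
        by simp [hr], by simp [h19]⟩, fun v => ?_, fun v => ?_, by omega⟩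
      · simp [hJ2, hins]
      · simp [hJ3, hins]
  · rintro τ k' ⟨hfr, l, ⟨h1, h2, h3, h4⟩, rfl⟩
    exact ⟨hfr, h1, h2, h3, by omega⟩

end RealRAM

namespace FlowRounding

/-! ### Compressing a forest to paths -/

/-- The direction in which the path through the arc `e` traverses it, as a sign. -/
def sgn (dir : ℕ → ℕ) (e : ℕ) : ℝ := if dir e = 0 then 1 else -1

lemma sgn_mul_self (dir : ℕ → ℕ) (e : ℕ) : sgn dir e * sgn dir e = 1 := by
  unfold sgn; split_ifs <;> norm_num

/-- The flow on the arcs induced by a flow `y` on the paths, where `par e` is the number of the path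
through `e`, or `0` if there is none. -/
def pull (par dir : ℕ → ℕ) (y : ℕ → ℝ) (e : ℕ) : ℝ :=
  if par e = 0 then 0 else sgn dir e * y (par e)

/-- The capacity of `e` in the direction of the path through it, given its capacities `up` forward
and `dn` backward. -/
def along (dir : ℕ → ℕ) (up dn : ℕ → ℝ) (e : ℕ) : ℝ := if dir e = 0 then up e else dn e

/-- The set `C` of paths, with start vertices `T`, end vertices `H` and capacities `A` forward and `B`
backward, represents the set `P` of pruned arcs of the forest `Act`: flows on the paths induce flows
on `P` with the same net inflows, every flow on `Act` conserved at the vertices satisfying `ok` is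
so induced, and the capacities of a path are the minimal capacities of its arcs. -/
structure Represents (E₀ E₁ : ℕ → ℕ) (up dn : ℕ → ℝ) (Act : Finset ℕ) (ok : ℕ → Prop)
    (P C : Finset ℕ) (T H par dir : ℕ → ℕ) (A B : ℕ → ℝ) : Prop where
  sub : P ⊆ Act
  par_mem : ∀ e ∈ P, par e = 0 ∨ par e ∈ C
  fwd : ∀ (y : ℕ → ℝ) (v : ℕ),
    ∑ e ∈ P, pull par dir y e * bd E₀ E₁ e v = ∑ s ∈ C, y s * bd T H s v
  bwd : ∀ c : ℕ → ℝ, (∀ v, ok v → ∑ e ∈ Act, c e * bd E₀ E₁ e v = 0) →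
    ∃ y : ℕ → ℝ, ∀ e ∈ P, c e = pull par dir y e
  pos : ∀ s ∈ C, 0 < A s ∧ 0 < B s
  cap : ∀ e ∈ P, par e ≠ 0 → A (par e) ≤ along dir up dn e ∧ B (par e) ≤ along dir dn up e
  attA : ∀ s ∈ C, ∃ e ∈ P, par e = s ∧ A s = along dir up dn e
  attB : ∀ s ∈ C, ∃ e ∈ P, par e = s ∧ B s = along dir dn up e

/-- The arc `e`, when traversed in direction `dir e`, goes from `a` to `b` and has capacity `r₁`
forward and `r₂` backward. -/
structure Oriented (E₀ E₁ : ℕ → ℕ) (up dn : ℕ → ℝ) (dir : ℕ → ℕ) (e a b : ℕ) (r₁ r₂ : ℝ) :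
    Prop where
  ne : a ≠ b
  bd : ∀ v, sgn dir e * bd E₀ E₁ e v = (if b = v then 1 else 0) - (if a = v then 1 else 0)
  inc_left : E₀ e = a ∨ E₁ e = a
  inc_right : E₀ e = b ∨ E₁ e = b
  fwd : r₁ = along dir up dn e
  bwd : r₂ = along dir dn up e

variable {E₀ E₁ : ℕ → ℕ} {up dn : ℕ → ℝ} {Act : Finset ℕ} {ok : ℕ → Prop} {P C : Finset ℕ}
  {T H par dir : ℕ → ℕ} {A B : ℕ → ℝ} {e s a b : ℕ} {r₁ r₂ : ℝ}

lemma pull_congr {par' dir' : ℕ → ℕ} {y y' : ℕ → ℝ} {e : ℕ} (h1 : par' e = par e)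
    (h2 : dir' e = dir e) (h3 : par e ≠ 0 → y' (par e) = y (par e)) :
    pull par' dir' y' e = pull par dir y e := by
  unfold pull sgn
  rw [h1, h2]
  split_ifs with h <;> simp_all

/-- At a vertex that is left by pruning `e`, the flow on the paths ending there goes on through
`e`. -/
lemma Represents.sum_at (h : Represents E₀ E₁ up dn Act ok P C T H par dir A B)
    (ho : Oriented E₀ E₁ up dn dir e a b r₁ r₂) (he : e ∈ Act) (heP : e ∉ P)
    (honly : ∀ e' ∈ Act, e' ∉ P → e' ≠ e → E₀ e' ≠ a ∧ E₁ e' ≠ a)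
    {c y : ℕ → ℝ} (hc : ∑ e ∈ Act, c e * bd E₀ E₁ e a = 0)
    (hy : ∀ e ∈ P, c e = pull par dir y e) :
    c e = sgn dir e * ∑ s ∈ C, y s * bd T H s a := by
  rw [← h.fwd]
  have h1 : ∑ e' ∈ Act, c e' * bd E₀ E₁ e' a =
      ∑ e' ∈ insert e P, c e' * bd E₀ E₁ e' a := by
    refine (Finset.sum_subset (Finset.insert_subset he h.sub) fun e' h1 h2 => ?_).symm
    rw [Finset.mem_insert, not_or] at h2
    obtain ⟨h3, h4⟩ := honly e' h1 h2.2 h2.1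
    simp [bd, h3, h4]
  rw [h1, Finset.sum_insert heP] at hc
  have h2 := ho.bd a
  rw [if_neg ho.ne.symm, if_pos rfl] at h2
  have h3 : ∑ e ∈ P, pull par dir y e * bd E₀ E₁ e a = ∑ e ∈ P, c e * bd E₀ E₁ e a :=
    Finset.sum_congr rfl fun e he => by rw [hy e he]
  rw [h3]
  linear_combination c e * h2 - sgn dir e * hc

lemma Represents.congr (h : Represents E₀ E₁ up dn Act ok P C T H par dir A B)
    {T' H' par' dir' : ℕ → ℕ} {A' B' : ℕ → ℝ} (hpar : ∀ e ∈ P, par' e = par e)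
    (hdir : ∀ e ∈ P, dir' e = dir e) (hT : ∀ s ∈ C, T' s = T s) (hH : ∀ s ∈ C, H' s = H s)
    (hA : ∀ s ∈ C, A' s = A s) (hB : ∀ s ∈ C, B' s = B s) :
    Represents E₀ E₁ up dn Act ok P C T' H' par' dir' A' B' := by
  have hal : ∀ u d, ∀ e ∈ P, along dir' u d e = along dir u d e := fun u d e he => by
    rw [along, along, hdir e he]
  have hpl : ∀ y, ∀ e ∈ P, pull par' dir' y e = pull par dir y e := fun y e he =>
    pull_congr (hpar e he) (hdir e he) fun _ => rfl
  refine ⟨h.sub, fun e he => ?_, fun y v => ?_, fun c hc => ?_, fun s hs => ?_, fun e he h0 => ?_,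
    fun s hs => ?_, fun s hs => ?_⟩
  · rw [hpar e he]; exact h.par_mem e he
  · rw [Finset.sum_congr rfl fun e he => by rw [hpl y e he], h.fwd]
    exact Finset.sum_congr rfl fun s hs => by rw [bd, bd, hT s hs, hH s hs]
  · obtain ⟨y, hy⟩ := h.bwd c hc
    exact ⟨y, fun e he => (hy e he).trans (hpl y e he).symm⟩
  · rw [hA s hs, hB s hs]; exact h.pos s hs
  · rw [hpar e he] at h0 ⊢
    have hs := (h.par_mem e he).resolve_left h0
    rw [hal _ _ e he, hal _ _ e he, hA _ hs, hB _ hs]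
    exact h.cap e he h0
  · obtain ⟨e, he, hp, hA'⟩ := h.attA s hs
    exact ⟨e, he, (hpar e he).trans hp, by rw [hA s hs, hal _ _ e he, hA']⟩
  · obtain ⟨e, he, hp, hB'⟩ := h.attB s hs
    exact ⟨e, he, (hpar e he).trans hp, by rw [hB s hs, hal _ _ e he, hB']⟩

/-- A new path, consisting of the arc `e` only, starts at `a`. -/
lemma Represents.start (h : Represents E₀ E₁ up dn Act ok P C T H par dir A B)
    (ho : Oriented E₀ E₁ up dn dir e a b r₁ r₂) (he : e ∈ Act) (heP : e ∉ P) (hs : s ∉ C)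
    (hs0 : s ≠ 0) (h1 : 0 < r₁) (h2 : 0 < r₂) :
    Represents E₀ E₁ up dn Act ok (insert e P) (insert s C) (Function.update T s a)
      (Function.update H s b) (Function.update par e s) dir (Function.update A s r₁)
      (Function.update B s r₂) := by
  have hneP : ∀ e' ∈ P, e' ≠ e := fun e' h h' => heP (h' ▸ h)
  have hneC : ∀ s' ∈ C, s' ≠ s := fun e' h h' => hs (h' ▸ h)
  have hpar : ∀ e' ∈ P, par e' ≠ s := fun e' h' h'' =>
    (h.par_mem e' h').elim (fun h => hs0 (h''.symm.trans h)) (fun h => hs (h'' ▸ h))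
  refine ⟨Finset.insert_subset he h.sub, ?_, ?_, ?_, ?_, ?_, ?_, ?_⟩
  · intro e' he'
    rcases Finset.mem_insert.1 he' with rfl | he'
    · simp
    · simp only [Function.update_of_ne (hneP e' he'), Finset.mem_insert]
      exact (h.par_mem e' he').imp_right .inr
  · intro y v
    rw [Finset.sum_insert heP, Finset.sum_insert hs]
    congr 1
    · simp only [pull, Function.update_self, if_neg hs0, bd]
      have := ho.bd v
      simp only [bd] at this
      linear_combination y s * this
    · trans ∑ e ∈ P, pull par dir y e * bd E₀ E₁ e v
      · refine Finset.sum_congr rfl fun e' he' => ?_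
        rw [pull_congr (Function.update_of_ne (hneP e' he') _ _) rfl (fun _ => rfl)]
      · rw [h.fwd]
        refine Finset.sum_congr rfl fun s' hs' => ?_
        simp [bd, Function.update_of_ne (hneC s' hs')]
  · intro c hc
    obtain ⟨y, hy⟩ := h.bwd c hc
    refine ⟨Function.update y s (sgn dir e * c e), fun e' he' => ?_⟩
    rcases Finset.mem_insert.1 he' with rfl | he'
    · simp only [pull, Function.update_self, if_neg hs0]
      rw [← mul_assoc, sgn_mul_self, one_mul]
    · rw [hy e' he', pull_congr (Function.update_of_ne (hneP e' he') _ _) rfl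
        (fun _ => Function.update_of_ne (hpar e' he') _ _)]
  · intro s' hs'
    rcases Finset.mem_insert.1 hs' with rfl | hs'
    · simp [h1, h2]
    · simpa [Function.update_of_ne (hneC s' hs')] using h.pos s' hs'
  · intro e' he' h0
    rcases Finset.mem_insert.1 he' with rfl | he'
    · simp [ho.fwd, ho.bwd]
    · rw [Function.update_of_ne (hneP e' he')] at h0
      simpa [Function.update_of_ne (hneP e' he'), Function.update_of_ne (hpar e' he')]
        using h.cap e' he' h0
  · intro s' hs'
    rcases Finset.mem_insert.1 hs' with rfl | hs'
    · exact ⟨e, Finset.mem_insert_self _ _, by simp, by simp [ho.fwd]⟩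
    · obtain ⟨e', he', hp, hA⟩ := h.attA s' hs'
      refine ⟨e', Finset.mem_insert_of_mem he', ?_, ?_⟩
      · rwa [Function.update_of_ne (hneP e' he')]
      · rw [Function.update_of_ne (hneC s' hs'), hA]
  · intro s' hs'
    rcases Finset.mem_insert.1 hs' with rfl | hs'
    · exact ⟨e, Finset.mem_insert_self _ _, by simp, by simp [ho.bwd]⟩
    · obtain ⟨e', he', hp, hA⟩ := h.attB s' hs'
      refine ⟨e', Finset.mem_insert_of_mem he', ?_, ?_⟩
      · rwa [Function.update_of_ne (hneP e' he')]
      · rw [Function.update_of_ne (hneC s' hs'), hA]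

/-- The only path at the vertex `a` ends there, and `e` is the only other arc: the path is extended by
`e`, and its capacities become the minima. -/
lemma Represents.extend (h : Represents E₀ E₁ up dn Act ok P C T H par dir A B)
    (ho : Oriented E₀ E₁ up dn dir e a b r₁ r₂) (he : e ∈ Act) (heP : e ∉ P) (hs : s ∈ C)
    (hs0 : s ≠ 0) (h1 : 0 < r₁) (h2 : 0 < r₂) (hok : ok a)
    (honly : ∀ e' ∈ Act, e' ∉ P → e' ≠ e → E₀ e' ≠ a ∧ E₁ e' ≠ a)
    (hT : ∀ s' ∈ C, T s' ≠ a) (hHs : H s = a) (hH : ∀ s' ∈ C, s' ≠ s → H s' ≠ a) :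
    Represents E₀ E₁ up dn Act ok (insert e P) C T
      (Function.update H s b) (Function.update par e s) dir (Function.update A s (min r₁ (A s)))
      (Function.update B s (min r₂ (B s))) := by
  have hneP : ∀ e' ∈ P, e' ≠ e := fun e' h h' => heP (h' ▸ h)
  refine ⟨Finset.insert_subset he h.sub, ?_, ?_, ?_, ?_, ?_, ?_, ?_⟩
  · intro e' he'
    rcases Finset.mem_insert.1 he' with rfl | he'
    · simp [hs]
    · simpa only [Function.update_of_ne (hneP e' he')] using h.par_mem e' he'
  · intro y v
    rw [Finset.sum_insert heP]
    have e1 : ∑ x ∈ P, pull (Function.update par e s) dir y x * bd E₀ E₁ x v =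
        ∑ s ∈ C, y s * bd T H s v := by
      rw [← h.fwd]
      refine Finset.sum_congr rfl fun e' he' => ?_
      rw [pull_congr (Function.update_of_ne (hneP e' he') _ _) rfl (fun _ => rfl)]
    rw [e1, ← Finset.add_sum_erase C _ hs, ← Finset.add_sum_erase C _ hs, ← add_assoc]
    congr 1
    · simp only [pull, Function.update_self, if_neg hs0, bd]
      have := ho.bd v
      simp only [bd] at this
      rw [hHs]
      linear_combination y s * this
    · refine Finset.sum_congr rfl fun s' hs' => ?_
      simp [bd, Function.update_of_ne (Finset.ne_of_mem_erase hs')]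
  · intro c hc
    obtain ⟨y, hy⟩ := h.bwd c hc
    refine ⟨y, fun e' he' => ?_⟩
    rcases Finset.mem_insert.1 he' with rfl | he'
    · rw [h.sum_at ho he heP honly (hc a hok) hy, Finset.sum_eq_single_of_mem s hs]
      · simp [pull, hs0, bd, hHs, hT s hs]
      · intro s' hs' hne
        simp [bd, hT s' hs', hH s' hs' hne]
    · rw [hy e' he', pull_congr (Function.update_of_ne (hneP e' he') _ _) rfl
        (fun _ => rfl)]
  · intro s' hs'
    by_cases hss : s' = s
    · subst hss
      simp [h1, h2, h.pos s' hs']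
    · simpa [Function.update_of_ne hss] using h.pos s' hs'
  · intro e' he' h0
    rcases Finset.mem_insert.1 he' with rfl | he'
    · simp [ho.fwd, ho.bwd]
    · rw [Function.update_of_ne (hneP e' he')] at h0
      have h3 := h.cap e' he' h0
      rw [Function.update_of_ne (hneP e' he')]
      by_cases hp : par e' = s
      · rw [hp] at h3 ⊢
        simp only [Function.update_self]
        exact ⟨(min_le_right _ _).trans h3.1, (min_le_right _ _).trans h3.2⟩
      · simpa [Function.update_of_ne hp] using h3
  · intro s' hs'
    obtain ⟨e', he', hp, hA⟩ := h.attA s' hs'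
    by_cases hss : s' = s
    · subst hss
      rcases le_total r₁ (A s') with hle | hle
      · exact ⟨e, Finset.mem_insert_self _ _, by simp, by simp [← ho.fwd, hle]⟩
      · refine ⟨e', Finset.mem_insert_of_mem he', ?_, ?_⟩
        · rwa [Function.update_of_ne (hneP e' he')]
        · rw [Function.update_self, min_eq_right hle, hA]
    · refine ⟨e', Finset.mem_insert_of_mem he', ?_, ?_⟩
      · rwa [Function.update_of_ne (hneP e' he')]
      · rw [Function.update_of_ne hss, hA]
  · intro s' hs'
    obtain ⟨e', he', hp, hA⟩ := h.attB s' hs'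
    by_cases hss : s' = s
    · subst hss
      rcases le_total r₂ (B s') with hle | hle
      · exact ⟨e, Finset.mem_insert_self _ _, by simp, by simp [← ho.bwd, hle]⟩
      · refine ⟨e', Finset.mem_insert_of_mem he', ?_, ?_⟩
        · rwa [Function.update_of_ne (hneP e' he')]
        · rw [Function.update_self, min_eq_right hle, hA]
    · refine ⟨e', Finset.mem_insert_of_mem he', ?_, ?_⟩
      · rwa [Function.update_of_ne (hneP e' he')]
      · rw [Function.update_of_ne hss, hA]

/-- No path has an end at the vertex `a`, and `e` is its only remaining arc: every flow conserved at
`a` vanishes on `e`. -/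
lemma Represents.dangle (h : Represents E₀ E₁ up dn Act ok P C T H par dir A B)
    (ho : Oriented E₀ E₁ up dn dir e a b r₁ r₂) (he : e ∈ Act) (heP : e ∉ P)
    (hpar : par e = 0) (hok : ok a)
    (honly : ∀ e' ∈ Act, e' ∉ P → e' ≠ e → E₀ e' ≠ a ∧ E₁ e' ≠ a)
    (hT : ∀ s' ∈ C, T s' ≠ a) (hH : ∀ s' ∈ C, H s' ≠ a) :
    Represents E₀ E₁ up dn Act ok (insert e P) C T H par dir A B := by
  refine ⟨Finset.insert_subset he h.sub, ?_, ?_, ?_, h.pos, ?_, ?_, ?_⟩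
  · intro e' he'
    rcases Finset.mem_insert.1 he' with rfl | he'
    · exact .inl hpar
    · exact h.par_mem e' he'
  · intro y v
    rw [Finset.sum_insert heP, ← h.fwd]
    simp only [pull, hpar, if_true, zero_mul, zero_add]
  · intro c hc
    obtain ⟨y, hy⟩ := h.bwd c hc
    refine ⟨y, fun e' he' => ?_⟩
    rcases Finset.mem_insert.1 he' with rfl | he'
    · rw [h.sum_at ho he heP honly (hc a hok) hy, Finset.sum_eq_zero]
      · simp [pull, hpar]
      · intro s' hs'
        simp [bd, hT s' hs', hH s' hs']
    · rw [hy e' he', pull_congr rfl rfl (fun _ => rfl)]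
  · intro e' he' h0
    rcases Finset.mem_insert.1 he' with rfl | he'
    · exact absurd hpar h0
    · exact h.cap e' he' h0
  · intro s' hs'
    obtain ⟨e', he', hp, hA⟩ := h.attA s' hs'
    exact ⟨e', Finset.mem_insert_of_mem he', hp, hA⟩
  · intro s' hs'
    obtain ⟨e', he', hp, hA⟩ := h.attB s' hs'
    exact ⟨e', Finset.mem_insert_of_mem he', hp, hA⟩

/-- Bookkeeping while a forest is pruned. The vertices with a mark (`key`) are the terminals `K₀` and
those where paths have met; they are where paths start and end. A path ending at an unmarked vertex
is pending there (`pend`), unless it is the path in `X`, which has just been extended. -/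
structure Bookkeeping (E₀ E₁ : ℕ → ℕ) (Act K₀ P C X : Finset ℕ) (T H key pend : ℕ → ℕ) : Prop where
  key_start : ∀ s ∈ C, key (T s) ≠ 0
  pend_end : ∀ s ∈ C, s ∉ X → key (H s) = 0 → pend (H s) = s
  pend_spec : ∀ v, pend v ≠ 0 → key v = 0 ∧ pend v ∈ C ∧ pend v ∉ X ∧ H (pend v) = v
  key_term : ∀ v ∈ K₀, key v ≠ 0
  inj : Set.InjOn T C
  done : ∀ s ∈ C, ∀ e ∈ Act, e ∉ P → E₀ e ≠ T s ∧ E₁ e ≠ T s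
  key_loc : ∀ v, key v ≠ 0 → v ∈ K₀ ∨ ∃ e ∈ Act, E₀ e = v ∨ E₁ e = v
  pend_loc : ∀ v, pend v ≠ 0 → ∃ e ∈ Act, E₀ e = v ∨ E₁ e = v
  count : ∃ K Q : Finset ℕ, (∀ v, key v ≠ 0 ↔ v ∈ K) ∧ (∀ v, pend v ≠ 0 ↔ v ∈ Q) ∧
    2 * K.card + Q.card + X.card ≤ 2 * K₀.card + C.card ∧ K.card + 1 ≤ 2 * K₀.card

variable {K₀ : Finset ℕ} {key pend : ℕ → ℕ}

/-- There are fewer than `2 |K₀|` paths, since each marked vertex is the start of at most one of them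
and each mark that is not a terminal comes from two paths that meet. -/
lemma Bookkeeping.card_le {X : Finset ℕ} (h : Bookkeeping E₀ E₁ Act K₀ P C X T H key pend) :
    C.card + 1 ≤ 2 * K₀.card := by
  obtain ⟨K, Q, hK, hQ, h1, h2⟩ := h.count
  have : C.card ≤ K.card := Finset.card_le_card_of_injOn T
    (fun s hs => (hK _).1 (h.key_start s hs)) h.inj
  omega

lemma Bookkeeping.start (h : Bookkeeping E₀ E₁ Act K₀ P C ∅ T H key pend) (he : e ∈ Act)
    (heP : e ∉ P) (hea : E₀ e = a ∨ E₁ e = a)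
    (honly : ∀ e' ∈ Act, e' ∉ P → e' ≠ e → E₀ e' ≠ a ∧ E₁ e' ≠ a)
    (hkey : key a ≠ 0) (hs : s ∉ C) :
    Bookkeeping E₀ E₁ Act K₀ (insert e P) (insert s C) {s} (Function.update T s a)
      (Function.update H s b) key pend := by
  have hneC : ∀ s' ∈ C, s' ≠ s := fun e' h h' => hs (h' ▸ h)
  have hTa : ∀ s' ∈ C, T s' ≠ a := by
    rintro s' hs' rfl
    have := h.done s' hs' e he heP
    tauto
  refine ⟨?_, ?_, ?_, h.key_term, ?_, ?_, h.key_loc, h.pend_loc, ?_⟩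
  · intro s' hs'
    rcases Finset.mem_insert.1 hs' with rfl | hs'
    · simpa
    · simpa [Function.update_of_ne (hneC s' hs')] using h.key_start s' hs'
  · intro s' hs' hX
    have hne : s' ≠ s := by simpa using hX
    rw [Function.update_of_ne hne]
    exact h.pend_end s' (Finset.mem_of_mem_insert_of_ne hs' hne) (by simp)
  · intro v hv
    obtain ⟨h1, h2, h3, h4⟩ := h.pend_spec v hv
    exact ⟨h1, Finset.mem_insert_of_mem h2, by simpa using hneC _ h2,
      by rwa [Function.update_of_ne (hneC _ h2)]⟩
  · rw [Finset.coe_insert, Set.injOn_insert (by simpa using hs)]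
    constructor
    · exact h.inj.congr fun s' hs' => (Function.update_of_ne (hneC s' hs') _ _).symm
    · rintro ⟨s', hs', h'⟩
      rw [Function.update_self, Function.update_of_ne (hneC s' hs')] at h'
      exact hTa s' hs' h'
  · intro s' hs' e' he' heP'
    rw [Finset.mem_insert, not_or] at heP'
    rcases Finset.mem_insert.1 hs' with rfl | hs'
    · simpa using honly e' he' heP'.2 heP'.1
    · simpa [Function.update_of_ne (hneC s' hs')] using h.done s' hs' e' he' heP'.2
  · obtain ⟨K, Q, hK, hQ, h1, h2⟩ := h.count
    refine ⟨K, Q, hK, hQ, ?_, h2⟩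
    rw [Finset.card_insert_of_notMem hs, Finset.card_singleton]
    simp at h1
    omega

lemma Bookkeeping.dangle (h : Bookkeeping E₀ E₁ Act K₀ P C ∅ T H key pend) :
    Bookkeeping E₀ E₁ Act K₀ (insert e P) C ∅ T H key pend :=
  { h with done := fun s' hs' e' he' heP' =>
      h.done s' hs' e' he' fun h => heP' (Finset.mem_insert_of_mem h) }

lemma Bookkeeping.extend (h : Bookkeeping E₀ E₁ Act K₀ P C ∅ T H key pend)
    (hpend : pend a = s) (hs0 : s ≠ 0) :
    Bookkeeping E₀ E₁ Act K₀ (insert e P) C {s} T (Function.update H s b) key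
      (Function.update pend a 0) := by
  subst hpend
  obtain ⟨hka, hsC, -, hHa⟩ := h.pend_spec a hs0
  refine ⟨h.key_start, ?_, ?_, h.key_term, h.inj, (h.dangle (e := e)).done, h.key_loc, ?_, ?_⟩
  · intro s' hs' hX hk
    have hne : s' ≠ pend a := by simpa using hX
    rw [Function.update_of_ne hne] at hk ⊢
    have := h.pend_end s' hs' (by simp) hk
    rw [Function.update_of_ne, this]
    rintro h'
    rw [h'] at this
    exact hne this.symm
  · intro v hv
    have hva : v ≠ a := by rintro rfl; simp at hv
    rw [Function.update_of_ne hva] at hv ⊢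
    obtain ⟨h1, h2, h3, h4⟩ := h.pend_spec v hv
    have hne : pend v ≠ pend a := fun h' => hva (by rw [← h4, h', hHa])
    exact ⟨h1, h2, by simpa using hne, by rwa [Function.update_of_ne hne]⟩
  · intro v hv
    have hva : v ≠ a := by rintro rfl; simp at hv
    rw [Function.update_of_ne hva] at hv
    exact h.pend_loc v hv
  · obtain ⟨K, Q, hK, hQ, h1, h2⟩ := h.count
    have haQ := (hQ a).1 hs0
    refine ⟨K, Q.erase a, hK, fun v => ?_, ?_, h2⟩
    · by_cases hva : v = a
      · simp [hva]
      · simp [Function.update_of_ne hva, hva, hQ]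
    · have := Finset.card_erase_add_one haQ
      simp at h1 ⊢
      omega

lemma Bookkeeping.arrive_key (h : Bookkeeping E₀ E₁ Act K₀ P C {s} T H key pend)
    (hH : H s = b) (hkey : key b ≠ 0) : Bookkeeping E₀ E₁ Act K₀ P C ∅ T H key pend := by
  refine ⟨h.key_start, ?_, ?_, h.key_term, h.inj, h.done, h.key_loc, h.pend_loc, ?_⟩
  · intro s' hs' _ hk
    by_cases hne : s' = s
    · subst hne; exact absurd (hH ▸ hk) hkey
    · exact h.pend_end s' hs' (by simpa) hk
  · intro v hv
    obtain ⟨h1, h2, h3, h4⟩ := h.pend_spec v hv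
    exact ⟨h1, h2, by simp, h4⟩
  · obtain ⟨K, Q, hK, hQ, h1, h2⟩ := h.count
    exact ⟨K, Q, hK, hQ, by simp at h1 ⊢; omega, h2⟩

lemma Bookkeeping.arrive_empty (h : Bookkeeping E₀ E₁ Act K₀ P C {s} T H key pend)
    (hC : ∀ s ∈ C, s ≠ 0) (hs : s ∈ C) (hH : H s = b) (hkey : key b = 0) (hpend : pend b = 0)
    (he : e ∈ Act) (heb : E₀ e = b ∨ E₁ e = b) :
    Bookkeeping E₀ E₁ Act K₀ P C ∅ T H key (Function.update pend b s) := by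
  refine ⟨h.key_start, ?_, ?_, h.key_term, h.inj, h.done, h.key_loc, ?_, ?_⟩
  · intro s' hs' _ hk
    by_cases hne : s' = s
    · subst hne; simp [hH]
    · have := h.pend_end s' hs' (by simpa) hk
      rw [Function.update_of_ne, this]
      intro h'
      rw [h', hpend] at this
      exact hC s' hs' this.symm
  · intro v hv
    by_cases hvb : v = b
    · subst hvb; simp [hkey, hs, hH]
    · rw [Function.update_of_ne hvb] at hv ⊢
      obtain ⟨h1, h2, h3, h4⟩ := h.pend_spec v hv
      exact ⟨h1, h2, by simp, h4⟩
  · intro v hv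
    by_cases hvb : v = b
    · exact hvb ▸ ⟨e, he, heb⟩
    · rw [Function.update_of_ne hvb] at hv
      exact h.pend_loc v hv
  · obtain ⟨K, Q, hK, hQ, h1, h2⟩ := h.count
    have hbQ : b ∉ Q := fun h' => (hQ b).2 h' hpend
    refine ⟨K, insert b Q, hK, fun v => ?_, ?_, h2⟩
    · by_cases hvb : v = b
      · simp [hvb, hC s hs]
      · simp [Function.update_of_ne hvb, hvb, hQ]
    · rw [Finset.card_insert_of_notMem hbQ]
      simp at h1 ⊢
      omega

/-- When a second path arrives at an unmarked vertex, the vertex is marked, and both paths end. -/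
lemma Bookkeeping.arrive_meet (h : Bookkeeping E₀ E₁ Act K₀ P C {s} T H key pend)
    (hH : H s = b) (hkey : key b = 0) (hpend : pend b ≠ 0)
    (he : e ∈ Act) (heb : E₀ e = b ∨ E₁ e = b) :
    Bookkeeping E₀ E₁ Act K₀ P C ∅ T H (Function.update key b 1) (Function.update pend b 0) := by
  have hk' : ∀ v, key v ≠ 0 → Function.update key b 1 v ≠ 0 := by
    intro v hv
    by_cases hvb : v = b
    · simp [hvb]
    · rwa [Function.update_of_ne hvb]
  refine ⟨fun s' hs' => hk' _ (h.key_start s' hs'), ?_, ?_, fun v hv => hk' _ (h.key_term v hv),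
    h.inj, h.done, ?_, ?_, ?_⟩
  · intro s' hs' _ hk
    have hvb : H s' ≠ b := by intro h'; simp [h'] at hk
    have hne : s' ≠ s := fun h' => hvb (h' ▸ hH)
    rw [Function.update_of_ne hvb] at hk ⊢
    exact h.pend_end s' hs' (by simpa) hk
  · intro v hv
    have hvb : v ≠ b := by rintro rfl; simp at hv
    rw [Function.update_of_ne hvb] at hv
    obtain ⟨h1, h2, h3, h4⟩ := h.pend_spec v hv
    simp only [Function.update_of_ne hvb]
    exact ⟨h1, h2, by simp, h4⟩
  · intro v hv
    by_cases hvb : v = b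
    · exact .inr (hvb ▸ ⟨e, he, heb⟩)
    · rw [Function.update_of_ne hvb] at hv
      exact h.key_loc v hv
  · intro v hv
    have hvb : v ≠ b := by rintro rfl; simp at hv
    rw [Function.update_of_ne hvb] at hv
    exact h.pend_loc v hv
  · obtain ⟨K, Q, hK, hQ, h1, h2⟩ := h.count
    have hbQ : b ∈ Q := (hQ b).1 hpend
    have hbK : b ∉ K := fun h' => (hK b).2 h' hkey
    have hle : C.card ≤ K.card := Finset.card_le_card_of_injOn T
      (fun s hs => (hK _).1 (h.key_start s hs)) h.inj
    have hQ1 := Finset.card_erase_add_one hbQ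
    refine ⟨insert b K, Q.erase b, fun v => ?_, fun v => ?_, ?_, ?_⟩
    · by_cases hvb : v = b
      · simp [hvb]
      · simp [Function.update_of_ne hvb, hvb, hK]
    · by_cases hvb : v = b
      · simp [hvb]
      · simp [Function.update_of_ne hvb, hvb, hQ]
    · rw [Finset.card_insert_of_notMem hbK]
      simp at h1 ⊢
      omega
    · rw [Finset.card_insert_of_notMem hbK]
      simp at h1
      omega

/-! ### Lifting acyclicity and conservation through a compression -/

/-- The paths representing an acyclic set form an acyclic set. -/
lemma Represents.acyc_paths (h : Represents E₀ E₁ up dn Act ok Act C T H par dir A B)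
    (hA : Acyc E₀ E₁ Act) (hC : ∀ s ∈ C, s ≠ 0) : Acyc T H C := by
  intro y hy s hs
  obtain ⟨e, he, hp, -⟩ := h.attA s hs
  have := hA (pull par dir y) (fun v => by rw [h.fwd, hy]) e he
  rw [pull, if_neg (by rw [hp]; exact hC s hs), hp] at this
  have h2 := sgn_mul_self dir e
  have : sgn dir e * (sgn dir e * y s) = 0 := by rw [this, mul_zero]
  rwa [← mul_assoc, h2, one_mul] at this

/-- If the paths in `C'` and the arcs in `I` together are acyclic, then so are the arcs in `S` and the
arcs in `I`, provided that a path not in `C'` contains an arc not in `S`. -/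
lemma Represents.acyc_lift {E₀' E₁' : ℕ → ℕ}
    (h : Represents E₀ E₁ up dn Act ok Act C T H par dir A B)
    {S I C' : Finset ℕ} (hS : S ⊆ Act) (hC' : C' ⊆ C) (hSI : Disjoint S I) (hCI : Disjoint C' I)
    (hpath : ∀ s ∈ C, s ∉ C' → ∃ e ∈ Act, e ∉ S ∧ par e = s) (hC : ∀ s ∈ C, s ≠ 0)
    (hac : Acyc E₀' E₁' (C' ∪ I))
    (hE : ∀ s ∈ C', ∀ v, bd E₀' E₁' s v = bd T H s v)
    (hI : ∀ e ∈ I, ∀ v, bd E₀ E₁ e v = bd E₀' E₁' e v)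
    (hok : ∀ e ∈ I, ∀ v, ok v → bd E₀ E₁ e v = 0) :
    Acyc E₀ E₁ (S ∪ I) := by
  intro c hc
  have hsum : ∀ v, ∑ e ∈ Act, (if e ∈ S then c e else 0) * bd E₀ E₁ e v =
      ∑ e ∈ S, c e * bd E₀ E₁ e v := by
    intro v
    rw [← Finset.sum_subset hS (fun x _ hx => by simp [hx])]
    exact Finset.sum_congr rfl fun e he => by simp [he]
  have hz : ∀ v, ok v → ∑ e ∈ Act, (if e ∈ S then c e else 0) * bd E₀ E₁ e v = 0 := by
    intro v hv
    rw [hsum]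
    have := hc v
    rw [Finset.sum_union hSI] at this
    rw [Finset.sum_eq_zero (s := I) fun e he => by rw [hok e he v hv, mul_zero], add_zero] at this
    exact this
  obtain ⟨y, hy⟩ := h.bwd _ hz
  have hy0 : ∀ s ∈ C, s ∉ C' → y s = 0 := by
    intro s hs hs'
    obtain ⟨e, he, heS, hp⟩ := hpath s hs hs'
    have h1 := hy e he
    rw [if_neg heS, pull, if_neg (by rw [hp]; exact hC s hs), hp] at h1
    have : sgn dir e * (sgn dir e * y s) = 0 := by rw [← h1, mul_zero]
    rwa [← mul_assoc, sgn_mul_self, one_mul] at this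
  have key := hac (fun x => if x ∈ C' then y x else c x) (fun v => by
    rw [Finset.sum_union hCI]
    have h3 : ∑ e ∈ Act, (if e ∈ S then c e else 0) * bd E₀ E₁ e v =
        ∑ e ∈ Act, pull par dir y e * bd E₀ E₁ e v :=
      Finset.sum_congr rfl fun e he => by rw [hy e he]
    have h1 : ∑ x ∈ C', (if x ∈ C' then y x else c x) * bd E₀' E₁' x v =
        ∑ e ∈ S, c e * bd E₀ E₁ e v := by
      rw [← hsum, h3, h.fwd, ← Finset.sum_subset hC' (fun x hx hx' => by rw [hy0 x hx hx', zero_mul])]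
      exact Finset.sum_congr rfl fun x hx => by rw [if_pos hx, hE x hx]
    have h2 : ∑ x ∈ I, (if x ∈ C' then y x else c x) * bd E₀' E₁' x v =
        ∑ e ∈ I, c e * bd E₀ E₁ e v :=
      Finset.sum_congr rfl fun x hx => by
        rw [if_neg fun h' => Finset.disjoint_left.1 hCI h' hx, hI x hx]
    rw [h1, h2, ← Finset.sum_union hSI, hc])
  have hyall : ∀ s ∈ C, y s = 0 := by
    intro s hs
    by_cases hs' : s ∈ C'
    · simpa [hs'] using key s (Finset.mem_union_left _ hs')
    · exact hy0 s hs hs'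
  intro e he
  rcases Finset.mem_union.1 he with he | he
  · have h1 := hy e (hS he)
    rw [if_pos he] at h1
    rw [h1, pull]
    rcases h.par_mem e (hS he) with h2 | h2
    · rw [if_pos h2]
    · rw [hyall _ h2, mul_zero, ite_self]
  · have := key e (Finset.mem_union_right _ he)
    rwa [if_neg fun h' => Finset.disjoint_left.1 hCI h' he] at this

end FlowRounding

namespace RealRAM
open FlowRounding

variable {W : ℕ}

/-! ### Pruning leaves -/

/-- Assumptions for pruning the forest `Act` in state `σ`. The numbers of the paths start at the
content of register `19`. The vertex with `fk v ≠ 0`, if there is one, is never pruned. -/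
structure PruneCtx (W : ℕ) (σ : State) (Act K₀ : Finset ℕ) (fk : ℕ → ℕ) : Prop where
  one : σ.wReg 4 = 1
  zero : σ.wReg 18 = 0
  pos : 0 < σ.wReg 19
  lt : ∀ e ∈ Act, e < σ.wReg 19
  res : ∀ e ∈ Act, 0 < upRes σ e ∧ 0 < dnRes σ e
  acyc : Acyc (σ.wArr 0) (σ.wArr 1) Act
  par : ∀ e ∈ Act, σ.wArr 6 e = 0
  two : ∀ v, fk v = 0 ∨ fk v = 2
  root : ∃ v₀, ∀ v, v ≠ v₀ → fk v = 0
  bound : σ.wReg 19 + 2 * K₀.card < W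

/-- The paths constructed between the states `σ` and `τ`. -/
def newPaths (σ τ : State) : Finset ℕ := Finset.Ico (σ.wReg 19) (τ.wReg 19)

/-- The situation in state `τ` when the arcs in `P` have been pruned from the forest `Act`, starting
from state `σ`. The set `X` contains the path being extended. -/
structure Pruned (σ : State) (Act K₀ : Finset ℕ) (fk : ℕ → ℕ) (P X : Finset ℕ) (τ : State) :
    Prop where
  rep : Represents (σ.wArr 0) (σ.wArr 1) (upRes σ) (dnRes σ) Act (fun v => v ∉ K₀ ∧ fk v = 0) P
    (newPaths σ τ) (τ.wArr 0) (τ.wArr 1) (τ.wArr 6) (τ.wArr 7) (τ.rArr 3) (τ.rArr 4)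
  book : Bookkeeping (σ.wArr 0) (σ.wArr 1) Act K₀ P (newPaths σ τ) X (τ.wArr 0) (τ.wArr 1)
    (τ.wArr 4) (τ.wArr 5)
  old : ∀ e < σ.wReg 19, τ.wArr 0 e = σ.wArr 0 e ∧ τ.wArr 1 e = σ.wArr 1 e ∧
    τ.rArr 3 e = σ.rArr 3 e ∧ τ.rArr 4 e = σ.rArr 4 e ∧ τ.rArr 5 e = σ.rArr 5 e
  fresh : ∀ s ∈ newPaths σ τ, τ.rArr 5 s = 0
  par_out : ∀ e, e ∉ P → τ.wArr 6 e = σ.wArr 6 e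
  dir_out : ∀ e, e ∉ Act → τ.wArr 7 e = σ.wArr 7 e
  wother : ∀ a, 8 ≤ a → τ.wArr a = σ.wArr a
  rother : ∀ a, a ≠ 3 → a ≠ 4 → a ≠ 5 → τ.rArr a = σ.rArr a
  le : σ.wReg 19 ≤ τ.wReg 19
  fr : Fr σ τ

/-- The counters in state `τ` describe the arcs incident to each vertex, when the arcs in `P` have
been removed from `Act`. -/
structure Counted (σ : State) (Act : Finset ℕ) (fk : ℕ → ℕ) (P : Finset ℕ) (τ : State) : Prop where
  deg : ∀ v, τ.wArr 2 v = fk v + (inc (σ.wArr 0) (σ.wArr 1) (Act \ P) v).card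
  sum : ∀ v, τ.wArr 3 v = ∑ e ∈ inc (σ.wArr 0) (σ.wArr 1) (Act \ P) v, e

variable {σ τ : State} {Act K₀ P X : Finset ℕ} {fk : ℕ → ℕ} {k : ℕ}

/-- What `detach` achieves: register `23` holds the arc `e`, leading from `a` to `b`. -/
structure Detached (σ : State) (Act K₀ : Finset ℕ) (fk : ℕ → ℕ) (P : Finset ℕ) (e a b : ℕ)
    (τ : State) : Prop where
  pruned : Pruned σ Act K₀ fk P ∅ τ
  counted : Counted σ Act fk (insert e P) τ
  mem : e ∈ Act
  notMem : e ∉ P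
  reg : τ.wReg 21 = a ∧ τ.wReg 23 = e ∧ τ.wReg 24 = b
  ori : Oriented (σ.wArr 0) (σ.wArr 1) (upRes σ) (dnRes σ) (τ.wArr 7) e a b (τ.rReg 1) (τ.rReg 2)
  only : ∀ e' ∈ Act, e' ∉ P → e' ≠ e → σ.wArr 0 e' ≠ a ∧ σ.wArr 1 e' ≠ a
  free : fk a = 0

/-- At a vertex with counter `1`, the sum of the incident arcs is the number of the only one. -/
lemma detach_spec (hc : PruneCtx W σ Act K₀ fk) (hp : Pruned σ Act K₀ fk P ∅ τ)
    (hd : Counted σ Act fk P τ) (hleaf : τ.wArr 2 (τ.wReg 21) = 1) :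
    WP W detach (fun τ' k' => τ'.wReg 20 = τ.wReg 20 ∧ k' ≤ k + 20 ∧
      ∃ e b, Detached σ Act K₀ fk P e (τ.wReg 21) b τ') τ k := by
  obtain ⟨a, ha⟩ : ∃ a, τ.wReg 21 = a := ⟨_, rfl⟩
  rw [ha] at hleaf ⊢
  have hfk : fk a = 0 := by
    rcases hc.two a with h | h
    · exact h
    · have := hd.deg a; omega
  have hcard : (inc (σ.wArr 0) (σ.wArr 1) (Act \ P) a).card = 1 := by
    have := hd.deg a; omega
  obtain ⟨e, he⟩ := Finset.card_eq_one.1 hcard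
  have hsum : τ.wArr 3 a = e := by rw [hd.sum, he]; simp
  have hmem : e ∈ inc (σ.wArr 0) (σ.wArr 1) (Act \ P) a := by rw [he]; simp
  obtain ⟨hmem', hinc⟩ := mem_inc.1 hmem
  obtain ⟨heA, heP⟩ := Finset.mem_sdiff.1 hmem'
  have hlt := hc.lt e heA
  have hne := hc.acyc.ne heA
  have honly : ∀ e' ∈ Act, e' ∉ P → e' ≠ e → σ.wArr 0 e' ≠ a ∧ σ.wArr 1 e' ≠ a := by
    intro e' h1 h2 h3
    by_contra hcon
    have : e' ∈ inc (σ.wArr 0) (σ.wArr 1) (Act \ P) a :=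
      mem_inc.2 ⟨Finset.mem_sdiff.2 ⟨h1, h2⟩, by tauto⟩
    rw [he] at this
    exact h3 (by simpa using this)
  obtain ⟨h0, h1, h3, h4, h5⟩ := hp.old e hlt
  have h4' : τ.wReg 4 = 1 := by rw [hp.fr 4 (by norm_num), hc.one]
  have h18 : τ.wReg 18 = 0 := by rw [hp.fr 18 (by norm_num), hc.zero]
  have hsd : Act \ insert e P = (Act \ P).erase e := by
    ext x; simp only [Finset.mem_sdiff, Finset.mem_insert, Finset.mem_erase]; tauto
  have hincv : ∀ v, inc (σ.wArr 0) (σ.wArr 1) (Act \ insert e P) v =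
      (inc (σ.wArr 0) (σ.wArr 1) (Act \ P) v).erase e := by
    intro v; rw [hsd]; simp only [inc, Finset.filter_erase]
  have hcnt : ∀ b, b ≠ a → (σ.wArr 0 e = b ∨ σ.wArr 1 e = b) →
      (∀ v, v ≠ a → v ≠ b → σ.wArr 0 e ≠ v ∧ σ.wArr 1 e ≠ v) →
      ∀ τ' : State, τ'.wArr 2 = Function.update (Function.update (τ.wArr 2) a 0) b
        (τ.wArr 2 b - 1) → τ'.wArr 3 = Function.update (Function.update (τ.wArr 3) a 0) b
        (τ.wArr 3 b - e) → Counted σ Act fk (insert e P) τ' := by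
    intro b hba hb hv τ' h2 h3
    have hmb : e ∈ inc (σ.wArr 0) (σ.wArr 1) (Act \ P) b := mem_inc.2 ⟨hmem', hb⟩
    constructor
    · intro v
      rw [h2, hincv]
      by_cases hvb : v = b
      · subst hvb
        rw [Function.update_self, hd.deg, Finset.card_erase_of_mem hmb]
        have := Finset.card_pos.2 ⟨e, hmb⟩
        omega
      · rw [Function.update_of_ne hvb]
        by_cases hva : v = a
        · subst hva
          rw [Function.update_self, he]; simp [hfk]
        · rw [Function.update_of_ne hva, hd.deg, Finset.erase_eq_of_notMem]
          intro h
          have := hv v hva hvb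
          have := (mem_inc.1 h).2
          tauto
    · intro v
      rw [h3, hincv]
      by_cases hvb : v = b
      · subst hvb
        rw [Function.update_self, hd.sum, ← Finset.add_sum_erase _ _ hmb]
        omega
      · rw [Function.update_of_ne hvb]
        by_cases hva : v = a
        · subst hva
          rw [Function.update_self, he]; simp
        · rw [Function.update_of_ne hva, hd.sum, Finset.erase_eq_of_notMem]
          intro h
          have := hv v hva hvb
          have := (mem_inc.1 h).2
          tauto
  have hpr : ∀ (τ' : State) (x : ℕ), (∀ a, a ≠ 2 → a ≠ 3 → a ≠ 7 → τ'.wArr a = τ.wArr a) →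
      τ'.rArr = τ.rArr → τ'.wReg 19 = τ.wReg 19 → τ'.wArr 7 = Function.update (τ.wArr 7) e x →
      Fr τ τ' → Pruned σ Act K₀ fk P ∅ τ' := by
    intro τ' x hw hr h19 h7 hfr
    have hnew : newPaths σ τ' = newPaths σ τ := by rw [newPaths, newPaths, h19]
    refine ⟨?_, ?_, ?_, ?_, ?_, ?_, ?_, ?_, by rw [h19]; exact hp.le, hp.fr.trans hfr⟩
    · rw [hnew, hr, hw 0 (by norm_num) (by norm_num) (by norm_num),
        hw 1 (by norm_num) (by norm_num) (by norm_num),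
        hw 6 (by norm_num) (by norm_num) (by norm_num)]
      refine hp.rep.congr (fun _ _ => rfl) (fun e' he' => ?_) (fun _ _ => rfl) (fun _ _ => rfl)
        (fun _ _ => rfl) (fun _ _ => rfl)
      rw [h7, Function.update_of_ne]
      exact fun h => heP (h ▸ he')
    · rw [hnew, hw 0 (by norm_num) (by norm_num) (by norm_num),
        hw 1 (by norm_num) (by norm_num) (by norm_num),
        hw 4 (by norm_num) (by norm_num) (by norm_num),
        hw 5 (by norm_num) (by norm_num) (by norm_num)]
      exact hp.book
    · rw [hr, hw 0 (by norm_num) (by norm_num) (by norm_num),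
        hw 1 (by norm_num) (by norm_num) (by norm_num)]
      exact hp.old
    · rw [hnew, hr]; exact hp.fresh
    · rw [hw 6 (by norm_num) (by norm_num) (by norm_num)]; exact hp.par_out
    · intro e' he'
      rw [h7, Function.update_of_ne (by rintro rfl; exact he' heA)]
      exact hp.dir_out e' he'
    · intro a ha
      rw [hw a (by omega) (by omega) (by omega)]; exact hp.wother a ha
    · rw [hr]; exact hp.rother
  simp only [detach, loadRes, WP_seq, WP_instr, WP_ite, WP_skip, Instr.exec, Test.Holds]
  refine ⟨fun hb => ?_, fun hb => ?_⟩
  · simp [ha, hsum, h0] at hb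
    refine ⟨by simp, by omega, e, σ.wArr 1 e, ?_, ?_, heA, heP, ?_, ?_, honly, hfk⟩
    · exact hpr _ 0 (by intro a h2 h3 h7; simp [h2, h3, h7]) (by simp) (by simp)
        (by simp [ha, hsum, h18]) (by simp [Fr.refl])
    · refine hcnt (σ.wArr 1 e) (by rw [← hb]; exact hne.symm) (.inr rfl)
        (fun v h h' => ⟨by rw [hb]; exact h.symm, h'.symm⟩) _ ?_ ?_
      · have : σ.wArr 1 e ≠ a := by rw [← hb]; exact hne.symm
        simp [ha, hsum, h1, h18, h4', this]
      · have : σ.wArr 1 e ≠ a := by rw [← hb]; exact hne.symm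
        simp [ha, hsum, h1, h18, h4', this]
    · simp [ha, hsum, h1]
    · refine ⟨by rw [← hb]; exact hne, fun v => ?_, .inl hb, .inr rfl, ?_, ?_⟩
      · simp [sgn, ha, hsum, h18, FlowRounding.bd, hb]
      · simp [along, ha, hsum, h18, upRes, h3, h5]
      · simp [along, ha, hsum, h18, dnRes, h4, h5]
  · simp [ha, hsum, h0] at hb
    have hb' : σ.wArr 1 e = a := by tauto
    refine ⟨by simp, by omega, e, σ.wArr 0 e, ?_, ?_, heA, heP, ?_, ?_, honly, hfk⟩
    · exact hpr _ 1 (by intro a h2 h3 h7; simp [h2, h3, h7]) (by simp) (by simp)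
        (by simp [ha, hsum, h4']) (by simp [Fr.refl])
    · refine hcnt (σ.wArr 0 e) hb (.inl rfl)
        (fun v h h' => ⟨h'.symm, by rw [hb']; exact h.symm⟩) _ ?_ ?_
      · simp [ha, hsum, h0, h18, h4', hb]
      · simp [ha, hsum, h0, h18, h4', hb]
    · simp [ha, hsum, h0]
    · refine ⟨Ne.symm hb, fun v => ?_, .inr hb', .inl rfl, ?_, ?_⟩
      · simp [sgn, ha, hsum, h4', FlowRounding.bd, hb']
      · simp [along, ha, hsum, h4', dnRes, h4, h5]
      · simp [along, ha, hsum, h4', upRes, h3, h5]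

end RealRAM

namespace RealRAM
open FlowRounding

variable {W : ℕ} {σ τ : State} {Act K₀ P X : Finset ℕ} {fk : ℕ → ℕ} {k e a b : ℕ}

/-- The marks and pending paths may change as long as the bookkeeping remains valid. -/
lemma Pruned.of_book {X' : Finset ℕ} {τ' : State} (h : Pruned σ Act K₀ fk P X τ)
    (hw : ∀ a, a ≠ 4 → a ≠ 5 → τ'.wArr a = τ.wArr a) (hr : τ'.rArr = τ.rArr)
    (h19 : τ'.wReg 19 = τ.wReg 19) (hfr : Fr τ τ')
    (hb : Bookkeeping (σ.wArr 0) (σ.wArr 1) Act K₀ P (newPaths σ τ) X' (τ.wArr 0) (τ.wArr 1)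
      (τ'.wArr 4) (τ'.wArr 5)) : Pruned σ Act K₀ fk P X' τ' := by
  have hnew : newPaths σ τ' = newPaths σ τ := by rw [newPaths, newPaths, h19]
  have h0 := hw 0 (by norm_num) (by norm_num)
  have h1 := hw 1 (by norm_num) (by norm_num)
  have h6 := hw 6 (by norm_num) (by norm_num)
  have h7 := hw 7 (by norm_num) (by norm_num)
  refine ⟨?_, ?_, ?_, ?_, ?_, ?_, ?_, ?_, by rw [h19]; exact h.le, h.fr.trans hfr⟩
  · rw [hnew, h0, h1, h6, h7, hr]; exact h.rep
  · rw [hnew, h0, h1]; exact hb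
  · rw [h0, h1, hr]; exact h.old
  · rw [hnew, hr]; exact h.fresh
  · rw [h6]; exact h.par_out
  · rw [h7]; exact h.dir_out
  · intro a ha; rw [hw a (by omega) (by omega)]; exact h.wother a ha
  · rw [hr]; exact h.rother

lemma PruneCtx.path_ne_zero (hc : PruneCtx W σ Act K₀ fk) {s : ℕ} (hs : s ∈ newPaths σ τ) :
    s ≠ 0 := by
  have := (Finset.mem_Ico.1 hs).1
  have := hc.pos
  omega

lemma arrive_spec (hc : PruneCtx W σ Act K₀ fk) {s : ℕ} (hp : Pruned σ Act K₀ fk P {s} τ)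
    (h27 : τ.wReg 27 = s) (hs : s ∈ newPaths σ τ) (hH : τ.wArr 1 s = b) (h24 : τ.wReg 24 = b)
    (he : e ∈ Act) (heb : σ.wArr 0 e = b ∨ σ.wArr 1 e = b) :
    WP W arrive (fun τ' k' => Pruned σ Act K₀ fk P ∅ τ' ∧ τ'.wReg 20 = τ.wReg 20 ∧
      τ'.wReg 24 = b ∧ τ'.wArr 2 = τ.wArr 2 ∧ τ'.wArr 3 = τ.wArr 3 ∧ k' ≤ k + 6) τ k := by
  have h18 : τ.wReg 18 = 0 := by rw [hp.fr 18 (by norm_num), hc.zero]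
  have h4 : τ.wReg 4 = 1 := by rw [hp.fr 4 (by norm_num), hc.one]
  simp only [arrive, WP_seq, WP_instr, WP_ite, WP_skip, Instr.exec, Test.Holds]
  refine ⟨fun hk => ⟨fun hq => ?_, fun hq => ?_⟩, fun hk => ?_⟩
  · simp [h24, h18] at hk hq
    refine ⟨hp.of_book (fun a ha hb => by simp [ha, hb]) (by simp) (by simp) (by simp [Fr.refl]) ?_,
      by simp, by simp [h24], by simp, by simp, by omega⟩
    simpa [h24, h27] using hp.book.arrive_empty (fun s => hc.path_ne_zero) hs hH hk hq he heb
  · simp [h24, h18] at hk hq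
    refine ⟨hp.of_book (fun a ha hb => by simp [ha, hb]) (by simp) (by simp) (by simp [Fr.refl]) ?_,
      by simp, by simp [h24], by simp, by simp, by omega⟩
    simpa [h24, h27, h18, h4] using hp.book.arrive_meet hH hk hq he heb
  · simp [h24, h18] at hk
    refine ⟨hp.of_book (fun a ha hb => by simp) (by simp) (by simp) (by simp [Fr.refl]) ?_,
      by simp, by simp [h24], by simp, by simp, by omega⟩
    simpa using hp.book.arrive_key hH hk

lemma Counted.congr {τ' : State} (h : Counted σ Act fk P τ) (h2 : τ'.wArr 2 = τ.wArr 2)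
    (h3 : τ'.wArr 3 = τ.wArr 3) : Counted σ Act fk P τ' :=
  ⟨by rw [h2]; exact h.deg, by rw [h3]; exact h.sum⟩

lemma startPath_spec (hc : PruneCtx W σ Act K₀ fk) (hd : Detached σ Act K₀ fk P e a b τ)
    (hkey : τ.wArr 4 a ≠ 0) :
    WP W startPath (fun τ' k' => Pruned σ Act K₀ fk (insert e P) {τ.wReg 19} τ' ∧
      τ'.wReg 27 = τ.wReg 19 ∧ τ.wReg 19 ∈ newPaths σ τ' ∧ τ'.wArr 1 (τ.wReg 19) = b ∧
      τ'.wReg 24 = b ∧ τ'.wReg 20 = τ.wReg 20 ∧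
      τ'.wArr 2 = τ.wArr 2 ∧ τ'.wArr 3 = τ.wArr 3 ∧ k' = k + 9) τ k := by
  have hp := hd.pruned
  obtain ⟨h21, h23, h24⟩ := hd.reg
  have h4 : τ.wReg 4 = 1 := by rw [hp.fr 4 (by norm_num), hc.one]
  have hs : τ.wReg 19 ∉ newPaths σ τ := by simp [newPaths]
  have hs0 : τ.wReg 19 ≠ 0 := by have := hp.le; have := hc.pos; omega
  have hB := hp.book.start hd.mem hd.notMem hd.ori.inc_left hd.only hkey hs (b := b)
  have hcard : (newPaths σ τ).card + 2 ≤ 2 * K₀.card := by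
    have := hB.card_le
    rwa [Finset.card_insert_of_notMem hs] at this
  have hlt : τ.wReg 19 + 1 < W := by
    have := hc.bound; have := hp.le
    rw [newPaths, Nat.card_Ico] at hcard
    omega
  have hr := hc.res e hd.mem
  have hal : 0 < τ.rReg 1 ∧ 0 < τ.rReg 2 := by
    rw [hd.ori.fwd, hd.ori.bwd, along, along]
    split_ifs
    · exact hr
    · exact hr.symm
  have hR := hp.rep.start hd.ori hd.mem hd.notMem hs hs0 hal.1 hal.2
  have hins : insert (τ.wReg 19) (newPaths σ τ) = Finset.Ico (σ.wReg 19) (τ.wReg 19 + 1) := by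
    rw [newPaths, Finset.insert_Ico_right_eq_Ico_add_one hp.le]
  have hm : (τ.wReg 19 + 1) % W = τ.wReg 19 + 1 := Nat.mod_eq_of_lt hlt
  rw [hins] at hB hR
  have hold : ∀ e < σ.wReg 19, e ≠ τ.wReg 19 := fun e he => by have := hp.le; omega
  simp only [startPath, WP_seq, WP_instr, Instr.exec]
  refine ⟨⟨?_, ?_, ?_, ?_, ?_, ?_, ?_, ?_, ?_, ?_⟩, ?_, ?_, ?_, ?_, ?_, ?_, ?_, ?_⟩
  · simpa [newPaths, h21, h23, h24, h4, hm] using hR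
  · simpa [newPaths, h21, h23, h24, h4, hm] using hB
  · intro e' he'
    simpa [Function.update_of_ne (hold e' he')] using hp.old e' he'
  · intro s
    by_cases hss : s = τ.wReg 19
    · simp [hss]
    · intro h
      have : s ∈ newPaths σ τ := by
        simp [newPaths, h4, hm] at h ⊢
        omega
      simpa [Function.update_of_ne hss] using hp.fresh s this
  · intro e' he'
    rw [Finset.mem_insert, not_or] at he'
    simpa [h23, Function.update_of_ne he'.1] using hp.par_out e' he'.2
  · simpa using hp.dir_out
  · intro a ha
    simpa [show a ≠ 0 by omega, show a ≠ 1 by omega, show a ≠ 6 by omega] using hp.wother a ha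
  · intro a h3 h4 h5
    simpa [h3, h4, h5] using hp.rother a h3 h4 h5
  · have := hp.le
    simp [h4, hm]; omega
  · simpa using hp.fr
  · simp
  · have := hp.le
    simp [newPaths, h4, hm, this]
  · simp [h24]
  · simp [h24]
  · simp
  · simp
  · simp
  · trivial

lemma extendPath_spec (hc : PruneCtx W σ Act K₀ fk) (hd : Detached σ Act K₀ fk P e a b τ)
    (hkey : τ.wArr 4 a = 0) {s : ℕ} (hpend : τ.wArr 5 a = s) (hs0 : s ≠ 0) (h27 : τ.wReg 27 = s) :
    WP W extendPath (fun τ' k' => Pruned σ Act K₀ fk (insert e P) {s} τ' ∧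
      τ'.wReg 27 = s ∧ s ∈ newPaths σ τ' ∧ τ'.wArr 1 s = b ∧
      τ'.wReg 24 = b ∧ τ'.wReg 20 = τ.wReg 20 ∧
      τ'.wArr 2 = τ.wArr 2 ∧ τ'.wArr 3 = τ.wArr 3 ∧ k' ≤ k + 9) τ k := by
  have hp := hd.pruned
  obtain ⟨h21, h23, h24⟩ := hd.reg
  have h18 : τ.wReg 18 = 0 := by rw [hp.fr 18 (by norm_num), hc.zero]
  have hB := hp.book.extend (e := e) (b := b) hpend hs0
  obtain ⟨-, hs, -, hHs⟩ := hp.book.pend_spec a (hpend ▸ hs0)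
  rw [hpend] at hs hHs
  have hr := hc.res e hd.mem
  have hal : 0 < τ.rReg 1 ∧ 0 < τ.rReg 2 := by
    rw [hd.ori.fwd, hd.ori.bwd, along, along]
    split_ifs
    · exact hr
    · exact hr.symm
  have haK : a ∉ K₀ := fun h => hp.book.key_term a h hkey
  have hR := hp.rep.extend hd.ori hd.mem hd.notMem hs hs0 hal.1 hal.2 ⟨haK, hd.free⟩ hd.only
    (fun s' hs' h => hp.book.key_start s' hs' (by rw [h, hkey])) hHs
    (fun s' hs' hne h => hne (by
      have := hp.book.pend_end s' hs' (by simp) (by rw [h, hkey])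
      rw [h, hpend] at this; exact this.symm))
  have hold : ∀ e < σ.wReg 19, e ≠ s := fun e he => by
    have := (Finset.mem_Ico.1 hs).1; omega
  have hmin1 : ∀ x y : ℝ, x < y → min x y = x := fun x y h => min_eq_left h.le
  have hmin2 : ∀ x y : ℝ, ¬ x < y → min x y = y := fun x y h => min_eq_right (not_lt.1 h)
  have main : ∀ τ' : State, (∀ a, a ≠ 1 → a ≠ 5 → a ≠ 6 → τ'.wArr a = τ.wArr a) →
      τ'.wArr 1 = Function.update (τ.wArr 1) s b → τ'.wArr 5 = Function.update (τ.wArr 5) a 0 →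
      τ'.wArr 6 = Function.update (τ.wArr 6) e s →
      (∀ a, a ≠ 3 → a ≠ 4 → τ'.rArr a = τ.rArr a) →
      τ'.rArr 3 = Function.update (τ.rArr 3) s (min (τ.rReg 1) (τ.rArr 3 s)) →
      τ'.rArr 4 = Function.update (τ.rArr 4) s (min (τ.rReg 2) (τ.rArr 4 s)) →
      τ'.wReg 19 = τ.wReg 19 → Fr τ τ' → Pruned σ Act K₀ fk (insert e P) {s} τ' := by
    intro τ' hw hw1 hw5 hw6 hr hr3 hr4 h19 hfr
    have hnew : newPaths σ τ' = newPaths σ τ := by rw [newPaths, newPaths, h19]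
    have h0 := hw 0 (by norm_num) (by norm_num) (by norm_num)
    refine ⟨?_, ?_, ?_, ?_, ?_, ?_, ?_, ?_, by rw [h19]; exact hp.le, hp.fr.trans hfr⟩
    · rw [hnew, h0, hw1, hw6, hr3, hr4, hw 7 (by norm_num) (by norm_num) (by norm_num)]
      exact hR
    · rw [hnew, h0, hw1, hw5, hw 4 (by norm_num) (by norm_num) (by norm_num)]
      exact hB
    · intro e' he'
      rw [h0, hw1, hr3, hr4, hr 5 (by norm_num) (by norm_num)]
      simpa [Function.update_of_ne (hold e' he')] using hp.old e' he'
    · rw [hnew, hr 5 (by norm_num) (by norm_num)]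
      exact hp.fresh
    · intro e' he'
      rw [Finset.mem_insert, not_or] at he'
      rw [hw6, Function.update_of_ne he'.1]
      exact hp.par_out e' he'.2
    · rw [hw 7 (by norm_num) (by norm_num) (by norm_num)]; exact hp.dir_out
    · intro a ha
      rw [hw a (by omega) (by omega) (by omega)]
      exact hp.wother a ha
    · intro a h3 h4 h5
      rw [hr a h3 h4]
      exact hp.rother a h3 h4 h5
  have hns : ∀ τ' : State, τ'.wReg 19 = τ.wReg 19 → s ∈ newPaths σ τ' := fun τ' h19 => by
    rw [newPaths, h19]; exact hs
  simp only [extendPath, WP_seq, WP_instr, WP_ite, WP_skip, Instr.exec, Test.Holds]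
  refine ⟨fun hx => ⟨fun hy => ?_, fun hy => ?_⟩, fun hx => ⟨fun hy => ?_, fun hy => ?_⟩⟩
  all_goals
    simp [h27] at hx hy
    refine ⟨main _ ?_ ?_ ?_ ?_ ?_ ?_ ?_ ?_ ?_, by simp [h27], hns _ (by simp), by simp [h27, h24],
      by simp [h24], by simp, by simp, by simp, by omega⟩
  all_goals first
    | (intro a h1 h2 h3; simp [h1, h2, h3])
    | (intro a h1 h2; simp [h1, h2])
    | (simp [h27, h21, h23, h24, h18]; done)
    | (simp [Fr.refl]; done)
    | simp [h27, hx, hy, hmin1, hmin2]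

lemma attach_spec (hc : PruneCtx W σ Act K₀ fk) (hd : Detached σ Act K₀ fk P e a b τ) :
    WP W attach (fun τ' k' => Pruned σ Act K₀ fk (insert e P) ∅ τ' ∧
      Counted σ Act fk (insert e P) τ' ∧
      τ'.wReg 24 = b ∧ τ'.wReg 20 = τ.wReg 20 ∧ k' ≤ k + 20) τ k := by
  have hp := hd.pruned
  obtain ⟨h21, h23, h24⟩ := hd.reg
  have h18 : τ.wReg 18 = 0 := by rw [hp.fr 18 (by norm_num), hc.zero]
  -- a write to a scratch register other than those used by `Detached`
  have hset : ∀ (τ : State) (x v : ℕ), Detached σ Act K₀ fk P e a b τ → 25 ≤ x →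
      Detached σ Act K₀ fk P e a b (τ.setW x v) := by
    intro τ x v h hx
    have h19 : (τ.setW x v).wReg 19 = τ.wReg 19 := by
      rw [setW_wReg, if_neg (by omega)]
    refine ⟨h.pruned.of_book (fun _ _ _ => rfl) rfl h19 ((Fr.refl τ).setW (by omega))
      h.pruned.book, h.counted.congr rfl rfl, h.mem, h.notMem, ?_, h.ori, h.only, h.free⟩
    simpa [show (21 : ℕ) ≠ x by omega, show (23 : ℕ) ≠ x by omega, show (24 : ℕ) ≠ x by omega]
      using h.reg
  simp only [attach, WP_seq, WP_instr, WP_ite, WP_skip]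
  refine ⟨fun hk => ⟨fun hq => ?_, fun hq => ?_⟩, fun hk => ?_⟩
  · simp [Test.Holds, Instr.exec, h18, h21] at hk hq
    have hp' : Pruned σ Act K₀ fk (insert e P) ∅ τ := by
      refine ⟨?_, hp.book.dangle, hp.old, hp.fresh, ?_, hp.dir_out, hp.wother, hp.rother, hp.le,
        hp.fr⟩
      · have haK : a ∉ K₀ := fun h => hp.book.key_term a h hk
        refine hp.rep.dangle hd.ori hd.mem hd.notMem ?_ ⟨haK, hd.free⟩ hd.only
          (fun s' hs' h => hp.book.key_start s' hs' (by rw [h, hk])) (fun s' hs' h => ?_)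
        · rw [hp.par_out e hd.notMem, hc.par e hd.mem]
        · have := hp.book.pend_end s' hs' (by simp) (by rw [h, hk])
          rw [h, hq] at this
          exact hc.path_ne_zero hs' this.symm
      · intro e' he'
        exact hp.par_out e' fun h => he' (Finset.mem_insert_of_mem h)
    refine ⟨hp'.of_book (fun _ _ _ => rfl) rfl (by simp [Instr.exec])
      (by simp [Instr.exec, Fr.refl]) hp'.book, hd.counted.congr rfl rfl, by simp [Instr.exec, h24],
      by simp [Instr.exec], by omega⟩
  · simp [Test.Holds, Instr.exec, h18, h21] at hk hq
    refine WP.mono (extendPath_spec hc (hset _ _ _ (hset _ _ _ hd (by norm_num)) (by norm_num))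
      (by simpa [Instr.exec] using hk) rfl
      (by simpa [Instr.exec, h21] using hq) (by simp [Instr.exec, h21])) ?_
    rintro τ' k' ⟨hp', h27, hs, hH, h24', h20, h2, h3, hk'⟩
    refine WP.mono (arrive_spec hc hp' h27 hs hH h24' hd.mem hd.ori.inc_right) ?_
    rintro τ'' k'' ⟨hp'', h20', h24'', h2', h3', hk''⟩
    refine ⟨hp'', hd.counted.congr (by rw [h2', h2]; rfl) (by rw [h3', h3]; rfl), h24'', ?_, by omega⟩
    rw [h20', h20]; simp [Instr.exec]
  · simp [Test.Holds, Instr.exec, h18, h21] at hk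
    refine WP.mono (startPath_spec hc (hset _ _ _ hd (by norm_num))
      (by simpa [Instr.exec] using hk)) ?_
    rintro τ' k' ⟨hp', h27, hs, hH, h24', h20, h2, h3, hk'⟩
    refine WP.mono (arrive_spec hc hp' h27 hs hH h24' hd.mem hd.ori.inc_right) ?_
    rintro τ'' k'' ⟨hp'', h20', h24'', h2', h3', hk''⟩
    refine ⟨hp'', hd.counted.congr (by rw [h2', h2]; rfl) (by rw [h3', h3]; rfl), h24'', ?_, by omega⟩
    rw [h20', h20]; simp [Instr.exec]

/-- Detaching a leaf creates a new leaf only at the other endpoint `b`. -/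
lemma Detached.deg_ne (hd : Detached σ Act K₀ fk P e a b τ) {τ' : State}
    (hold : Counted σ Act fk P τ') {v : ℕ} (hv : v ≠ b)
    (h : v ≠ a → τ'.wArr 2 v ≠ 1) : τ.wArr 2 v ≠ 1 := by
  rw [hd.counted.deg]
  by_cases hva : v = a
  · subst hva
    rw [hd.free, show inc (σ.wArr 0) (σ.wArr 1) (Act \ insert e P) v = ∅ from ?_]
    · simp
    · ext x
      simp only [mem_inc, Finset.mem_sdiff, Finset.mem_insert, not_or, Finset.notMem_empty,
        iff_false, not_and]
      rintro ⟨h1, h2, h3⟩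
      exact hd.only x h1 h3 h2
  · have h1 := h hva
    rw [hold.deg] at h1
    rwa [show inc (σ.wArr 0) (σ.wArr 1) (Act \ insert e P) v =
      inc (σ.wArr 0) (σ.wArr 1) (Act \ P) v from ?_]
    ext x
    simp only [mem_inc, Finset.mem_sdiff, Finset.mem_insert, not_or]
    refine ⟨fun ⟨⟨h1, h2, h3⟩, h4⟩ => ⟨⟨h1, h3⟩, h4⟩, fun ⟨⟨h1, h3⟩, h4⟩ => ⟨⟨h1, ?_, h3⟩, h4⟩⟩
    rintro rfl
    have := hd.ori.inc_left
    have := hd.ori.inc_right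
    have := hd.ori.ne
    grind

/-- The vertices in `S` are those known not to be leaves; the pruning leaves them so, because a new
leaf is pruned at once. Each round prunes an arc, which pays for its time. -/
lemma chaseLoop_spec (hc : PruneCtx W σ Act K₀ fk) (S : ℕ → Prop) (n : ℕ) :
    ∀ (P : Finset ℕ) (τ : State) (k : ℕ), (Act \ P).card = n → Pruned σ Act K₀ fk P ∅ τ →
    Counted σ Act fk P τ → τ.wReg 22 = τ.wArr 2 (τ.wReg 21) →
    (∀ v, S v → v ≠ τ.wReg 21 → τ.wArr 2 v ≠ 1) →
    WP W (.loop (.wEq 22 4) (detach ;; attach ;; .instr (.wCopy 21 24) ;; .instr (.wLoad 22 2 21)))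
      (fun τ' k' => ∃ P', Pruned σ Act K₀ fk P' ∅ τ' ∧ Counted σ Act fk P' τ' ∧
        (∀ v, S v → τ'.wArr 2 v ≠ 1) ∧ τ'.wReg 20 = τ.wReg 20 ∧
        k' + 43 * (Act \ P').card ≤ k + 43 * (Act \ P).card + 1) τ k := by
  induction n with
  | zero =>
    intro P τ k hcard hp hd h22 hS
    have h4 : τ.wReg 4 = 1 := by rw [hp.fr 4 (by norm_num), hc.one]
    have hne : τ.wArr 2 (τ.wReg 21) ≠ 1 := by
      rw [hd.deg, Finset.card_eq_zero.1 hcard]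
      rcases hc.two (τ.wReg 21) with h | h <;> simp [inc, h]
    rw [WP_loop]
    refine ⟨fun h => absurd (show τ.wReg 22 = τ.wReg 4 from h) (by rwa [h22, h4]), fun _ => ?_⟩
    refine ⟨P, hp, hd, fun v hv => ?_, rfl, by omega⟩
    by_cases h : v = τ.wReg 21
    · rwa [h]
    · exact hS v hv h
  | succ n ih =>
    intro P τ k hcard hp hd h22 hS
    have h4 : τ.wReg 4 = 1 := by rw [hp.fr 4 (by norm_num), hc.one]
    rw [WP_loop]
    refine ⟨fun h => ?_, fun h => ?_⟩
    · have hleaf : τ.wArr 2 (τ.wReg 21) = 1 := by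
        rw [← h22, ← h4]; exact h
      rw [WP_seq]
      refine WP.mono (detach_spec hc hp hd hleaf) ?_
      rintro τ₁ k₁ ⟨h20, hk₁, e, b, hdet⟩
      rw [WP_seq]
      refine WP.mono (attach_spec hc hdet) ?_
      rintro τ₂ k₂ ⟨hp₂, hd₂, h24, h20', hk₂⟩
      rw [WP_seq, WP_instr, WP_instr]
      have hsd : Act \ insert e P = (Act \ P).erase e := by
        ext x; simp only [Finset.mem_sdiff, Finset.mem_insert, Finset.mem_erase]; tauto
      have hcard' : (Act \ insert e P).card + 1 = (Act \ P).card := by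
        rw [hsd]
        exact Finset.card_erase_add_one (Finset.mem_sdiff.2 ⟨hdet.mem, hdet.notMem⟩)
      have h22' : ((Instr.wLoad 22 2 21).exec W ((Instr.wCopy 21 24).exec W τ₂)).wReg 21 = b := by
        simp [Instr.exec, h24]
      refine WP.mono (ih (insert e P) _ _ (by omega)
        (hp₂.of_book (fun _ _ _ => rfl) rfl (by simp [Instr.exec]) (by simp [Instr.exec, Fr.refl])
          hp₂.book) (hd₂.congr rfl rfl) (by simp [Instr.exec]) ?_) ?_
      · intro v hv hvb
        rw [h22'] at hvb
        have h5 := hdet.deg_ne hd hvb (fun h => hS v hv h)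
        rw [hdet.counted.deg] at h5
        simpa [Instr.exec, hd₂.deg] using h5
      · rintro τ₃ k₃ ⟨P', hp', hd', hS', h20'', hk'⟩
        refine ⟨P', hp', hd', hS', ?_, by omega⟩
        rw [h20'', ← h20, ← h20']; simp [Instr.exec]
    · refine ⟨P, hp, hd, fun v hv => ?_, rfl, by omega⟩
      by_cases hv' : v = τ.wReg 21
      · rw [hv', ← h22, ← h4]; exact h
      · exact hS v hv hv'

lemma chase_spec (hc : PruneCtx W σ Act K₀ fk) (S : ℕ → Prop) (hp : Pruned σ Act K₀ fk P ∅ τ)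
    (hd : Counted σ Act fk P τ) (hS : ∀ v, S v → τ.wArr 2 v ≠ 1) :
    WP W chase (fun τ' k' => ∃ P', Pruned σ Act K₀ fk P' ∅ τ' ∧ Counted σ Act fk P' τ' ∧
        (∀ v, S v ∨ v = τ.wReg 21 → τ'.wArr 2 v ≠ 1) ∧ τ'.wReg 20 = τ.wReg 20 ∧
        k' + 43 * (Act \ P').card ≤ k + 43 * (Act \ P).card + 2) τ k := by
  rw [chase, WP_seq, WP_instr]
  refine WP.mono (chaseLoop_spec hc (fun v => S v ∨ v = τ.wReg 21) _ P _ _ rfl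
    (hp.of_book (fun _ _ _ => rfl) rfl (by simp [Instr.exec]) (by simp [Instr.exec, Fr.refl])
      hp.book) (hd.congr rfl rfl) (by simp [Instr.exec]) ?_) ?_
  · intro v hv hne
    rcases hv with hv | hv
    · exact hS v hv
    · exact absurd hv (by simpa [Instr.exec] using hne)
  · rintro τ₃ k₃ ⟨P', hp', hd', hS', h20, hk'⟩
    exact ⟨P', hp', hd', hS', by rw [h20]; simp [Instr.exec], by omega⟩

/-- After all endpoints have been visited there is no leaf left, so that all arcs have been pruned. -/
lemma scanLoop_spec (hc : PruneCtx W σ Act K₀ fk) (hAct : Act ⊆ El σ) (h12 : σ.wReg 12 < W)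
    (h14 : σ.wReg 14 < W) (h11 : σ.wReg 11 ≤ σ.wReg 12) (h13 : σ.wReg 13 ≤ σ.wReg 14)
    (hdis : σ.wReg 14 ≤ σ.wReg 11) (h19 : σ.wReg 12 ≤ σ.wReg 19)
    (hp : Pruned σ Act K₀ fk ∅ ∅ σ) (hd : Counted σ Act fk ∅ σ) :
    WP W (forEl scanBody) (fun τ k' => Pruned σ Act K₀ fk Act ∅ τ ∧ Counted σ Act fk Act τ ∧
      k' ≤ k + 60 * (El σ).card + 4) σ k := by
  let J : Finset ℕ → State → ℕ → Prop := fun T τ l => ∃ P, Pruned σ Act K₀ fk P ∅ τ ∧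
    Counted σ Act fk P τ ∧
    (∀ v, (∃ e ∈ T, v = σ.wArr 0 e ∨ v = σ.wArr 1 e) → τ.wArr 2 v ≠ 1) ∧
    l + 43 * (Act \ P).card ≤ k + 43 * Act.card + 10 * T.card
  refine WP.mono (WP_forEl (J := J) hc.one h12 h14 h11 h13 hdis ?_ ?_ ?_) ?_
  · rintro T τ l v ⟨P, hp, hd, hS, hl⟩
    exact ⟨P, hp.of_book (fun _ _ _ => rfl) rfl (by simp) (by simp [Fr.refl]) hp.book,
      hd.congr rfl rfl, hS, hl⟩
  · exact ⟨∅, hp, hd, by simp, by simp⟩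
  · rintro T τ l e hfr he heT hTE h20 ⟨P, hp, hd, hS, hl⟩
    have hlt : e < σ.wReg 19 := by
      simp only [El, Finset.mem_union, Finset.mem_Ico] at he; omega
    rw [scanBody, WP_seq, WP_instr, WP_seq]
    refine WP.mono (chase_spec hc (fun v => ∃ e ∈ T, v = σ.wArr 0 e ∨ v = σ.wArr 1 e)
      (hp.of_book (fun _ _ _ => rfl) rfl (by simp [Instr.exec])
      (by simp [Instr.exec, Fr.refl]) hp.book) (hd.congr rfl rfl) hS) ?_
    rintro τ₁ k₁ ⟨P₁, hp₁, hd₁, hS₁, h20₁, hk₁⟩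
    have h20' : τ₁.wReg 20 = e := by rw [h20₁]; simp [Instr.exec, h20]
    rw [WP_seq, WP_instr]
    refine WP.mono (chase_spec hc _ (hp₁.of_book (fun _ _ _ => rfl) rfl (by simp [Instr.exec])
      (by simp [Instr.exec, Fr.refl]) hp₁.book) (hd₁.congr rfl rfl) hS₁) ?_
    rintro τ₂ k₂ ⟨P₂, hp₂, hd₂, hS₂, h20₂, hk₂⟩
    refine ⟨fun r hr => by rw [hp₂.fr r hr, hp.fr r hr], ?_, P₂, hp₂, hd₂, ?_, ?_⟩
    · rw [h20₂]; simp [Instr.exec, h20']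
    · rintro v ⟨e', he', hv⟩
      apply hS₂
      rcases Finset.mem_insert.1 he' with rfl | he'
      · rcases hv with hv | hv
        · left; right; simp [Instr.exec, h20, hv, (hp.old _ hlt).1]
        · right; simp [Instr.exec, h20', hv, (hp₁.old _ hlt).2.1]
      · exact .inl (.inl ⟨e', he', hv⟩)
    · rw [Finset.card_insert_of_notMem heT]; omega
  · rintro τ k' ⟨hfr, l, ⟨P, hp, hd, hS, hl⟩, rfl⟩
    have hPA : Act \ P = ∅ := by
      by_contra hne
      obtain ⟨v₀, hv₀⟩ := hc.root
      obtain ⟨v, hv, hv1⟩ := (hc.acyc.subset Finset.sdiff_subset).exists_leaf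
        (Finset.nonempty_iff_ne_empty.2 hne) v₀
      obtain ⟨e, he⟩ := Finset.card_eq_one.1 hv1
      have hmem : e ∈ inc (σ.wArr 0) (σ.wArr 1) (Act \ P) v := by rw [he]; simp
      obtain ⟨h1, h2⟩ := mem_inc.1 hmem
      refine hS v ⟨e, hAct (Finset.mem_sdiff.1 h1).1, h2.imp Eq.symm Eq.symm⟩ ?_
      rw [hd.deg, hv1, hv₀ v hv]
    have hP : P = Act := Finset.Subset.antisymm hp.rep.sub (Finset.sdiff_eq_empty_iff_subset.1 hPA)
    subst hP
    have := Finset.card_le_card hAct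
    exact ⟨hp, hd, by omega⟩

end RealRAM

namespace RealRAM
open FlowRounding

variable {W : ℕ} {σ τ : State} {K₀ : Finset ℕ} {fk : ℕ → ℕ} {k : ℕ}

/-! ### The compression routine -/

lemma cleanLoop_spec (h4 : σ.wReg 4 = 1) (h18 : σ.wReg 18 = 0) (h12 : σ.wReg 12 < W)
    (h14 : σ.wReg 14 < W) (h11 : σ.wReg 11 ≤ σ.wReg 12) (h13 : σ.wReg 13 ≤ σ.wReg 14)
    (hdis : σ.wReg 14 ≤ σ.wReg 11)
    (hkey : ∀ v, σ.wArr 4 v ≠ 0 → v ∈ K₀ ∨ ∃ e ∈ El σ, σ.wArr 0 e = v ∨ σ.wArr 1 e = v)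
    (hpend : ∀ v, σ.wArr 5 v ≠ 0 → ∃ e ∈ El σ, σ.wArr 0 e = v ∨ σ.wArr 1 e = v) :
    WP W (forEl cleanBody) (fun τ k' => Fr σ τ ∧ (∀ a, a ≠ 4 → a ≠ 5 → τ.wArr a = σ.wArr a) ∧
      τ.rArr = σ.rArr ∧ τ.wReg 19 = σ.wReg 19 ∧ (∀ v, τ.wArr 4 v ≠ 0 → v ∈ K₀) ∧
      (∀ v, τ.wArr 5 v = 0) ∧ k' ≤ k + 8 * (El σ).card + 4) σ k := by
  let J : Finset ℕ → State → ℕ → Prop := fun T τ l =>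
    (∀ a, a ≠ 4 → a ≠ 5 → τ.wArr a = σ.wArr a) ∧ τ.rArr = σ.rArr ∧ τ.wReg 19 = σ.wReg 19 ∧
    (∀ v, τ.wArr 4 v ≠ 0 → v ∈ K₀ ∨ ∃ e ∈ El σ, e ∉ T ∧ (σ.wArr 0 e = v ∨ σ.wArr 1 e = v)) ∧
    (∀ v, τ.wArr 5 v ≠ 0 → ∃ e ∈ El σ, e ∉ T ∧ (σ.wArr 0 e = v ∨ σ.wArr 1 e = v)) ∧
    l ≤ k + 8 * T.card
  refine WP.mono (WP_forEl (J := J) h4 h12 h14 h11 h13 hdis ?_ ?_ ?_) ?_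
  · rintro T τ l v ⟨h1, h2, h3, h4, h5, h6⟩
    exact ⟨h1, h2, by simpa using h3, h4, h5, h6⟩
  · exact ⟨fun _ _ _ => rfl, rfl, rfl, by simpa using hkey, by simpa using hpend, by simp⟩
  · rintro T τ l e hfr he heT hTE h20 ⟨h1, h2, h3, h4, h5, h6⟩
    have h18' : τ.wReg 18 = 0 := by rw [hfr 18 (by norm_num), h18]
    have hc : (insert e T).card = T.card + 1 := Finset.card_insert_of_notMem heT
    have e0 : τ.wArr 0 = σ.wArr 0 := h1 0 (by norm_num) (by norm_num)
    have e1 : τ.wArr 1 = σ.wArr 1 := h1 1 (by norm_num) (by norm_num)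
    simp only [cleanBody, WP_seq, WP_instr, Instr.exec]
    refine ⟨by simp [Fr.refl], by simp [h20], fun a ha hb => by simp [ha, hb, h1], by simp [h2],
      by simp [h3], fun v hv => ?_, fun v hv => ?_, by omega⟩
    all_goals
      have hv1 : v ≠ σ.wArr 1 e := by
        rintro rfl; simp [h20, h18', e0, e1] at hv
      have hv0 : v ≠ σ.wArr 0 e := by
        rintro rfl; simp [h20, h18', e0, e1, hv1] at hv
      simp [h20, h18', e0, e1, hv1, hv0] at hv
    · refine (h4 v hv).imp_right fun ⟨e', he', hT', hi⟩ => ⟨e', he', ?_, hi⟩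
      rw [Finset.mem_insert, not_or]
      exact ⟨by rintro rfl; exact hi.elim (fun h => hv0 h.symm) (fun h => hv1 h.symm), hT'⟩
    · obtain ⟨e', he', hT', hi⟩ := h5 v hv
      refine ⟨e', he', ?_, hi⟩
      rw [Finset.mem_insert, not_or]
      exact ⟨by rintro rfl; exact hi.elim (fun h => hv0 h.symm) (fun h => hv1 h.symm), hT'⟩
  · rintro τ k' ⟨hfr, l, ⟨h1, h2, h3, h4, h5, h6⟩, rfl⟩
    refine ⟨hfr, h1, h2, h3, fun v hv => ?_, fun v => ?_, by omega⟩
    · exact (h4 v hv).elim id fun ⟨e, he, hn, _⟩ => absurd he hn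
    · by_contra hv
      obtain ⟨e, he, hn, _⟩ := h5 v hv
      exact hn he

/-- Assumptions of the compression routine: `K₀` is the set of marked vertices, and the counters hold
the values of `fk`, so that a vertex with `fk v = 2` never becomes a leaf. -/
structure CompressPre (W : ℕ) (σ : State) (K₀ : Finset ℕ) (fk : ℕ → ℕ) : Prop where
  one : σ.wReg 4 = 1
  zero : σ.wReg 18 = 0
  r11 : σ.wReg 11 ≤ σ.wReg 12
  r13 : σ.wReg 13 ≤ σ.wReg 14
  disj : σ.wReg 14 ≤ σ.wReg 11
  nx : σ.wReg 19 = σ.wReg 12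
  pos : 0 < σ.wReg 12
  deg : σ.wArr 2 = fk
  sum : σ.wArr 3 = fun _ => 0
  key : ∀ v, σ.wArr 4 v ≠ 0 ↔ v ∈ K₀
  pend : σ.wArr 5 = fun _ => 0
  acyc : Acyc (σ.wArr 0) (σ.wArr 1) (actS σ (El σ))
  par : ∀ e ∈ El σ, σ.wArr 6 e = 0
  two : ∀ v, fk v = 0 ∨ fk v = 2
  root : ∃ v₀, ∀ v, v ≠ v₀ → fk v = 0
  bound : σ.wReg 12 + 2 * K₀.card < W
  card : (El σ).card + 2 < W
  sumlt : ∑ e ∈ El σ, e < W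
  ne : K₀.Nonempty

/-- The result of compressing the active arcs of state `σ` to paths. -/
structure Compressed (σ : State) (K₀ : Finset ℕ) (fk : ℕ → ℕ) (τ : State) : Prop where
  rep : Represents (σ.wArr 0) (σ.wArr 1) (upRes σ) (dnRes σ) (actS σ (El σ))
    (fun v => v ∉ K₀ ∧ fk v = 0) (actS σ (El σ)) (newPaths σ τ) (τ.wArr 0) (τ.wArr 1) (τ.wArr 6)
    (τ.wArr 7) (τ.rArr 3) (τ.rArr 4)
  start : ∃ K : Finset ℕ, K.card + 1 ≤ 2 * K₀.card ∧ K₀ ⊆ K ∧ ∀ s ∈ newPaths σ τ, τ.wArr 0 s ∈ K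
  card : (newPaths σ τ).card + 1 ≤ 2 * K₀.card
  old : ∀ e < σ.wReg 19, τ.wArr 0 e = σ.wArr 0 e ∧ τ.wArr 1 e = σ.wArr 1 e ∧
    τ.rArr 3 e = σ.rArr 3 e ∧ τ.rArr 4 e = σ.rArr 4 e ∧ τ.rArr 5 e = σ.rArr 5 e
  fresh : ∀ s ∈ newPaths σ τ, τ.rArr 5 s = 0
  par_out : ∀ e, e ∉ actS σ (El σ) → τ.wArr 6 e = σ.wArr 6 e
  dir_out : ∀ e, e ∉ actS σ (El σ) → τ.wArr 7 e = σ.wArr 7 e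
  wother : ∀ a, 8 ≤ a → τ.wArr a = σ.wArr a
  rother : ∀ a, a ≠ 3 → a ≠ 4 → a ≠ 5 → τ.rArr a = σ.rArr a
  le : σ.wReg 19 ≤ τ.wReg 19
  fr : Fr σ τ
  deg : τ.wArr 2 = fk
  sum : τ.wArr 3 = fun _ => 0
  key : ∀ v, τ.wArr 4 v ≠ 0 → v ∈ K₀
  pend : τ.wArr 5 = fun _ => 0

lemma mem_El_lt (h : CompressPre W σ K₀ fk) {e : ℕ} (he : e ∈ El σ) : e < σ.wReg 19 := by
  have := h.r11; have := h.disj; have := h.nx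
  simp only [El, Finset.mem_union, Finset.mem_Ico] at he
  omega

/-- The forest is compressed to fewer than `2 |K₀|` paths in linear time. -/
lemma compress_spec (h : CompressPre W σ K₀ fk) :
    WP W compress (fun τ k' => Compressed σ K₀ fk τ ∧ k' ≤ k + 92 * (El σ).card + 12) σ k := by
  have h12 : σ.wReg 12 < W := by have := h.bound; omega
  have h14 : σ.wReg 14 < W := by have := h.r11; have := h.disj; omega
  rw [compress, WP_seq]
  refine WP.mono (degLoop_spec h.one h12 h14 h.r11 h.r13 h.disj h.deg h.sum
    (fun e he => h.acyc.ne he) (fun v => ?_) h.sumlt) ?_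
  · have := h.card
    rcases h.two v with h | h <;> omega
  rintro τ₁ k₁ ⟨hfr₁, ⟨hw₁, hr₁, h19₁⟩, hd₁, hs₁, hk₁⟩
  have hEl : El τ₁ = El σ := El_congr hfr₁
  have w₁ : ∀ a, a ≠ 2 → a ≠ 3 → τ₁.wArr a = σ.wArr a := hw₁
  have e0 := w₁ 0 (by norm_num) (by norm_num)
  have e1 := w₁ 1 (by norm_num) (by norm_num)
  have e4 := w₁ 4 (by norm_num) (by norm_num)
  have e5 := w₁ 5 (by norm_num) (by norm_num)
  have e6 := w₁ 6 (by norm_num) (by norm_num)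
  have e7 := w₁ 7 (by norm_num) (by norm_num)
  have hup : upRes τ₁ = upRes σ := by funext e; simp [upRes, hr₁]
  have hdn : dnRes τ₁ = dnRes σ := by funext e; simp [dnRes, hr₁]
  have r4 : τ₁.wReg 4 = 1 := by rw [hfr₁ 4 (by norm_num), h.one]
  have r18 : τ₁.wReg 18 = 0 := by rw [hfr₁ 18 (by norm_num), h.zero]
  have r11 := hfr₁ 11 (by norm_num)
  have r12 := hfr₁ 12 (by norm_num)
  have r13 := hfr₁ 13 (by norm_num)
  have r14 := hfr₁ 14 (by norm_num)
  set Act := actS σ (El σ) with hAct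
  have hActE : Act ⊆ El σ := Finset.filter_subset _ _
  have hctx : PruneCtx W τ₁ Act K₀ fk := by
    refine ⟨r4, r18, by rw [h19₁, h.nx]; exact h.pos, fun e he => ?_, fun e he => ?_, ?_, ?_,
      h.two, h.root, by rw [h19₁, h.nx]; exact h.bound⟩
    · rw [h19₁]; exact mem_El_lt h (hActE he)
    · rw [hup, hdn]; exact (mem_actS.1 he).2
    · rw [e0, e1]; exact h.acyc
    · rw [e6]; exact fun e he => h.par e (hActE he)
  have hnew : newPaths τ₁ τ₁ = ∅ := by simp [newPaths]
  have hp₁ : Pruned τ₁ Act K₀ fk ∅ ∅ τ₁ := by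
    refine ⟨?_, ?_, fun e _ => ⟨rfl, rfl, rfl, rfl, rfl⟩, by simp [hnew], fun _ _ => rfl,
      fun _ _ => rfl, fun _ _ => rfl, fun _ _ _ _ => rfl, le_rfl, Fr.refl _⟩
    · rw [hnew]
      exact ⟨by simp, by simp, by simp, fun _ _ => ⟨0, by simp⟩, by simp, by simp, by simp,
        by simp⟩
    · rw [hnew, e4, e5, h.pend]
      refine ⟨by simp, by simp, by simp, fun v hv => (h.key v).2 hv, by simp, by simp,
        fun v hv => .inl ((h.key v).1 hv), by simp, K₀, ∅, h.key, by simp, by simp, ?_⟩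
      have := h.ne.card_pos
      omega
  have hd₁' : Counted τ₁ Act fk ∅ τ₁ := by
    constructor
    · intro v; rw [hd₁, Finset.sdiff_empty, e0, e1]
    · intro v; rw [hs₁, Finset.sdiff_empty, e0, e1]
  rw [WP_seq]
  refine WP.mono (scanLoop_spec hctx (hEl ▸ hActE) (by rwa [r12]) (by rwa [r14])
    (by rw [r11, r12]; exact h.r11) (by rw [r13, r14]; exact h.r13)
    (by rw [r14, r11]; exact h.disj) (by rw [r12, h19₁, h.nx]) hp₁ hd₁') ?_
  rintro τ₂ k₂ ⟨hp, hd, hk₂⟩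
  have hEl₂ : El τ₂ = El σ := (El_congr hp.fr).trans hEl
  have hlt : ∀ e ∈ El σ, e < τ₁.wReg 19 := fun e he => by rw [h19₁]; exact mem_El_lt h he
  have s4 : τ₂.wReg 4 = 1 := by rw [hp.fr 4 (by norm_num), r4]
  have s18 : τ₂.wReg 18 = 0 := by rw [hp.fr 18 (by norm_num), r18]
  have s11 := (hp.fr 11 (by norm_num)).trans r11
  have s12 := (hp.fr 12 (by norm_num)).trans r12
  have s13 := (hp.fr 13 (by norm_num)).trans r13
  have s14 := (hp.fr 14 (by norm_num)).trans r14
  have hconv : ∀ v, (∃ e ∈ Act, τ₁.wArr 0 e = v ∨ τ₁.wArr 1 e = v) →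
      ∃ e ∈ El τ₂, τ₂.wArr 0 e = v ∨ τ₂.wArr 1 e = v := by
    rintro v ⟨e, he, hi⟩
    have h1 := hActE he
    obtain ⟨o0, o1, -⟩ := hp.old e (hlt e h1)
    exact ⟨e, hEl₂ ▸ h1, by rwa [o0, o1]⟩
  refine WP.mono (cleanLoop_spec (K₀ := K₀) s4 s18 (by rwa [s12]) (by rwa [s14])
    (by rw [s11, s12]; exact h.r11) (by rw [s13, s14]; exact h.r13)
    (by rw [s14, s11]; exact h.disj) (fun v hv => (hp.book.key_loc v hv).imp_right (hconv v))
    (fun v hv => hconv v (hp.book.pend_loc v hv))) ?_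
  rintro τ₃ k₃ ⟨hfr₃, hw₃, hr₃, h19₃, hkey₃, hpend₃, hk₃⟩
  have hn : newPaths σ τ₃ = newPaths τ₁ τ₂ := by simp only [newPaths, h19₃, h19₁]
  have f0 := hw₃ 0 (by norm_num) (by norm_num)
  have f1 := hw₃ 1 (by norm_num) (by norm_num)
  have f6 := hw₃ 6 (by norm_num) (by norm_num)
  have f7 := hw₃ 7 (by norm_num) (by norm_num)
  have hrep := hp.rep
  have hcard := hp.book.card_le
  have hold := hp.old
  have hfresh := hp.fresh
  have hstart := hp.book.key_start
  have hpar := hp.par_out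
  have hdir := hp.dir_out
  rw [← hn, ← f0, ← f1, ← f6, ← f7, ← hr₃, e0, e1, hup, hdn] at hrep
  rw [← f0, ← f1, ← hr₃, e0, e1, hr₁, h19₁] at hold
  rw [← hn, ← hr₃] at hfresh
  rw [← hn] at hcard
  rw [← f6, e6] at hpar
  rw [← f7, e7] at hdir
  rw [← hn, ← f0] at hstart
  refine ⟨⟨hrep, ?_, hcard, hold, hfresh, hpar, hdir, ?_, ?_, ?_, ?_, ?_, ?_, hkey₃,
    funext hpend₃⟩, by rw [hEl] at hk₂; rw [hEl₂] at hk₃; omega⟩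
  · obtain ⟨K, Q, hK, -, -, hle⟩ := hp.book.count
    exact ⟨K, hle, fun v hv => (hK v).1 (hp.book.key_term v hv), fun s hs => (hK _).1 (hstart s hs)⟩
  · intro a ha
    rw [hw₃ a (by omega) (by omega), hp.wother a ha, w₁ a (by omega) (by omega)]
  · intro a h3 h4 h5
    rw [hr₃, hp.rother a h3 h4 h5, hr₁]
  · have := hp.le; omega
  · exact (hfr₁.trans hp.fr).trans hfr₃
  · funext v
    rw [hw₃ 2 (by norm_num) (by norm_num), hd.deg]
    simp [inc]
  · funext v
    rw [hw₃ 3 (by norm_num) (by norm_num), hd.sum]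
    simp [inc]

/-! ### Writing back the flow on the paths -/

/-- Each arc receives the flow on the path it belongs to. Paths must not themselves be treated as
arcs in the same loop. -/
lemma wbLoop_spec (h4 : σ.wReg 4 = 1) (h18 : σ.wReg 18 = 0) (h12 : σ.wReg 12 < W)
    (h14 : σ.wReg 14 < W) (h11 : σ.wReg 11 ≤ σ.wReg 12) (h13 : σ.wReg 13 ≤ σ.wReg 14)
    (hdis : σ.wReg 14 ≤ σ.wReg 11)
    (hpar : ∀ e ∈ El σ, σ.wArr 6 e ≠ 0 → σ.wArr 6 e ∉ El σ) :
    WP W (forEl wbBody) (fun τ k' => Fr σ τ ∧ (∀ a, a ≠ 6 → τ.wArr a = σ.wArr a) ∧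
      (∀ a, a ≠ 5 → τ.rArr a = σ.rArr a) ∧
      (∀ e, τ.wArr 6 e = if e ∈ El σ then 0 else σ.wArr 6 e) ∧
      (∀ e, τ.rArr 5 e = σ.rArr 5 e +
        if e ∈ El σ then pull (σ.wArr 6) (σ.wArr 7) (σ.rArr 5) e else 0) ∧
      k' ≤ k + 12 * (El σ).card + 4) σ k := by
  let J : Finset ℕ → State → ℕ → Prop := fun T τ l =>
    (∀ a, a ≠ 6 → τ.wArr a = σ.wArr a) ∧ (∀ a, a ≠ 5 → τ.rArr a = σ.rArr a) ∧
    (∀ e, τ.wArr 6 e = if e ∈ T then 0 else σ.wArr 6 e) ∧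
    (∀ e, τ.rArr 5 e = σ.rArr 5 e +
        if e ∈ T then pull (σ.wArr 6) (σ.wArr 7) (σ.rArr 5) e else 0) ∧
    l ≤ k + 12 * T.card
  refine WP.mono (WP_forEl (J := J) h4 h12 h14 h11 h13 hdis ?_ ?_ ?_) ?_
  · rintro T τ l v ⟨h1, h2, h3, h4, h5⟩
    exact ⟨h1, h2, h3, h4, h5⟩
  · exact ⟨fun _ _ => rfl, fun _ _ => rfl, by simp, by simp, by simp⟩
  · rintro T τ l e hfr he heT hTE h20 ⟨h1, h2, h3, h4, h5⟩
    have h18' : τ.wReg 18 = 0 := by rw [hfr 18 (by norm_num), h18]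
    have hc : (insert e T).card = T.card + 1 := Finset.card_insert_of_notMem heT
    have h6 : τ.wArr 6 e = σ.wArr 6 e := by rw [h3, if_neg heT]
    have h7 : τ.wArr 7 = σ.wArr 7 := h1 7 (by norm_num)
    have hD : τ.rArr 5 e = σ.rArr 5 e := by rw [h4, if_neg heT, add_zero]
    have hDs : σ.wArr 6 e ≠ 0 → τ.rArr 5 (σ.wArr 6 e) = σ.rArr 5 (σ.wArr 6 e) := fun h => by
      rw [h4, if_neg (fun h' => hpar e he h (hTE h')), add_zero]
    simp only [wbBody, WP_seq, WP_instr, WP_ite, WP_skip, Instr.exec, Test.Holds]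
    refine ⟨fun hp => ?_, fun hp => ⟨fun hd => ?_, fun hd => ?_⟩⟩
    · simp [h20, h18', h6] at hp
      refine ⟨by simp [Fr.refl], by simp [h20], by simpa using h1, by simpa using h2,
        fun e' => ?_, fun e' => ?_, by omega⟩
      · by_cases hee : e' = e
        · subst hee; simp [h6, hp]
        · simp [hee, h3]
      · by_cases hee : e' = e
        · subst hee; simp [hD, pull, hp]
        · simp [hee, h4]
    all_goals
      simp [h20, h18', h6, h7] at hp hd
      refine ⟨by simp [Fr.refl], by simp [h20], fun a ha => by simp [ha, h1],
        fun a ha => by simp [ha, h2], fun e' => ?_, fun e' => ?_, by omega⟩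
      · by_cases hee : e' = e
        · subst hee; simp [h20, h18']
        · simp [hee, h3, h20]
    · by_cases hee : e' = e
      · subst hee; simp [h20, h6, hD, hDs hp, pull, sgn, hp, hd]
      · simp [hee, h4, h20]
    · by_cases hee : e' = e
      · subst hee; simp [h20, h6, hD, hDs hp, pull, sgn, hp, hd]; ring
      · simp [hee, h4, h20]
  · rintro τ k' ⟨hfr, l, ⟨h1, h2, h3, h4, h5⟩, rfl⟩
    exact ⟨hfr, h1, h2, h3, h4, by omega⟩

/-! ### Marking terminals -/

/-- The endpoints of the arcs in `I`. -/
def ends (σ : State) (I : Finset ℕ) : Finset ℕ := I.image (σ.wArr 0) ∪ I.image (σ.wArr 1)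

lemma mem_ends {I : Finset ℕ} {v : ℕ} :
    v ∈ ends σ I ↔ ∃ e ∈ I, σ.wArr 0 e = v ∨ σ.wArr 1 e = v := by
  simp only [ends, Finset.mem_union, Finset.mem_image]
  constructor
  · rintro (⟨e, h, h'⟩ | ⟨e, h, h'⟩)
    exacts [⟨e, h, .inl h'⟩, ⟨e, h, .inr h'⟩]
  · rintro ⟨e, h, h' | h'⟩
    exacts [.inl ⟨e, h, h'⟩, .inr ⟨e, h, h'⟩]

lemma markLoop_spec {x : ℕ} (hx : x < 19) (h4 : σ.wReg 4 = 1) (h17 : σ.wReg 17 < W)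
    (hle : σ.wReg 8 ≤ σ.wReg 17) :
    WP W (forRange 8 17 (markBody x)) (fun τ k' => Fr σ τ ∧ (∀ a, a ≠ 4 → τ.wArr a = σ.wArr a) ∧
      τ.rArr = σ.rArr ∧ τ.wReg 19 = σ.wReg 19 ∧
      (∀ v, τ.wArr 4 v = if v ∈ ends σ (Finset.Ico (σ.wReg 8) (σ.wReg 17)) then σ.wReg x
        else σ.wArr 4 v) ∧
      k' ≤ k + 6 * (σ.wReg 17 - σ.wReg 8) + 2) σ k := by
  let J : Finset ℕ → State → ℕ → Prop := fun T τ l =>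
    (∀ a, a ≠ 4 → τ.wArr a = σ.wArr a) ∧ τ.rArr = σ.rArr ∧ τ.wReg 19 = σ.wReg 19 ∧
    (∀ v, τ.wArr 4 v = if v ∈ ends σ T then σ.wReg x else σ.wArr 4 v) ∧ l ≤ k + 6 * T.card
  refine WP.mono (WP_forRange (J := J) (T₀ := ∅) (by norm_num) rfl rfl h4 h17 hle (by simp)
    ?_ ?_ ?_) ?_
  · rintro T τ l v ⟨h1, h2, h3, h4, h5⟩
    exact ⟨h1, h2, by simpa using h3, h4, h5⟩
  · exact ⟨fun _ _ => rfl, rfl, rfl, by simp [ends], by simp⟩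
  · rintro T τ l e hfr he heT hTE h20 ⟨h1, h2, h3, h4, h5⟩
    have hc : (insert e T).card = T.card + 1 := Finset.card_insert_of_notMem heT
    have e0 : τ.wArr 0 = σ.wArr 0 := h1 0 (by norm_num)
    have e1 : τ.wArr 1 = σ.wArr 1 := h1 1 (by norm_num)
    have hxx := hfr x hx
    have x21 : x ≠ 21 := by omega
    simp only [markBody, WP_seq, WP_instr, Instr.exec]
    refine ⟨by simp [Fr.refl], by simp [h20], fun a ha => by simp [ha, h1], by simp [h2],
      by simp [h3], fun v => ?_, by omega⟩
    have hmem : v ∈ ends σ (insert e T) ↔ σ.wArr 0 e = v ∨ σ.wArr 1 e = v ∨ v ∈ ends σ T := by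
      simp only [mem_ends, Finset.mem_insert]
      grind
    simp only [hmem]
    by_cases hv1 : v = σ.wArr 1 e
    · simp [hv1, h20, e0, e1, x21, hxx]
    · by_cases hv0 : v = σ.wArr 0 e
      · simp [hv0, h20, e0, e1, x21, hxx, Function.update_apply]
      · simp [hv0, hv1, Ne.symm hv0, Ne.symm hv1, h20, e0, e1, x21, hxx, h4]
  · rintro τ k' ⟨hfr, l, ⟨h1, h2, h3, h4, h5⟩, rfl⟩
    rw [Finset.empty_union] at h4 h5
    rw [Nat.card_Ico] at h5
    exact ⟨hfr, h1, h2, h3, h4, by omega⟩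

end RealRAM

namespace RealRAM
open FlowRounding

/-! ### From a solution on the paths to a solution on the arcs -/

/-- In state `σ` the active arcs in `L` form a forest, and the arcs in `I` are to be inserted. The
forest is represented by the paths in `C`, and in state `ρ` the arcs in `I` have been inserted into
the forest of paths. State `ω` arises from `ρ` by transferring the flow on the paths to the arcs. -/
structure WriteBack (σ ρ ω : State) (L I C : Finset ℕ) (ok : ℕ → Prop) : Prop where
  rep : Represents (σ.wArr 0) (σ.wArr 1) (upRes σ) (dnRes σ) (actS σ L) ok (actS σ L) C
    (ρ.wArr 0) (ρ.wArr 1) (ρ.wArr 6) (ρ.wArr 7) (ρ.rArr 3) (ρ.rArr 4)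
  disj : Disjoint L I
  disjC : Disjoint C I
  ne_zero : ∀ s ∈ C, s ≠ 0
  same : ∀ e ∈ L ∪ I, ρ.wArr 0 e = σ.wArr 0 e ∧ ρ.wArr 1 e = σ.wArr 1 e ∧
    ρ.rArr 3 e = σ.rArr 3 e ∧ ρ.rArr 4 e = σ.rArr 4 e
  flowL : ∀ e ∈ L, ρ.rArr 5 e = σ.rArr 5 e
  flowI : ∀ e ∈ I, σ.rArr 5 e = 0
  par : ∀ e ∈ L ∪ I, e ∉ actS σ L → ρ.wArr 6 e = 0
  ok : ∀ e ∈ actS ρ I, ∀ v, ok v → bd (σ.wArr 0) (σ.wArr 1) e v = 0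
  bddL : ∀ e ∈ L, 0 ≤ upRes σ e ∧ 0 ≤ dnRes σ e
  acyc : Acyc (ρ.wArr 0) (ρ.wArr 1) (actS ρ (C ∪ I))
  bdd : ∀ e ∈ C ∪ I, 0 ≤ upRes ρ e ∧ 0 ≤ dnRes ρ e
  cons : ∀ v, ∑ e ∈ C ∪ I, ρ.rArr 5 e * bd (ρ.wArr 0) (ρ.wArr 1) e v = 0
  w0 : ω.wArr 0 = ρ.wArr 0
  w1 : ω.wArr 1 = ρ.wArr 1
  r3 : ω.rArr 3 = ρ.rArr 3
  r4 : ω.rArr 4 = ρ.rArr 4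
  flow : ∀ e, ω.rArr 5 e = ρ.rArr 5 e +
    if e ∈ L ∪ I then pull (ρ.wArr 6) (ρ.wArr 7) (ρ.rArr 5) e else 0

namespace WriteBack

variable {σ ρ ω : State} {L I C : Finset ℕ} {ok : ℕ → Prop}

lemma flow_I (h : WriteBack σ ρ ω L I C ok) {e : ℕ} (he : e ∈ I) :
    ω.rArr 5 e = ρ.rArr 5 e := by
  have : e ∉ actS σ L := fun h' => Finset.disjoint_left.1 h.disj (mem_actS.1 h').1 he
  rw [h.flow, if_pos (Finset.mem_union_right _ he), pull,
    if_pos (h.par e (Finset.mem_union_right _ he) this), add_zero]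

lemma flow_L (h : WriteBack σ ρ ω L I C ok) {e : ℕ} (he : e ∈ L) :
    ω.rArr 5 e = σ.rArr 5 e + pull (ρ.wArr 6) (ρ.wArr 7) (ρ.rArr 5) e := by
  rw [h.flow, if_pos (Finset.mem_union_left _ he), h.flowL e he]

lemma flow_inactive (h : WriteBack σ ρ ω L I C ok) {e : ℕ} (he : e ∈ L) (he' : e ∉ actS σ L) :
    ω.rArr 5 e = σ.rArr 5 e := by
  rw [h.flow_L he, pull, if_pos (h.par e (Finset.mem_union_left _ he) he'), add_zero]

lemma res_I (h : WriteBack σ ρ ω L I C ok) {e : ℕ} (he : e ∈ I) :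
    upRes ω e = upRes ρ e ∧ dnRes ω e = dnRes ρ e := by
  simp [upRes, dnRes, h.r3, h.r4, h.flow_I he]

lemma res_inactive (h : WriteBack σ ρ ω L I C ok) {e : ℕ} (he : e ∈ L) (he' : e ∉ actS σ L) :
    upRes ω e = upRes σ e ∧ dnRes ω e = dnRes σ e := by
  obtain ⟨-, -, h3, h4⟩ := h.same e (Finset.mem_union_left _ he)
  simp [upRes, dnRes, h.r3, h.r4, h3, h4, h.flow_inactive he he']

lemma along_res (h : WriteBack σ ρ ω L I C ok) {e : ℕ} (he : e ∈ L) (hp : ρ.wArr 6 e ≠ 0) :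
    along (ρ.wArr 7) (upRes ω) (dnRes ω) e =
      along (ρ.wArr 7) (upRes σ) (dnRes σ) e - ρ.rArr 5 (ρ.wArr 6 e) ∧
    along (ρ.wArr 7) (dnRes ω) (upRes ω) e =
      along (ρ.wArr 7) (dnRes σ) (upRes σ) e + ρ.rArr 5 (ρ.wArr 6 e) := by
  obtain ⟨-, -, h3, h4⟩ := h.same e (Finset.mem_union_left _ he)
  have h5 := h.flow_L he
  rw [pull, if_neg hp] at h5
  simp only [along, upRes, dnRes, h.r3, h.r4, h3, h4, h5, sgn]
  split_ifs <;> constructor <;> ring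

lemma bdd' (h : WriteBack σ ρ ω L I C ok) {e : ℕ} (he : e ∈ L ∪ I) :
    0 ≤ upRes ω e ∧ 0 ≤ dnRes ω e := by
  rcases Finset.mem_union.1 he with he | he
  · by_cases ha : e ∈ actS σ L
    · rcases h.rep.par_mem e ha with hp | hp
      · have h5 := h.flow_L he
        obtain ⟨-, -, h3, h4⟩ := h.same e (Finset.mem_union_left _ he)
        rw [pull, if_pos hp, add_zero] at h5
        simpa only [upRes, dnRes, h.r3, h.r4, h3, h4, h5] using h.bddL e he
      · have h0 := h.ne_zero _ hp
        obtain ⟨h1, h2⟩ := h.along_res he h0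
        obtain ⟨h3, h4⟩ := h.rep.cap e ha h0
        obtain ⟨h5, h6⟩ := h.bdd _ (Finset.mem_union_left _ hp)
        simp only [along, upRes, dnRes] at *
        split_ifs at * <;> constructor <;> linarith
    · rw [(h.res_inactive he ha).1, (h.res_inactive he ha).2]
      exact h.bddL e he
  · rw [(h.res_I he).1, (h.res_I he).2]
    exact h.bdd e (Finset.mem_union_right _ he)

lemma act_subset (h : WriteBack σ ρ ω L I C ok) : actS ω L ⊆ actS σ L := by
  intro e he
  obtain ⟨he, hr⟩ := mem_actS.1 he
  by_contra ha
  rw [(h.res_inactive he ha).1, (h.res_inactive he ha).2] at hr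
  exact ha (mem_actS.2 ⟨he, hr⟩)

lemma actS_union (σ : State) (S T : Finset ℕ) : actS σ (S ∪ T) = actS σ S ∪ actS σ T :=
  Finset.filter_union _ _ _

lemma acyc' (h : WriteBack σ ρ ω L I C ok) : Acyc (ω.wArr 0) (ω.wArr 1) (actS ω (L ∪ I)) := by
  have hI : actS ω I = actS ρ I := by
    ext e
    simp only [mem_actS]
    refine and_congr_right fun he => ?_
    rw [(h.res_I he).1, (h.res_I he).2]
  have hsame : ∀ e ∈ actS ω (L ∪ I), ω.wArr 0 e = σ.wArr 0 e ∧ ω.wArr 1 e = σ.wArr 1 e := by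
    intro e he
    obtain ⟨h1, h2, -⟩ := h.same e (mem_actS.1 he).1
    exact ⟨by rw [h.w0, h1], by rw [h.w1, h2]⟩
  refine Acyc.congr ?_ (fun e he => (hsame e he).1) (fun e he => (hsame e he).2)
  rw [actS_union, hI]
  have hac := h.acyc
  rw [actS_union] at hac
  refine h.rep.acyc_lift h.act_subset (Finset.filter_subset _ _)
    (h.disj.mono (Finset.filter_subset _ _) (Finset.filter_subset _ _))
    (h.disjC.mono (Finset.filter_subset _ _) (Finset.filter_subset _ _)) ?_ h.ne_zero hac
    (fun _ _ _ => rfl) (fun e he v => ?_) h.ok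
  · intro s hs hsC
    obtain ⟨h5, h6⟩ := h.bdd s (Finset.mem_union_left _ hs)
    have hsat : upRes ρ s = 0 ∨ dnRes ρ s = 0 := by
      by_contra hcon
      rw [not_or] at hcon
      exact hsC (mem_actS.2 ⟨hs, lt_of_le_of_ne h5 (Ne.symm hcon.1),
        lt_of_le_of_ne h6 (Ne.symm hcon.2)⟩)
    rcases hsat with h0 | h0
    · obtain ⟨e, he, hp, hA⟩ := h.rep.attA s hs
      refine ⟨e, he, fun hact => ?_, hp⟩
      have h1 := (h.along_res (mem_actS.1 he).1 (by rw [hp]; exact h.ne_zero s hs)).1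
      obtain ⟨-, h2, h3⟩ := mem_actS.1 hact
      rw [hp, ← hA] at h1
      change ρ.rArr 3 s - ρ.rArr 5 s = 0 at h0
      rw [h0, along] at h1
      split_ifs at h1 <;> linarith
    · obtain ⟨e, he, hp, hB⟩ := h.rep.attB s hs
      refine ⟨e, he, fun hact => ?_, hp⟩
      have h1 := (h.along_res (mem_actS.1 he).1 (by rw [hp]; exact h.ne_zero s hs)).2
      obtain ⟨-, h2, h3⟩ := mem_actS.1 hact
      rw [hp, ← hB] at h1
      change ρ.rArr 4 s + ρ.rArr 5 s = 0 at h0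
      rw [h0, along] at h1
      split_ifs at h1 <;> linarith
  · obtain ⟨h1, h2, -⟩ := h.same e (Finset.mem_union_right _ (mem_actS.1 he).1)
    exact (bd_congr h1 h2 v).symm

lemma cons' (h : WriteBack σ ρ ω L I C ok) (v : ℕ) :
    ∑ e ∈ L ∪ I, (ω.rArr 5 e - σ.rArr 5 e) * bd (σ.wArr 0) (σ.wArr 1) e v = 0 := by
  have hc := h.cons v
  rw [Finset.sum_union h.disjC, ← h.rep.fwd] at hc
  rw [Finset.sum_union h.disj, ← hc]
  congr 1
  · rw [← Finset.sum_subset (Finset.filter_subset _ _ : actS σ L ⊆ L)]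
    · refine Finset.sum_congr rfl fun e he => ?_
      rw [h.flow_L (mem_actS.1 he).1]
      ring
    · intro e he he'
      rw [h.flow_inactive he he', sub_self, zero_mul]
  · refine Finset.sum_congr rfl fun e he => ?_
    obtain ⟨h1, h2, -⟩ := h.same e (Finset.mem_union_right _ he)
    rw [h.flow_I he, h.flowI e he, sub_zero, bd_congr h1 h2]

end WriteBack

end RealRAM

namespace RealRAM
open FlowRounding

variable {W M : ℕ} {σ τ ρ : State} {S a p sz d N nx h k : ℕ}

/-! ### Blocks of arcs -/

/-- The traversal has, at depth `d`, treated the arcs from `a` to `p` of the block of size `sz` that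
begins with the arc `a`. The forest consists of the active ones among these arcs and among the paths
numbered from `S` to `N`, which represent the arcs inserted before the block. The inequalities bound
the memory and the numbers used. -/
structure Level (W M : ℕ) (σ : State) (S a p sz d N : ℕ) : Prop where
  one : σ.wReg 4 = 1
  zero : σ.wReg 18 = 0
  run : σ.wReg 10 = 1
  dep : σ.wReg 6 = d
  size : σ.wReg 7 = sz
  cur : σ.wReg 8 = p
  top : σ.wReg 9 = N
  base : σ.wArr 8 d = S
  blk : σ.wArr 9 d = a
  le_cur : a ≤ p
  cur_le : p ≤ a + sz
  end_le : a + sz ≤ M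
  le_base : M ≤ S
  base_le : S ≤ N
  top_le : N ≤ S + 4 * sz
  room : N + 4 * sz ≤ 5 * M
  depth : d + sz ≤ M
  sz_pos : 0 < sz
  deg : σ.wArr 2 = fun _ => 0
  sum : σ.wArr 3 = fun _ => 0
  key : σ.wArr 4 = fun _ => 0
  pend : σ.wArr 5 = fun _ => 0
  par : ∀ e, e ∈ Finset.Ico S N ∪ Finset.Ico a (a + sz) ∨ N ≤ e → σ.wArr 6 e = 0
  acyc : Acyc (σ.wArr 0) (σ.wArr 1) (actS σ (Finset.Ico S N ∪ Finset.Ico a p))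
  bdd : ∀ e ∈ Finset.Ico S N ∪ Finset.Ico a p, 0 ≤ upRes σ e ∧ 0 ≤ dnRes σ e
  future : ∀ e ∈ Finset.Ico p (a + sz), σ.rArr 5 e = 0 ∧ 0 ≤ σ.rArr 3 e ∧ 0 ≤ σ.rArr 4 e ∧
    (0 < σ.rArr 3 e → 0 < σ.rArr 4 e → σ.wArr 0 e ≠ σ.wArr 1 e)

/-- Between the states `σ` and `τ`, the flow has been changed on the arcs and paths in `D` only, by a
circulation. -/
structure Change (σ τ : State) (D : Finset ℕ) (N d : ℕ) : Prop where
  same : ∀ e < N, τ.wArr 0 e = σ.wArr 0 e ∧ τ.wArr 1 e = σ.wArr 1 e ∧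
    τ.rArr 3 e = σ.rArr 3 e ∧ τ.rArr 4 e = σ.rArr 4 e
  flow_out : ∀ e < N, e ∉ D → τ.rArr 5 e = σ.rArr 5 e
  dir_out : ∀ e < N, e ∉ D → τ.wArr 7 e = σ.wArr 7 e
  par : τ.wArr 6 = σ.wArr 6
  stack : ∀ i ≤ d, τ.wArr 8 i = σ.wArr 8 i ∧ τ.wArr 9 i = σ.wArr 9 i
  rother : ∀ a, a ≠ 3 → a ≠ 4 → a ≠ 5 → τ.rArr a = σ.rArr a
  regs : ∀ r < 6, τ.wReg r = σ.wReg r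
  cons : ∀ v, ∑ e ∈ D, (τ.rArr 5 e - σ.rArr 5 e) * bd (σ.wArr 0) (σ.wArr 1) e v = 0

lemma Change.mono {D D' : Finset ℕ} (hc : Change σ τ D N d) (hD : D ⊆ D') (hN : ∀ e ∈ D', e < N) :
    Change σ τ D' N d :=
  { hc with
    flow_out := fun e he hD' => hc.flow_out e he fun h => hD' (hD h)
    dir_out := fun e he hD' => hc.dir_out e he fun h => hD' (hD h)
    cons := fun v => by
      rw [← Finset.sum_subset hD, hc.cons v]
      intro e he he'
      rw [hc.flow_out e (hN e he) he', sub_self, zero_mul] }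

lemma Change.trans {D : Finset ℕ} (h₁ : Change σ τ D N d) (h₂ : Change τ ρ D N d)
    (hN : ∀ e ∈ D, e < N) : Change σ ρ D N d := by
  refine ⟨fun e he => ?_, fun e he hD => (h₂.flow_out e he hD).trans (h₁.flow_out e he hD),
    fun e he hD => (h₂.dir_out e he hD).trans (h₁.dir_out e he hD), h₂.par.trans h₁.par,
    fun i hi => ?_, fun a h3 h4 h5 => (h₂.rother a h3 h4 h5).trans (h₁.rother a h3 h4 h5),
    fun r hr => (h₂.regs r hr).trans (h₁.regs r hr), fun v => ?_⟩
  · obtain ⟨a1, a2, a3, a4⟩ := h₁.same e he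
    obtain ⟨b1, b2, b3, b4⟩ := h₂.same e he
    exact ⟨b1.trans a1, b2.trans a2, b3.trans a3, b4.trans a4⟩
  · exact ⟨(h₂.stack i hi).1.trans (h₁.stack i hi).1, (h₂.stack i hi).2.trans (h₁.stack i hi).2⟩
  · have e1 := h₁.cons v
    have e2 := h₂.cons v
    rw [← add_zero (0 : ℝ)]
    nth_rewrite 1 [← e1]
    rw [← e2, ← Finset.sum_add_distrib]
    refine Finset.sum_congr rfl fun e he => ?_
    obtain ⟨a1, a2, -⟩ := h₁.same e (hN e he)
    rw [bd_congr a1 a2]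
    ring

/-- The numbers occurring in the traversal of `M` arcs are less than the word range. -/
def Fits (W M : ℕ) : Prop := 25 * M * M + 10 * M + 10 < W

lemma Level.lt_top (hl : Level W M σ S a p sz d N) {e : ℕ}
    (he : e ∈ Finset.Ico S N ∪ Finset.Ico a (a + sz)) : e < N := by
  have := hl.end_le; have := hl.le_base; have := hl.base_le
  simp only [Finset.mem_union, Finset.mem_Ico] at he
  omega

lemma visitPrep_spec (hf : Fits W M) (hl : Level W M σ S a p sz d N) :
    WP W visitPrep (fun τ k' => τ = ((((σ.setW 11 S).setW 12 N).setW 13 a).setW 14 p).setW 22 (a + sz)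
      ∧ k' = k + 5) σ k := by
  have hlt : a + sz < W := by have := hl.end_le; have := hf; unfold Fits at this; omega
  simp only [visitPrep, WP_seq, WP_instr, Instr.exec]
  simp [hl.dep, hl.base, hl.top, hl.blk, hl.cur, hl.size, Nat.mod_eq_of_lt hlt]

/-- The state at which the arcs of a level are compressed. -/
lemma Level.compressPre (hf : Fits W M) (hl : Level W M σ S a p sz d N) {K₀ : Finset ℕ}
    {fk : ℕ → ℕ} (hd : τ.wArr 2 = fk) (hk : ∀ v, τ.wArr 4 v ≠ 0 ↔ v ∈ K₀)
    (hw : ∀ i, i ≠ 2 → i ≠ 4 → τ.wArr i = σ.wArr i) (hr : τ.rArr = σ.rArr)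
    (r4 : τ.wReg 4 = 1) (r18 : τ.wReg 18 = 0) (r11 : τ.wReg 11 = S) (r12 : τ.wReg 12 = N)
    (r13 : τ.wReg 13 = a) (r14 : τ.wReg 14 = p) (r19 : τ.wReg 19 = N)
    (htwo : ∀ v, fk v = 0 ∨ fk v = 2) (hroot : ∃ v₀, ∀ v, v ≠ v₀ → fk v = 0)
    (hK : K₀.Nonempty) (hK2 : K₀.card ≤ 2 * sz) : CompressPre W τ K₀ fk := by
  have h1 := hl.end_le
  have h2 := hl.le_base
  have h3 := hl.base_le
  have h4 := hl.room
  have h5 := hl.le_cur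
  have h6 := hl.cur_le
  have h7 := hl.sz_pos
  have hEl : El τ = Finset.Ico S N ∪ Finset.Ico a p := by rw [El, r11, r12, r13, r14]
  have hsub : El τ ⊆ Finset.range (5 * M) := by
    rw [hEl]
    intro e he
    simp only [Finset.mem_union, Finset.mem_Ico] at he
    rw [Finset.mem_range]
    omega
  have hcard : (El τ).card ≤ 5 * M := by simpa using Finset.card_le_card hsub
  unfold Fits at hf
  refine ⟨r4, r18, by omega, by omega, by omega, by omega, by omega, hd, ?_, hk, ?_, ?_, ?_, htwo,
    hroot, by omega, by omega, ?_, hK⟩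
  · rw [hw 3 (by norm_num) (by norm_num), hl.sum]
  · rw [hw 5 (by norm_num) (by norm_num), hl.pend]
  · rw [hw 0 (by norm_num) (by norm_num), hw 1 (by norm_num) (by norm_num), actS_congr hr, hEl]
    exact hl.acyc
  · rw [hw 6 (by norm_num) (by norm_num), hEl]
    intro e he
    refine hl.par e (.inl ?_)
    exact Finset.union_subset_union_right (Finset.Ico_subset_Ico_right h6) he
  · have : ∑ e ∈ El τ, e ≤ (El τ).card * (5 * M) := by
      rw [← smul_eq_mul]
      exact Finset.sum_le_card_nsmul _ _ _ fun e he => (Finset.mem_range.1 (hsub he)).le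
    have h8 : (El τ).card * (5 * M) ≤ 5 * M * (5 * M) := Nat.mul_le_mul_right _ hcard
    have h9 : 5 * M * (5 * M) = 25 * M * M := by ring
    omega

/-- The forest of the block at depth `d` has been compressed to the paths from `N` to `nx`, whose
terminals are the endpoints of the arcs from `p` to `p + h`. -/
structure Descended (σ τ : State) (S a p h d N nx : ℕ) : Prop where
  rep : Represents (σ.wArr 0) (σ.wArr 1) (upRes σ) (dnRes σ)
    (actS σ (Finset.Ico S N ∪ Finset.Ico a p)) (fun v => v ∉ ends σ (Finset.Ico p (p + h)))
    (actS σ (Finset.Ico S N ∪ Finset.Ico a p)) (Finset.Ico N nx) (τ.wArr 0) (τ.wArr 1) (τ.wArr 6)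
    (τ.wArr 7) (τ.rArr 3) (τ.rArr 4)
  old : ∀ e < N, τ.wArr 0 e = σ.wArr 0 e ∧ τ.wArr 1 e = σ.wArr 1 e ∧
    τ.rArr 3 e = σ.rArr 3 e ∧ τ.rArr 4 e = σ.rArr 4 e ∧ τ.rArr 5 e = σ.rArr 5 e
  fresh : ∀ e ∈ Finset.Ico N nx, τ.rArr 5 e = 0
  par_out : ∀ e, e ∉ actS σ (Finset.Ico S N ∪ Finset.Ico a p) → τ.wArr 6 e = σ.wArr 6 e
  dir_out : ∀ e, e ∉ actS σ (Finset.Ico S N ∪ Finset.Ico a p) → τ.wArr 7 e = σ.wArr 7 e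
  stack : ∀ i ≤ d, τ.wArr 8 i = σ.wArr 8 i ∧ τ.wArr 9 i = σ.wArr 9 i
  rother : ∀ a, a ≠ 3 → a ≠ 4 → a ≠ 5 → τ.rArr a = σ.rArr a
  regs : ∀ r < 6, τ.wReg r = σ.wReg r

/-- Descending to a half of the block: the forest is compressed with respect to the endpoints of its
`h` arcs, and the new level starts with an empty half and the forest of the paths. -/
lemma down_spec (hf : Fits W M) (hl : Level W M σ S a p (2 * h) d N) (hh : 0 < h)
    (hp : p + h ≤ a + 2 * h) :
    WP W visitBody (fun τ k' => ∃ nx, Level W M τ N p p h (d + 1) nx ∧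
      Descended σ τ S a p h d N nx ∧ k' ≤ k + 1000 * h) σ k := by
  have h1 := hl.end_le
  have h2 := hl.le_base
  have h3 := hl.base_le
  have h4 := hl.room
  have h5 := hl.le_cur
  have h8 := hl.depth
  have hf' := hf
  unfold Fits at hf'
  have hpw : p + h < W := by omega
  rw [visitBody, WP_seq]
  refine WP.mono (visitPrep_spec hf hl) ?_
  rintro τ₀ k₀ ⟨hτ₀, rfl⟩
  rw [WP_ite]
  refine ⟨fun _ => ?_, fun hn => absurd ?_ hn⟩
  swap
  · show τ₀.wReg 8 < τ₀.wReg 22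
    simp [hτ₀, hl.cur]; omega
  rw [WP_seq, WP_instr, WP_ite]
  refine ⟨fun hn => ?_, fun _ => ?_⟩
  · simp [Test.Holds, Instr.exec, hτ₀, hl.size, hl.one] at hn
  rw [down, WP_seq]
  obtain ⟨τ₁, hτ₁⟩ : ∃ τ₁, τ₁ = (((τ₀.setW 19 N).setW 22 2).setW 16 h).setW 17 (p + h) := ⟨_, rfl⟩
  have hprep : ∀ (Q : State → ℕ → Prop) (k : ℕ), Q τ₁ (k + 3) →
      WP W downPrep Q ((Instr.wCopy 19 9).exec W τ₀) k := by
    intro Q k hQ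
    simp only [downPrep, WP_seq, WP_instr]
    convert hQ using 1
    have h2W : 2 % W = 2 := Nat.mod_eq_of_lt (by omega)
    rw [hτ₁]
    simp [Instr.exec, hτ₀, hl.size, hl.cur, hl.top, h2W, Nat.mod_eq_of_lt hpw]
  apply hprep
  have t : ∀ r, r < 11 → τ₁.wReg r = σ.wReg r := by
    intro r hr
    simp [hτ₁, hτ₀, show r ≠ 17 by omega, show r ≠ 16 by omega, show r ≠ 22 by omega,
      show r ≠ 19 by omega, show r ≠ 14 by omega, show r ≠ 13 by omega, show r ≠ 12 by omega,
      show r ≠ 11 by omega]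
  have tw : τ₁.wArr = σ.wArr := by simp [hτ₁, hτ₀]
  have tr : τ₁.rArr = σ.rArr := by simp [hτ₁, hτ₀]
  have t4 : τ₁.wReg 4 = 1 := by rw [t 4 (by norm_num), hl.one]
  have t8 : τ₁.wReg 8 = p := by rw [t 8 (by norm_num), hl.cur]
  have t17 : τ₁.wReg 17 = p + h := by simp [hτ₁]
  have t18 : τ₁.wReg 18 = 0 := by simp [hτ₁, hτ₀, hl.zero]
  have t19 : τ₁.wReg 19 = N := by simp [hτ₁]
  rw [WP_seq]
  refine WP.mono (markLoop_spec (x := 4) (by norm_num) t4 (by rwa [t17]) (by omega)) ?_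
  rintro τ₂ k₂ ⟨hfr₂, hw₂, hr₂, h19₂, hkey₂, hk₂⟩
  set K₀ := ends σ (Finset.Ico p (p + h)) with hK₀
  have hends : ∀ I, ends τ₁ I = ends σ I := fun I => by rw [ends, ends, tw]
  rw [t8, t17, hends, t4, tw] at hkey₂
  have hK : K₀.Nonempty := ⟨σ.wArr 0 p, mem_ends.2 ⟨p, by simp [hh], .inl rfl⟩⟩
  have hKc : K₀.card ≤ 2 * h := by
    refine (Finset.card_union_le _ _).trans ?_
    have e1 := Finset.card_image_le (s := Finset.Ico p (p + h)) (f := σ.wArr 0)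
    have e2 := Finset.card_image_le (s := Finset.Ico p (p + h)) (f := σ.wArr 1)
    rw [Nat.card_Ico] at e1 e2
    omega
  have hpre : CompressPre W τ₂ K₀ (fun _ => 0) := by
    refine hl.compressPre hf ?_ ?_ ?_ (hr₂.trans tr) (by rw [hfr₂ 4 (by norm_num), t4])
      (by rw [hfr₂ 18 (by norm_num), t18]) ?_ ?_ ?_ ?_ (by rw [h19₂, t19]) (by simp)
      ⟨0, by simp⟩ hK (by omega)
    · rw [hw₂ 2 (by norm_num), tw, hl.deg]
    · intro v
      rw [hkey₂, hl.key]
      split_ifs with hv <;> simp [hK₀, hv]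
    · intro i _ hi
      rw [hw₂ i hi, tw]
    · rw [hfr₂ 11 (by norm_num)]; simp [hτ₁, hτ₀]
    · rw [hfr₂ 12 (by norm_num)]; simp [hτ₁, hτ₀]
    · rw [hfr₂ 13 (by norm_num)]; simp [hτ₁, hτ₀]
    · rw [hfr₂ 14 (by norm_num)]; simp [hτ₁, hτ₀]
  have hEl : El τ₂ = Finset.Ico S N ∪ Finset.Ico a p := by
    rw [El_congr hfr₂]
    simp [El, hτ₁, hτ₀]
  have hElc : (El τ₂).card ≤ 10 * h := by
    rw [hEl]
    refine (Finset.card_union_le _ _).trans ?_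
    rw [Nat.card_Ico, Nat.card_Ico]
    have := hl.top_le
    omega
  rw [WP_seq]
  refine WP.mono (compress_spec hpre) ?_
  rintro τ₃ k₃ ⟨hC, hk₃⟩
  have u : ∀ r, r < 11 → τ₃.wReg r = σ.wReg r := fun r hr => by
    rw [hC.fr r (by omega), hfr₂ r (by omega), t r hr]
  have u17 : τ₃.wReg 17 = p + h := by rw [hC.fr 17 (by norm_num), hfr₂ 17 (by norm_num), t17]
  have u18 : τ₃.wReg 18 = 0 := by rw [hC.fr 18 (by norm_num), hfr₂ 18 (by norm_num), t18]
  have u16 : τ₃.wReg 16 = h := by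
    rw [hC.fr 16 (by norm_num), hfr₂ 16 (by norm_num)]; simp [hτ₁]
  have u8 : τ₃.wReg 8 = p := by rw [u 8 (by norm_num), hl.cur]
  have u4 : τ₃.wReg 4 = 1 := by rw [u 4 (by norm_num), hl.one]
  have w₂ : ∀ i, i ≠ 4 → τ₂.wArr i = σ.wArr i := fun i hi => by rw [hw₂ i hi, tw]
  have r₂ : τ₂.rArr = σ.rArr := hr₂.trans tr
  have n2 : τ₂.wReg 19 = N := by rw [h19₂, t19]
  rw [WP_seq]
  refine WP.mono (markLoop_spec (x := 18) (by norm_num) u4 (by rwa [u17]) (by omega)) ?_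
  rintro τ₄ k₄ ⟨hfr₄, hw₄, hr₄, h19₄, hkey₄, hk₄⟩
  obtain ⟨nx, hnx⟩ : ∃ nx, τ₃.wReg 19 = nx := ⟨_, rfl⟩
  have hnew : newPaths τ₂ τ₃ = Finset.Ico N nx := by rw [newPaths, n2, hnx]
  have hNnx : N ≤ nx := by have := hC.le; omega
  have hcard : nx - N + 1 ≤ 2 * K₀.card := by
    have := hC.card
    rwa [hnew, Nat.card_Ico] at this
  have hActe : actS τ₂ (El τ₂) = actS σ (Finset.Ico S N ∪ Finset.Ico a p) := by
    rw [hEl, actS_congr r₂]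
  have hup : upRes τ₂ = upRes σ := by funext e; simp [upRes, r₂]
  have hdn : dnRes τ₂ = dnRes σ := by funext e; simp [dnRes, r₂]
  have hends₃ : ends τ₃ (Finset.Ico p (p + h)) = K₀ := by
    ext v
    simp only [hK₀, mem_ends]
    refine exists_congr fun e => and_congr_right fun he => ?_
    rw [Finset.mem_Ico] at he
    obtain ⟨o0, o1, -⟩ := hC.old e (by omega)
    rw [o0, o1, w₂ 0 (by norm_num), w₂ 1 (by norm_num)]
  rw [u8, u17, hends₃, u18] at hkey₄
  have hkey0 : τ₄.wArr 4 = fun _ => 0 := by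
    funext v
    rw [hkey₄]
    split_ifs with hv
    · rfl
    · by_contra hne
      exact hv (hC.key v hne)
  have hrep := hC.rep
  rw [hActe, hnew, hup, hdn, w₂ 0 (by norm_num), w₂ 1 (by norm_num)] at hrep
  simp only [and_true] at hrep
  have hold := hC.old
  rw [n2, w₂ 0 (by norm_num), w₂ 1 (by norm_num), r₂] at hold
  have hfresh := hC.fresh
  rw [hnew] at hfresh
  have hpar := hC.par_out
  have hdir := hC.dir_out
  rw [hActe, w₂ 6 (by norm_num)] at hpar
  rw [hActe, w₂ 7 (by norm_num)] at hdir
  -- the state after the final assignments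
  obtain ⟨τ₅, hτ₅⟩ : ∃ τ₅, τ₅ = ((((τ₄.setW 6 (d + 1)).setWArr 8 (d + 1) N).setWArr 9 (d + 1)
    p).setW 7 h).setW 9 nx := ⟨_, rfl⟩
  have v : ∀ r, r < 11 → τ₄.wReg r = σ.wReg r := fun r hr => by rw [hfr₄ r (by omega), u r hr]
  have hpost : ∀ (Q : State → ℕ → Prop) (k : ℕ), Q τ₅ (k + 5) → WP W downPost Q τ₄ k := by
    intro Q k hQ
    simp only [downPost, WP_seq, WP_instr]
    convert hQ using 1
    have hdW : (d + 1) % W = d + 1 := Nat.mod_eq_of_lt (by omega)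
    rw [hτ₅]
    simp [Instr.exec, v, hl.dep, hl.one, hl.top, hl.cur, hdW, hfr₄ 16 (by norm_num), u16, h19₄,
      hnx]
  apply hpost
  have x0 : τ₅.wArr 0 = τ₃.wArr 0 := by simp [hτ₅, hw₄]
  have x1 : τ₅.wArr 1 = τ₃.wArr 1 := by simp [hτ₅, hw₄]
  have x6 : τ₅.wArr 6 = τ₃.wArr 6 := by simp [hτ₅, hw₄]
  have x7 : τ₅.wArr 7 = τ₃.wArr 7 := by simp [hτ₅, hw₄]
  have xr : τ₅.rArr = τ₃.rArr := by simp [hτ₅, hr₄]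
  have hAct_ids : ∀ e ∈ actS σ (Finset.Ico S N ∪ Finset.Ico a p), e < N ∧ (e < p ∨ S ≤ e) := by
    intro e he
    have := (mem_actS.1 he).1
    simp only [Finset.mem_union, Finset.mem_Ico] at this
    omega
  refine ⟨nx, ⟨?_, ?_, ?_, by simp [hτ₅], by simp [hτ₅], ?_, by simp [hτ₅], by simp [hτ₅],
    by simp [hτ₅], le_rfl, by omega, by omega, by omega, hNnx, by omega, by omega, by omega, hh,
    ?_, ?_, ?_, ?_, ?_, ?_, ?_, ?_⟩, ⟨?_, ?_, ?_, ?_, ?_, ?_, ?_, ?_⟩, by omega⟩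
  · simp [hτ₅, v, hl.one]
  · simp [hτ₅, hfr₄ 18 (by norm_num), u18]
  · simp [hτ₅, v, hl.run]
  · simp [hτ₅, v, hl.cur]
  · simp [hτ₅, hw₄, hC.deg]
  · simp [hτ₅, hw₄, hC.sum]
  · simp [hτ₅, hkey0]
  · simp [hτ₅, hw₄, hC.pend]
  · intro e he
    simp only [Finset.mem_union, Finset.mem_Ico] at he
    rw [x6, hpar e fun h' => by have := hAct_ids e h'; omega]
    refine hl.par e ?_
    simp only [Finset.mem_union, Finset.mem_Ico]
    omega
  · rw [x0, x1]
    refine Acyc.subset (hrep.acyc_paths hl.acyc fun s hs => ?_) ?_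
    · have := (Finset.mem_Ico.1 hs).1; omega
    · rw [Finset.Ico_self, Finset.union_empty]
      exact Finset.filter_subset _ _
  · intro e he
    rw [Finset.Ico_self, Finset.union_empty] at he
    obtain ⟨h6, h7⟩ := hrep.pos e he
    simp only [upRes, dnRes, xr, hfresh e he]
    constructor <;> linarith
  · intro e he
    rw [Finset.mem_Ico] at he
    obtain ⟨o0, o1, o3, o4, o5⟩ := hold e (by omega)
    rw [x0, x1, xr, o0, o1, o3, o4, o5]
    exact hl.future e (Finset.mem_Ico.2 (by omega))
  · rw [x0, x1, x6, x7, xr]; exact hrep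
  · rw [x0, x1, xr]; exact hold
  · rw [xr]; exact hfresh
  · rw [x6]; exact hpar
  · rw [x7]; exact hdir
  · intro i hi
    have hi' : i ≠ d + 1 := by omega
    have e8 := hC.wother 8 (by norm_num)
    have e9 := hC.wother 9 (by norm_num)
    simp [hτ₅, hi', hw₄, e8, e9, w₂]
  · intro a h3 h4 h5
    rw [xr, hC.rother a h3 h4 h5, r₂]
  · intro r hr
    simp [hτ₅, show r ≠ 9 by omega, show r ≠ 7 by omega, show r ≠ 6 by omega, v r (by omega)]

end RealRAM

namespace RealRAM
open FlowRounding

variable {W M : ℕ} {σ τ ρ ω : State} {S a p q sz d N nx h k : ℕ} {ok : ℕ → Prop}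

/-! ### Transferring the flow within a block -/

/-- The forest of the block at depth `d` of state `σ` is represented by the paths from `N` to `nx`,
and in state `ρ` the arcs from `p` to `q` have been inserted into the forest of paths. -/
structure Inserted (σ ρ : State) (S a p q d N nx : ℕ) (ok : ℕ → Prop) : Prop where
  rep : Represents (σ.wArr 0) (σ.wArr 1) (upRes σ) (dnRes σ)
    (actS σ (Finset.Ico S N ∪ Finset.Ico a p)) ok
    (actS σ (Finset.Ico S N ∪ Finset.Ico a p)) (Finset.Ico N nx) (ρ.wArr 0) (ρ.wArr 1) (ρ.wArr 6)
    (ρ.wArr 7) (ρ.rArr 3) (ρ.rArr 4)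
  same : ∀ e < N, ρ.wArr 0 e = σ.wArr 0 e ∧ ρ.wArr 1 e = σ.wArr 1 e ∧
    ρ.rArr 3 e = σ.rArr 3 e ∧ ρ.rArr 4 e = σ.rArr 4 e
  flow_out : ∀ e < N, e ∉ Finset.Ico p q → ρ.rArr 5 e = σ.rArr 5 e
  par_out : ∀ e, e ∉ actS σ (Finset.Ico S N ∪ Finset.Ico a p) → ρ.wArr 6 e = σ.wArr 6 e
  dir_out : ∀ e < N, e ∉ actS σ (Finset.Ico S N ∪ Finset.Ico a p) → e ∉ Finset.Ico p q →
    ρ.wArr 7 e = σ.wArr 7 e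
  stack : ∀ i ≤ d, ρ.wArr 8 i = σ.wArr 8 i ∧ ρ.wArr 9 i = σ.wArr 9 i
  rother : ∀ a, a ≠ 3 → a ≠ 4 → a ≠ 5 → ρ.rArr a = σ.rArr a
  ok : ∀ e ∈ actS ρ (Finset.Ico p q), ∀ v, ok v → bd (σ.wArr 0) (σ.wArr 1) e v = 0
  acyc : Acyc (ρ.wArr 0) (ρ.wArr 1) (actS ρ (Finset.Ico N nx ∪ Finset.Ico p q))
  bdd : ∀ e ∈ Finset.Ico N nx ∪ Finset.Ico p q, 0 ≤ upRes ρ e ∧ 0 ≤ dnRes ρ e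
  cons : ∀ v, ∑ e ∈ Finset.Ico N nx ∪ Finset.Ico p q,
    ρ.rArr 5 e * bd (ρ.wArr 0) (ρ.wArr 1) e v = 0
  deg : ρ.wArr 2 = fun _ => 0
  sum : ρ.wArr 3 = fun _ => 0
  key : ρ.wArr 4 = fun _ => 0
  pend : ρ.wArr 5 = fun _ => 0

/-- The last step at a block: transferring the flow on the paths reestablishes the invariant. The
registers of the final state are left open, since they are adjusted by the callers. -/
lemma Level.writeBack (hf : Fits W M) (hl : Level W M σ S a p sz d N) (hpq : p ≤ q)
    (hq : q ≤ a + sz) (hi : Inserted σ ρ S a p q d N nx ok)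
    (r4 : ρ.wReg 4 = 1) (r18 : ρ.wReg 18 = 0) (r11 : ρ.wReg 11 = S) (r12 : ρ.wReg 12 = N)
    (r13 : ρ.wReg 13 = a) (r14 : ρ.wReg 14 = q) :
    WP W (forEl wbBody) (fun ω k' => Fr ρ ω ∧
      (∀ ω', ω'.wArr = ω.wArr → ω'.rArr = ω.rArr → ω'.wReg 18 = 0 → ω'.wReg 10 = 1 →
        ω'.wReg 6 = d → ω'.wReg 7 = sz → ω'.wReg 8 = q → ω'.wReg 9 = N →
        (∀ r < 6, ω'.wReg r = σ.wReg r) →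
        Level W M ω' S a q sz d N ∧ Change σ ω' (Finset.Ico S N ∪ Finset.Ico a q) N d ∧
          ∀ e ∈ Finset.Ico p q, ω'.rArr 5 e = ρ.rArr 5 e) ∧
      k' ≤ k + 12 * (5 * sz) + 4) ρ k := by
  have h1 := hl.end_le
  have h2 := hl.le_base
  have h3 := hl.base_le
  have h4 := hl.room
  have h5 := hl.le_cur
  have h6 := hl.top_le
  have h7 := hl.sz_pos
  have hf' := hf
  unfold Fits at hf'
  set L := Finset.Ico S N ∪ Finset.Ico a p with hL
  have hEl : El ρ = Finset.Ico S N ∪ Finset.Ico a q := by rw [El, r11, r12, r13, r14]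
  have hLI : El ρ = L ∪ Finset.Ico p q := by
    rw [hEl, hL, Finset.union_assoc, Finset.Ico_union_Ico_eq_Ico h5 hpq]
  have hElN : ∀ e ∈ El ρ, e < N := fun e he => by
    rw [hEl] at he
    simp only [Finset.mem_union, Finset.mem_Ico] at he
    omega
  have hσ6 : ∀ e ∈ El ρ, σ.wArr 6 e = 0 := fun e he => hl.par e (.inl (by
    rw [hEl] at he
    simp only [Finset.mem_union, Finset.mem_Ico] at he ⊢
    omega))
  have hActE : actS σ L ⊆ El ρ := by
    rw [hLI]
    exact (Finset.filter_subset _ _).trans Finset.subset_union_left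
  have hpar6 : ∀ e ∈ El ρ, e ∉ actS σ L → ρ.wArr 6 e = 0 := fun e he he' => by
    rw [hi.par_out e he', hσ6 e he]
  refine WP.mono (wbLoop_spec r4 r18 (by omega) (by omega) (by omega) (by omega) (by omega) ?_) ?_
  · intro e he hne
    by_cases ha : e ∈ actS σ L
    · rcases hi.rep.par_mem e ha with h0 | h0
      · exact absurd h0 hne
      · intro hmem
        have := hElN _ hmem
        have := (Finset.mem_Ico.1 h0).1
        omega
    · exact absurd (hpar6 e he ha) hne
  rintro ω k' ⟨hfr, hw, hr, hω6, hω5, hk'⟩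
  have hcard : (El ρ).card ≤ 5 * sz := by
    rw [hEl]
    refine (Finset.card_union_le _ _).trans ?_
    rw [Nat.card_Ico, Nat.card_Ico]
    omega
  refine ⟨hfr, ?_, by omega⟩
  intro ω' ew er s18 s10 s6 s7 s8 s9 sreg
  rw [← er] at hr hω5
  rw [← ew] at hw hω6
  have hwb : WriteBack σ ρ ω' L (Finset.Ico p q) (Finset.Ico N nx) ok := by
    refine ⟨hi.rep, ?_, ?_, ?_, ?_, ?_, ?_, ?_, hi.ok, hl.bdd, hi.acyc, hi.bdd, hi.cons,
      hw 0 (by norm_num), hw 1 (by norm_num), hr 3 (by norm_num), hr 4 (by norm_num), ?_⟩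
    · rw [Finset.disjoint_left]
      intro e he
      simp only [hL, Finset.mem_union, Finset.mem_Ico] at he ⊢
      omega
    · rw [Finset.disjoint_left]
      intro e he
      simp only [Finset.mem_Ico] at he ⊢
      omega
    · intro s hs
      have := (Finset.mem_Ico.1 hs).1
      omega
    · exact fun e he => hi.same e (hElN e (hLI ▸ he))
    · intro e he
      refine hi.flow_out e (hElN e (hLI ▸ Finset.mem_union_left _ he)) ?_
      simp only [hL, Finset.mem_union, Finset.mem_Ico] at he ⊢
      omega
    · intro e he
      refine (hl.future e ?_).1
      simp only [Finset.mem_Ico] at he ⊢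
      omega
    · exact fun e he he' => hpar6 e (hLI ▸ he) he'
    · rw [← hLI]; exact hω5
  have hω6' : ω'.wArr 6 = σ.wArr 6 := by
    funext e
    rw [hω6]
    split_ifs with he
    · exact (hσ6 e he).symm
    · exact hi.par_out e fun h => he (hActE h)
  have hsame : ∀ e < N, ω'.wArr 0 e = σ.wArr 0 e ∧ ω'.wArr 1 e = σ.wArr 1 e ∧
      ω'.rArr 3 e = σ.rArr 3 e ∧ ω'.rArr 4 e = σ.rArr 4 e := by
    rw [hwb.w0, hwb.w1, hwb.r3, hwb.r4]
    exact hi.same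
  have hflow : ∀ e < N, e ∉ El ρ → ω'.rArr 5 e = σ.rArr 5 e := by
    intro e he he'
    rw [hω5, if_neg he', add_zero]
    exact hi.flow_out e he fun h => he' (hLI ▸ Finset.mem_union_right _ h)
  have hst : ∀ i ≤ d, ω'.wArr 8 i = σ.wArr 8 i ∧ ω'.wArr 9 i = σ.wArr 9 i := by
    rw [hw 8 (by norm_num), hw 9 (by norm_num)]
    exact hi.stack
  refine ⟨⟨?_, s18, s10, s6, s7, s8, s9, ?_, ?_, by omega, hq, h1, h2, h3, h6, h4, hl.depth, h7,
    ?_, ?_, ?_, ?_, ?_, ?_, ?_, ?_⟩, ⟨hsame, ?_, ?_, hω6', hst, ?_, sreg, ?_⟩,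
    fun e he => hwb.flow_I he⟩
  · rw [sreg 4 (by norm_num), hl.one]
  · rw [(hst d le_rfl).1, hl.base]
  · rw [(hst d le_rfl).2, hl.blk]
  · rw [hw 2 (by norm_num), hi.deg]
  · rw [hw 3 (by norm_num), hi.sum]
  · rw [hw 4 (by norm_num), hi.key]
  · rw [hw 5 (by norm_num), hi.pend]
  · rw [hω6']; exact hl.par
  · rw [← hEl, hLI]; exact hwb.acyc'
  · rw [← hEl, hLI]; exact fun e he => hwb.bdd' he
  · intro e he
    rw [Finset.mem_Ico] at he
    obtain ⟨o0, o1, o3, o4⟩ := hsame e (by omega)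
    rw [o0, o1, o3, o4, hflow e (by omega) (by
      rw [hEl]; simp only [Finset.mem_union, Finset.mem_Ico]; omega)]
    exact hl.future e (Finset.mem_Ico.2 (by omega))
  · rw [← hEl]; exact hflow
  · intro e he he'
    rw [← hEl] at he'
    rw [hw 7 (by norm_num)]
    exact hi.dir_out e he (fun h => he' (hActE h))
      (fun h => he' (hLI ▸ Finset.mem_union_right _ h))
  · intro b h3 h4 h5
    rw [hr b h5, hi.rother b h3 h4 h5]
  · rw [← hEl, hLI]; exact hwb.cons'

lemma bd_eq_zero_of_not_mem_ends {I : Finset ℕ} {e v : ℕ} (he : e ∈ I) (hv : v ∉ ends σ I) :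
    bd (σ.wArr 0) (σ.wArr 1) e v = 0 := by
  rw [mem_ends] at hv
  push Not at hv
  obtain ⟨h0, h1⟩ := hv e he
  simp [bd, h0, h1]

/-- Returning from a half of the block: the circulation found on the paths and the new arcs becomes a
circulation on the arcs of the whole block. -/
lemma up_spec (hf : Fits W M) (hl : Level W M σ S a p (2 * h) d N) (hp : p + h ≤ a + 2 * h)
    (hd : Descended σ τ S a p h d N nx) (hl' : Level W M ρ N p (p + h) h (d + 1) nx)
    (hc : Change τ ρ (Finset.Ico N nx ∪ Finset.Ico p (p + h)) nx (d + 1)) :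
    WP W visitBody (fun ω k' => Level W M ω S a (p + h) (2 * h) d N ∧
      Change σ ω (Finset.Ico S N ∪ Finset.Ico a (p + h)) N d ∧
      (∀ e ∈ Finset.Ico p (p + h), ω.rArr 5 e = ρ.rArr 5 e) ∧ k' ≤ k + 150 * h) ρ k := by
  have h1 := hl.end_le
  have h2 := hl.le_base
  have h3 := hl.base_le
  have h4 := hl.room
  have h5 := hl.le_cur
  have h6 := hl'.base_le
  have h7 := hl'.sz_pos
  have h8 := hl.depth
  have hf' := hf
  unfold Fits at hf'
  have hi : Inserted σ ρ S a p (p + h) d N nx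
      (fun v => v ∉ ends σ (Finset.Ico p (p + h))) := by
    have hact : ∀ e ∈ actS σ (Finset.Ico S N ∪ Finset.Ico a p), e < N ∧
        e ∉ Finset.Ico N nx ∪ Finset.Ico p (p + h) := by
      intro e he
      have := (mem_actS.1 he).1
      simp only [Finset.mem_union, Finset.mem_Ico] at this ⊢
      omega
    have hnx : ∀ s ∈ Finset.Ico N nx, s < nx := fun s hs => (Finset.mem_Ico.1 hs).2
    have hsame : ∀ e < N, ρ.wArr 0 e = σ.wArr 0 e ∧ ρ.wArr 1 e = σ.wArr 1 e ∧
        ρ.rArr 3 e = σ.rArr 3 e ∧ ρ.rArr 4 e = σ.rArr 4 e := by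
      intro e he
      obtain ⟨a0, a1, a3, a4⟩ := hc.same e (by omega)
      obtain ⟨b0, b1, b3, b4, -⟩ := hd.old e he
      exact ⟨a0.trans b0, a1.trans b1, a3.trans b3, a4.trans b4⟩
    refine ⟨?_, hsame, ?_, ?_, ?_, ?_, ?_, ?_, hl'.acyc, hl'.bdd, ?_, hl'.deg, hl'.sum, hl'.key,
      hl'.pend⟩
    · refine hd.rep.congr (fun e _ => by rw [hc.par])
        (fun e he => hc.dir_out e (by have := (hact e he).1; omega) (hact e he).2)
        (fun s hs => (hc.same s (hnx s hs)).1) (fun s hs => (hc.same s (hnx s hs)).2.1)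
        (fun s hs => (hc.same s (hnx s hs)).2.2.1) (fun s hs => (hc.same s (hnx s hs)).2.2.2)
    · intro e he he'
      rw [hc.flow_out e (by omega), (hd.old e he).2.2.2.2]
      simp only [Finset.mem_union, Finset.mem_Ico] at he' ⊢
      omega
    · intro e he
      rw [hc.par, hd.par_out e he]
    · intro e he hea he'
      rw [hc.dir_out e (by omega), hd.dir_out e hea]
      simp only [Finset.mem_union, Finset.mem_Ico] at he' ⊢
      omega
    · intro i hi
      obtain ⟨a8, a9⟩ := hc.stack i (by omega)
      obtain ⟨b8, b9⟩ := hd.stack i hi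
      exact ⟨a8.trans b8, a9.trans b9⟩
    · intro b h3 h4 h5
      rw [hc.rother b h3 h4 h5, hd.rother b h3 h4 h5]
    · intro e he v hv
      exact bd_eq_zero_of_not_mem_ends (mem_actS.1 he).1 hv
    · intro v
      rw [← hc.cons v]
      refine Finset.sum_congr rfl fun e he => ?_
      have hτ5 : τ.rArr 5 e = 0 := by
        rcases Finset.mem_union.1 he with h | h
        · exact hd.fresh e h
        · rw [Finset.mem_Ico] at h
          rw [(hd.old e (by omega)).2.2.2.2]
          exact (hl.future e (Finset.mem_Ico.2 (by omega))).1
      have he' : e < nx := by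
        simp only [Finset.mem_union, Finset.mem_Ico] at he
        omega
      obtain ⟨a0, a1, -⟩ := hc.same e he'
      rw [hτ5, sub_zero, bd_congr a0 a1]
  have hbase : ρ.wArr 8 d = S := by rw [(hi.stack d le_rfl).1, hl.base]
  have hblk : ρ.wArr 9 d = a := by rw [(hi.stack d le_rfl).2, hl.blk]
  rw [visitBody, WP_seq]
  refine WP.mono (visitPrep_spec hf hl') ?_
  rintro τ₀ k₀ ⟨hτ₀, rfl⟩
  rw [WP_ite]
  refine ⟨fun hn => absurd hn ?_, fun _ => ?_⟩
  · simp [Test.Holds, hτ₀, hl'.cur]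
  rw [WP_ite]
  refine ⟨fun hn => absurd hn ?_, fun _ => ?_⟩
  · simp [Test.Holds, hτ₀, hl'.dep, hl'.zero]
  obtain ⟨τ₁, hτ₁⟩ : ∃ τ₁, τ₁ = ((((τ₀.setW 9 N).setW 6 d).setW 11 S).setW 12 N).setW 13 a :=
    ⟨_, rfl⟩
  have hprep : ∀ (Q : State → ℕ → Prop) (k : ℕ), Q τ₁ (k + 5) → WP W upPrep Q τ₀ k := by
    intro Q k hQ
    simp only [upPrep, WP_seq, WP_instr]
    convert hQ using 1
    rw [hτ₁]
    simp [Instr.exec, hτ₀, hl'.dep, hl'.base, hl'.one, hbase, hblk]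
  rw [up, WP_seq]
  apply hprep
  rw [WP_seq]
  have hi₁ : Inserted σ τ₁ S a p (p + h) d N nx
      (fun v => v ∉ ends σ (Finset.Ico p (p + h))) := by
    have ew : τ₁.wArr = ρ.wArr := by simp [hτ₁, hτ₀]
    have er : τ₁.rArr = ρ.rArr := by simp [hτ₁, hτ₀]
    have hu : ∀ e, upRes τ₁ e = upRes ρ e := fun e => by rw [upRes, upRes, er]
    have hn : ∀ e, dnRes τ₁ e = dnRes ρ e := fun e => by rw [dnRes, dnRes, er]
    constructor <;> simp only [ew, er, actS_congr er, hu, hn]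
    exacts [hi.rep, hi.same, hi.flow_out, hi.par_out, hi.dir_out, hi.stack, hi.rother, hi.ok,
      hi.acyc, hi.bdd, hi.cons, hi.deg, hi.sum, hi.key, hi.pend]
  refine WP.mono (hl.writeBack hf (Nat.le_add_right p h) hp hi₁ (by simp [hτ₁, hτ₀, hl'.one])
    (by simp [hτ₁, hτ₀, hl'.zero]) (by simp [hτ₁]) (by simp [hτ₁]) (by simp [hτ₁])
    (by simp [hτ₁, hτ₀])) ?_
  rintro ω k' ⟨hfr, hω, hk'⟩
  rw [WP_instr]
  have hrho : ∀ r < 6, ω.wReg r = σ.wReg r := by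
    intro r hr
    rw [← hd.regs r hr, ← hc.regs r hr, hfr r (by omega)]
    simp [hτ₁, hτ₀, show r ≠ 13 by omega, show r ≠ 12 by omega, show r ≠ 11 by omega,
      show r ≠ 6 by omega, show r ≠ 9 by omega, show r ≠ 22 by omega, show r ≠ 14 by omega]
  have hW : (h + h) % W = 2 * h := by rw [Nat.mod_eq_of_lt (by omega)]; omega
  have g7 : ω.wReg 7 = h := by rw [hfr 7 (by norm_num)]; simp [hτ₁, hτ₀, hl'.size]
  have hexec : (Instr.wAdd 7 7 7).exec W ω = ω.setW 7 (2 * h) := by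
    simp only [Instr.exec, g7, hW]
  obtain ⟨l1, l2, l3⟩ := hω (ω.setW 7 (2 * h)) rfl rfl
    (by simp [hfr 18 (by norm_num), hτ₁, hτ₀, hl'.zero])
    (by simp [hfr 10 (by norm_num), hτ₁, hτ₀, hl'.run])
    (by simp [hfr 6 (by norm_num), hτ₁, hτ₀]) (by simp)
    (by simp [hfr 8 (by norm_num), hτ₁, hτ₀, hl'.cur])
    (by simp [hfr 9 (by norm_num), hτ₁, hτ₀])
    (fun r hr => by simp [show r ≠ 7 by omega, hrho r hr])
  rw [hexec]
  refine ⟨l1, l2, fun e he => ?_, by omega⟩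
  rw [l3 e he]
  simp [hτ₁, hτ₀]

end RealRAM

namespace RealRAM
open FlowRounding

variable {W M : ℕ} {σ τ ρ ω : State} {S a p q sz d N nx h k : ℕ} {ok : ℕ → Prop}

/-! ### Inserting one arc -/

lemma acyc_singleton {E₀ E₁ : ℕ → ℕ} {e : ℕ} (h : E₀ e ≠ E₁ e) : Acyc E₀ E₁ {e} := by
  intro c hc e' he'
  rw [Finset.mem_singleton] at he'
  subst he'
  simpa [bd, h, h.symm] using hc (E₁ e')

/-- Two arcs with the same tail and different heads are acyclic. -/
lemma acyc_pair {E₀ E₁ : ℕ → ℕ} {e e' : ℕ} (h : E₀ e ≠ E₁ e) (h' : E₀ e' ≠ E₁ e')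
    (h0 : E₀ e = E₀ e') (h1 : E₁ e ≠ E₁ e') (hne : e ≠ e') : Acyc E₀ E₁ {e, e'} := by
  intro c hc
  have a1 := hc (E₁ e)
  have a2 := hc (E₁ e')
  rw [Finset.sum_pair hne] at a1 a2
  simp [bd, h, h', h0, h1, h1.symm, h0 ▸ h] at a1 a2
  intro x hx
  rcases Finset.mem_insert.1 hx with rfl | hx
  · simpa using a1
  · rw [Finset.mem_singleton] at hx
    subst hx
    simpa using a2

/-- If the only path from the tail of the arc `a` ends at its head, the cycle is cancelled, whereby
the path or the arc becomes inactive. -/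
lemma tryPush_spec (h8 : σ.wReg 8 = a) (h9 : σ.wReg 9 = N) (h19 : σ.wReg 19 = nx)
    (h21 : σ.wReg 21 = σ.wArr 1 a) (haN : a < N) (hN : N ≤ nx) (hnx : nx ≤ N + 1)
    (hne : σ.wArr 0 a ≠ σ.wArr 1 a) (hst : ∀ s ∈ Finset.Ico N nx, σ.wArr 0 s = σ.wArr 0 a)
    (hac : Acyc (σ.wArr 0) (σ.wArr 1) (Finset.Ico N nx))
    (hpos : ∀ s ∈ Finset.Ico N nx, 0 < σ.rArr 3 s ∧ 0 < σ.rArr 4 s ∧ σ.rArr 5 s = 0)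
    (hpa : 0 < σ.rArr 3 a ∧ 0 < σ.rArr 4 a ∧ σ.rArr 5 a = 0) :
    WP W tryPush (fun ρ k' => Fr σ ρ ∧ ρ.wArr = σ.wArr ∧ (∀ b, b ≠ 5 → ρ.rArr b = σ.rArr b) ∧
      (∀ e < N, e ≠ a → ρ.rArr 5 e = σ.rArr 5 e) ∧
      Acyc (ρ.wArr 0) (ρ.wArr 1) (actS ρ (Finset.Ico N nx ∪ Finset.Ico a (a + 1))) ∧
      (∀ e ∈ Finset.Ico N nx ∪ Finset.Ico a (a + 1), 0 ≤ upRes ρ e ∧ 0 ≤ dnRes ρ e) ∧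
      (∀ v, ∑ e ∈ Finset.Ico N nx ∪ Finset.Ico a (a + 1),
        ρ.rArr 5 e * bd (ρ.wArr 0) (ρ.wArr 1) e v = 0) ∧
      ρ.rArr 5 a ≤ 0 ∧ k' ≤ k + 12) σ k := by
  have hIa : Finset.Ico a (a + 1) = {a} := by simp
  obtain ⟨pa3, pa4, pa5⟩ := hpa
  have hzero : ∀ e ∈ Finset.Ico N nx ∪ Finset.Ico a (a + 1),
      0 < σ.rArr 3 e ∧ 0 < σ.rArr 4 e ∧ σ.rArr 5 e = 0 := by
    intro e he
    rcases Finset.mem_union.1 he with he | he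
    · exact hpos e he
    · rw [hIa, Finset.mem_singleton] at he
      rw [he]; exact ⟨pa3, pa4, pa5⟩
  have stay : ∀ ρ : State, ρ.wArr = σ.wArr → ρ.rArr = σ.rArr →
      (N < nx → σ.wArr 1 N ≠ σ.wArr 1 a) →
      (∀ b, b ≠ 5 → ρ.rArr b = σ.rArr b) ∧
      (∀ e < N, e ≠ a → ρ.rArr 5 e = σ.rArr 5 e) ∧
      Acyc (ρ.wArr 0) (ρ.wArr 1) (actS ρ (Finset.Ico N nx ∪ Finset.Ico a (a + 1))) ∧
      (∀ e ∈ Finset.Ico N nx ∪ Finset.Ico a (a + 1), 0 ≤ upRes ρ e ∧ 0 ≤ dnRes ρ e) ∧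
      (∀ v, ∑ e ∈ Finset.Ico N nx ∪ Finset.Ico a (a + 1),
        ρ.rArr 5 e * bd (ρ.wArr 0) (ρ.wArr 1) e v = 0) ∧ ρ.rArr 5 a ≤ 0 := by
    intro ρ hw hr hend
    rw [hw, hr]
    refine ⟨fun _ _ => rfl, fun _ _ _ => rfl, ?_, fun e he => ?_, fun v => ?_, pa5.le⟩
    · refine Acyc.subset ?_ (Finset.filter_subset _ _)
      rw [hIa]
      rcases hN.eq_or_lt with rfl | hlt
      · rw [Finset.Ico_self, Finset.empty_union]
        exact acyc_singleton hne
      · obtain rfl : nx = N + 1 := by omega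
        have hm : N ∈ Finset.Ico N (N + 1) := by simp
        rw [Nat.Ico_succ_singleton]
        exact acyc_pair (hac.ne hm) hne (hst N hm) (hend hlt) (by omega)
    · obtain ⟨z3, z4, z5⟩ := hzero e he
      simp only [upRes, dnRes, hr, z5]
      constructor <;> linarith
    · exact Finset.sum_eq_zero fun e he => by rw [(hzero e he).2.2, zero_mul]
  simp only [tryPush, push, WP_ite, WP_seq, WP_instr, WP_skip, Test.Holds, Instr.exec]
  refine ⟨fun hlt => ⟨fun hend => ?_, fun hend => ?_⟩, fun hlt => ?_⟩
  · simp only [h9, h19] at hlt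
    simp [h9, h21] at hend
    obtain rfl : nx = N + 1 := by omega
    have hm : N ∈ Finset.Ico N (N + 1) := by simp
    obtain ⟨p3, p4, p5⟩ := hpos N hm
    have haN' : a ≠ N := haN.ne
    have hNa' : N ≠ a := haN.ne'
    have main : ∀ (ρ : State) (δ : ℝ), δ = min (σ.rArr 3 N) (σ.rArr 4 a) → ρ.wArr = σ.wArr →
        (∀ b, b ≠ 5 → ρ.rArr b = σ.rArr b) →
        ρ.rArr 5 = Function.update (Function.update (σ.rArr 5) N δ) a (-δ) →
        (∀ b, b ≠ 5 → ρ.rArr b = σ.rArr b) ∧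
        (∀ e < N, e ≠ a → ρ.rArr 5 e = σ.rArr 5 e) ∧
        Acyc (ρ.wArr 0) (ρ.wArr 1) (actS ρ (Finset.Ico N (N + 1) ∪ Finset.Ico a (a + 1))) ∧
        (∀ e ∈ Finset.Ico N (N + 1) ∪ Finset.Ico a (a + 1), 0 ≤ upRes ρ e ∧ 0 ≤ dnRes ρ e) ∧
        (∀ v, ∑ e ∈ Finset.Ico N (N + 1) ∪ Finset.Ico a (a + 1),
          ρ.rArr 5 e * bd (ρ.wArr 0) (ρ.wArr 1) e v = 0) ∧ ρ.rArr 5 a ≤ 0 := by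
      intro ρ δ hδ hw hr h5
      have hδ3 : δ ≤ σ.rArr 3 N := hδ ▸ min_le_left _ _
      have hδ4 : δ ≤ σ.rArr 4 a := hδ ▸ min_le_right _ _
      have hδ0 : 0 < δ := hδ ▸ lt_min p3 pa4
      have f5 : ρ.rArr 5 N = δ := by rw [h5]; simp [hNa']
      have fa5 : ρ.rArr 5 a = -δ := by rw [h5]; simp
      have r3 := hr 3 (by norm_num)
      have r4 := hr 4 (by norm_num)
      have hset : Finset.Ico N (N + 1) ∪ Finset.Ico a (a + 1) = {N, a} := by
        rw [hIa, Nat.Ico_succ_singleton]; rfl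
      rw [hset, hw]
      refine ⟨hr, fun e he he' => ?_, ?_, fun e he => ?_, fun v => ?_, by linarith⟩
      · rw [h5]; simp [he', he.ne]
      · rcases min_cases (σ.rArr 3 N) (σ.rArr 4 a) with ⟨hc, -⟩ | ⟨hc, -⟩
        · refine (acyc_singleton (e := a) hne).subset fun e he => ?_
          obtain ⟨he, hu, -⟩ := mem_actS.1 he
          rcases Finset.mem_insert.1 he with rfl | he
          · rw [upRes, r3, f5] at hu
            linarith
          · exact he
        · refine (acyc_singleton (e := N) (hac.ne hm)).subset fun e he => ?_
          obtain ⟨he, -, hn⟩ := mem_actS.1 he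
          rcases Finset.mem_insert.1 he with rfl | he
          · simp
          · rw [Finset.mem_singleton] at he
            subst he
            rw [dnRes, r4, fa5] at hn
            linarith
      · rcases Finset.mem_insert.1 he with rfl | he
        · rw [upRes, dnRes, r3, r4, f5]
          constructor <;> linarith
        · rw [Finset.mem_singleton] at he
          subst he
          rw [upRes, dnRes, r3, r4, fa5]
          constructor <;> linarith
      · rw [Finset.sum_pair hNa', f5, fa5, bd, bd, hst N hm, hend]
        ring
    have pack : ∀ {A B C D E F G : Prop}, A ∧ B ∧ C ∧ D ∧ E ∧ F → G →
        A ∧ B ∧ C ∧ D ∧ E ∧ F ∧ G := by tauto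
    refine ⟨fun hmin => ?_, fun hmin => ?_⟩
    all_goals
      simp [h8, h9] at hmin
      refine ⟨by simp [Fr.refl], by simp, ?_⟩
    · exact pack (main _ (σ.rArr 3 N) (min_eq_left hmin.le).symm (by simp)
        (fun b hb => by simp [hb]) (by simp [h8, h9])) (by omega)
    · exact pack (main _ (σ.rArr 4 a) (min_eq_right hmin).symm (by simp)
        (fun b hb => by simp [hb]) (by simp [h8, h9])) (by omega)
  · simp [h9, h21] at hend
    obtain ⟨m1, m2, m3, m4, m5, m6⟩ := stay (σ.setW 22 (σ.wArr 1 (σ.wReg 9))) rfl rfl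
      (fun _ => hend)
    exact ⟨by simp [Fr.refl], rfl, m1, m2, m3, m4, m5, m6, by omega⟩
  · rw [h9, h19] at hlt
    obtain ⟨m1, m2, m3, m4, m5, m6⟩ := stay σ rfl rfl (fun h => absurd h hlt)
    exact ⟨Fr.refl _, trivial, fun _ _ => trivial, fun _ _ _ => trivial, m3, m4, m5, m6, by omega⟩

/-- The arc `a` is active. With its tail as the only terminal and its head protected from pruning, the
compression leaves at most one path, starting at the tail. The arc closes a cycle with the forest if
and only if that path ends at the head. -/
lemma insertArc_spec (hf : Fits W M) (hl : Level W M σ S a a 1 d N)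
    (hpos : 0 < σ.rArr 3 a ∧ 0 < σ.rArr 4 a) (tw : τ.wArr = σ.wArr) (tr : τ.rArr = σ.rArr)
    (t : ∀ r < 11, τ.wReg r = σ.wReg r) (t11 : τ.wReg 11 = S) (t12 : τ.wReg 12 = N)
    (t13 : τ.wReg 13 = a) (t14 : τ.wReg 14 = a) (t18 : τ.wReg 18 = 0) (t19 : τ.wReg 19 = N) :
    WP W insertArc (fun ω k' => (∀ r < 11, ω.wReg r = σ.wReg r) ∧ ω.wReg 18 = 0 ∧
      (∀ ω', ω'.wArr = ω.wArr → ω'.rArr = ω.rArr → ω'.wReg 18 = 0 → ω'.wReg 10 = 1 →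
        ω'.wReg 6 = d → ω'.wReg 7 = 1 → ω'.wReg 8 = a + 1 → ω'.wReg 9 = N →
        (∀ r < 6, ω'.wReg r = σ.wReg r) →
        Level W M ω' S a (a + 1) 1 d N ∧ Change σ ω' (Finset.Ico S N ∪ Finset.Ico a (a + 1)) N d ∧
          ω'.rArr 5 a ≤ 0) ∧ k' ≤ k + 500) τ k := by
  have h1 := hl.end_le
  have h2 := hl.le_base
  have h3 := hl.base_le
  have h4 := hl.room
  have h6 := hl.top_le
  have hf' := hf
  unfold Fits at hf'
  have ha0 : a ∈ Finset.Ico a (a + 1) := by simp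
  obtain ⟨fa5, -, -, fne⟩ := hl.future a ha0
  replace fne := fne hpos.1 hpos.2
  set u := σ.wArr 0 a with hu
  set v := σ.wArr 1 a with hv
  obtain ⟨fk, hfk⟩ : ∃ fk : ℕ → ℕ, fk = fun w => if w = v then 2 else 0 := ⟨_, rfl⟩
  have t4 : τ.wReg 4 = 1 := by rw [t 4 (by norm_num), hl.one]
  have t8 : τ.wReg 8 = a := by rw [t 8 (by norm_num), hl.cur]
  obtain ⟨τ₁, hτ₁⟩ : ∃ τ₁, τ₁ = ((((τ.setW 21 u).setWArr 4 u 1).setW 21 v).setW 22 2).setWArr 2 v 2 :=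
    ⟨_, rfl⟩
  have hmark : ∀ (Q : State → ℕ → Prop) (k : ℕ), Q τ₁ (k + 5) → WP W markEnds Q τ k := by
    intro Q k hQ
    simp only [markEnds, WP_seq, WP_instr]
    convert hQ using 1
    rw [hτ₁]
    simp [Instr.exec, t8, t4, tw, ← hu, ← hv, Nat.mod_eq_of_lt (show 2 < W by omega)]
  rw [insertArc, WP_seq]
  apply hmark
  have hfr₁ : Fr τ τ₁ := by rw [hτ₁]; simp [Fr.refl]
  have hr₁ : τ₁.rArr = σ.rArr := by rw [hτ₁]; simp [tr]
  have hw₁ : ∀ i, i ≠ 2 → i ≠ 4 → τ₁.wArr i = σ.wArr i := fun i h h' => by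
    rw [hτ₁]; simp [h, h', tw]
  have hpre : CompressPre W τ₁ {u} fk := by
    refine hl.compressPre hf ?_ (fun w => ?_) hw₁ hr₁ (by rw [hfr₁ 4 (by norm_num), t4])
      (by rw [hfr₁ 18 (by norm_num), t18]) (by rw [hfr₁ 11 (by norm_num), t11])
      (by rw [hfr₁ 12 (by norm_num), t12]) (by rw [hfr₁ 13 (by norm_num), t13])
      (by rw [hfr₁ 14 (by norm_num), t14]) (by rw [hτ₁]; simp [t19]) (fun w => ?_)
      ⟨v, fun w hw => by simp [hfk, hw]⟩ (by simp) (by simp)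
    · funext w
      rw [hτ₁, hfk]
      simp [tw, hl.deg, Function.update_apply]
    · rw [hτ₁]
      simp [tw, hl.key, Function.update_apply]
    · rw [hfk]
      by_cases hw : w = v <;> simp [hw]
  have hEl : El τ₁ = Finset.Ico S N ∪ Finset.Ico a a := by
    rw [El_congr hfr₁, El, t11, t12, t13, t14]
  have hElc : (El τ₁).card ≤ 4 := by
    rw [hEl, Finset.Ico_self, Finset.union_empty, Nat.card_Ico]
    omega
  rw [WP_seq]
  refine WP.mono (compress_spec hpre) ?_
  rintro τ₂ k₂ ⟨hC, hk₂⟩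
  have n1 : τ₁.wReg 19 = N := by rw [hτ₁]; simp [t19]
  obtain ⟨nx, hnx⟩ : ∃ nx, τ₂.wReg 19 = nx := ⟨_, rfl⟩
  have hnew : newPaths τ₁ τ₂ = Finset.Ico N nx := by rw [newPaths, n1, hnx]
  have hNnx : N ≤ nx := by have := hC.le; omega
  have hnx1 : nx ≤ N + 1 := by
    have := hC.card
    rw [hnew, Nat.card_Ico, Finset.card_singleton] at this
    omega
  have hActe : actS τ₁ (El τ₁) = actS σ (Finset.Ico S N ∪ Finset.Ico a a) := by
    rw [hEl, actS_congr hr₁]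
  have hup : upRes τ₁ = upRes σ := by funext e; simp [upRes, hr₁]
  have hdn : dnRes τ₁ = dnRes σ := by funext e; simp [dnRes, hr₁]
  have hrep := hC.rep
  have hold := hC.old
  have hfresh := hC.fresh
  have hpar := hC.par_out
  have hdir := hC.dir_out
  rw [hActe, hnew, hup, hdn, hw₁ 0 (by norm_num) (by norm_num),
    hw₁ 1 (by norm_num) (by norm_num)] at hrep
  rw [n1, hw₁ 0 (by norm_num) (by norm_num), hw₁ 1 (by norm_num) (by norm_num), hr₁] at hold
  rw [hnew] at hfresh
  rw [hActe, hw₁ 6 (by norm_num) (by norm_num)] at hpar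
  rw [hActe, hw₁ 7 (by norm_num) (by norm_num)] at hdir
  have hstart : ∀ s ∈ Finset.Ico N nx, τ₂.wArr 0 s = u := by
    obtain ⟨K, hK, hKu, hs⟩ := hC.start
    rw [Finset.card_singleton] at hK
    have hKu' : K = {u} := (Finset.eq_of_subset_of_card_le hKu (by simp; omega)).symm
    intro s hs'
    simpa [hKu'] using hs s (hnew ▸ hs')
  obtain ⟨o0, o1, o3, o4, o5⟩ := hold a (by omega)
  have hkey2 : ∀ w, w ≠ u → τ₂.wArr 4 w = 0 := fun w hw => by
    by_contra hne
    exact hw (by simpa using hC.key w hne)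
  obtain ⟨τ₃, hτ₃⟩ : ∃ τ₃, τ₃ = (((τ₂.setW 21 u).setWArr 4 u 0).setW 21 v).setWArr 2 v 0 :=
    ⟨_, rfl⟩
  have hunmark : ∀ (Q : State → ℕ → Prop) (k : ℕ), Q τ₃ (k + 4) → WP W unmarkEnds Q τ₂ k := by
    intro Q k hQ
    simp only [unmarkEnds, WP_seq, WP_instr]
    convert hQ using 1
    rw [hτ₃]
    simp [Instr.exec, hC.fr 8 (by norm_num), hC.fr 18 (by norm_num), hfr₁ 8 (by norm_num),
      hfr₁ 18 (by norm_num), t8, t18, o0, o1, hu, hv]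
  rw [WP_seq]
  apply hunmark
  have hfr₃ : Fr τ τ₃ := by rw [hτ₃]; simp [hfr₁.trans hC.fr]
  have w₃ : ∀ i, i ≠ 2 → i ≠ 4 → τ₃.wArr i = τ₂.wArr i := fun i h h' => by
    rw [hτ₃]; simp [h, h']
  have r₃ : τ₃.rArr = τ₂.rArr := by rw [hτ₃]; simp
  have e0 := w₃ 0 (by norm_num) (by norm_num)
  have e1 := w₃ 1 (by norm_num) (by norm_num)
  have hpaths : Acyc (τ₂.wArr 0) (τ₂.wArr 1) (Finset.Ico N nx) :=
    hrep.acyc_paths hl.acyc fun s hs => by have := (Finset.mem_Ico.1 hs).1; omega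
  rw [WP_seq]
  refine WP.mono (tryPush_spec (a := a) (N := N) (nx := nx) (by rw [hfr₃ 8 (by norm_num), t8])
    (by rw [hfr₃ 9 (by norm_num), t 9 (by norm_num), hl.top]) (by rw [hτ₃]; simp [hnx])
    (by rw [e1, o1, hτ₃]; simp [hv]) (by omega) hNnx hnx1 (by rwa [e0, e1, o0, o1])
    (by rw [e0, o0]; exact hstart) (by rwa [e0, e1])
    (fun s hs => by
      rw [r₃]; exact ⟨(hrep.pos s hs).1, (hrep.pos s hs).2, hfresh s hs⟩)
    (by rw [r₃, o3, o4, o5]; exact ⟨hpos.1, hpos.2, fa5⟩)) ?_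
  rintro ρ k₃ ⟨hfr₄, hw₄, hr₄, hflow₄, hac₄, hbdd₄, hcons₄, hneg₄, hk₃⟩
  rw [WP_seq, WP_instr]
  have hfr₄' := hfr₃.trans hfr₄
  have hexec : (Instr.wAdd 14 14 4).exec W ρ = ρ.setW 14 (a + 1) := by
    simp [Instr.exec, hfr₄' 14 (by norm_num), hfr₄' 4 (by norm_num), t14, t4,
      Nat.mod_eq_of_lt (show a + 1 < W by omega)]
  rw [hexec]
  have g0 : ρ.wArr 0 = τ₂.wArr 0 := by rw [hw₄, e0]
  have g1 : ρ.wArr 1 = τ₂.wArr 1 := by rw [hw₄, e1]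
  have g3 : ρ.rArr 3 = τ₂.rArr 3 := by rw [hr₄ 3 (by norm_num), r₃]
  have g4 : ρ.rArr 4 = τ₂.rArr 4 := by rw [hr₄ 4 (by norm_num), r₃]
  have gw : ∀ i, i ≠ 2 → i ≠ 4 → ρ.wArr i = τ₂.wArr i := fun i h h' => by rw [hw₄, w₃ i h h']
  have hi : Inserted σ ρ S a a (a + 1) d N nx (fun w => w ∉ ({u} : Finset ℕ) ∧ fk w = 0) := by
    refine ⟨?_, ?_, ?_, ?_, ?_, ?_, ?_, ?_, hac₄, hbdd₄, hcons₄, ?_, ?_, ?_, ?_⟩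
    · rw [g0, g1, g3, g4, gw 6 (by norm_num) (by norm_num), gw 7 (by norm_num) (by norm_num)]
      exact hrep
    · rw [g0, g1, g3, g4]
      exact fun e he => ⟨(hold e he).1, (hold e he).2.1, (hold e he).2.2.1, (hold e he).2.2.2.1⟩
    · intro e he he'
      rw [hflow₄ e he (by simpa using he'), r₃, (hold e he).2.2.2.2]
    · rw [gw 6 (by norm_num) (by norm_num)]; exact hpar
    · rw [gw 7 (by norm_num) (by norm_num)]; exact fun e _ he _ => hdir e he
    · intro i _
      rw [gw 8 (by norm_num) (by norm_num), gw 9 (by norm_num) (by norm_num),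
        hC.wother 8 (by norm_num), hC.wother 9 (by norm_num), hw₁ 8 (by norm_num) (by norm_num),
        hw₁ 9 (by norm_num) (by norm_num)]
      exact ⟨rfl, rfl⟩
    · intro b h3 h4 h5
      rw [hr₄ b h5, r₃, hC.rother b h3 h4 h5, hr₁]
    · rintro e he w ⟨hwu, hwv⟩
      obtain rfl : e = a := by simpa using (mem_actS.1 he).1
      rw [hfk] at hwv
      have h1 : w ≠ v := fun h => by simp [h] at hwv
      have h2 : w ≠ u := by simpa using hwu
      simp [bd, ← hu, ← hv, h1.symm, h2.symm]
    · funext w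
      rw [hw₄, hτ₃]
      simp [hC.deg, hfk, Function.update_apply]
    · rw [gw 3 (by norm_num) (by norm_num), hC.sum]
    · funext w
      rw [hw₄, hτ₃]
      by_cases hw : w = u
      · simp [hw]
      · simp [hw, hkey2]
    · rw [gw 5 (by norm_num) (by norm_num), hC.pend]
  have hi' : Inserted σ (ρ.setW 14 (a + 1)) S a a (a + 1) d N nx
      (fun w => w ∉ ({u} : Finset ℕ) ∧ fk w = 0) :=
    ⟨hi.rep, hi.same, hi.flow_out, hi.par_out, hi.dir_out, hi.stack, hi.rother, hi.ok,
      hi.acyc, hi.bdd, hi.cons, hi.deg, hi.sum, hi.key, hi.pend⟩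
  refine WP.mono (hl.writeBack hf (Nat.le_succ a) le_rfl hi'
    (by simp [hfr₄' 4 (by norm_num), t4]) (by simp [hfr₄' 18 (by norm_num), t18])
    (by simp [hfr₄' 11 (by norm_num), t11]) (by simp [hfr₄' 12 (by norm_num), t12])
    (by simp [hfr₄' 13 (by norm_num), t13]) (by simp)) ?_
  rintro ω k' ⟨hfr₅, hω, hk'⟩
  refine ⟨fun r hr => ?_, ?_, fun ω' x1 x2 x3 x4 x5 x6 x7 x8 x9 => ?_, by omega⟩
  · rw [hfr₅ r (by omega)]
    simp [show r ≠ 14 by omega, hfr₄' r (by omega), t r hr]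
  · rw [hfr₅ 18 (by norm_num)]
    simp [hfr₄' 18 (by norm_num), t18]
  · obtain ⟨y1, y2, y3⟩ := hω ω' x1 x2 x3 x4 x5 x6 x7 x8 x9
    exact ⟨y1, y2, by rw [y3 a ha0]; exact hneg₄⟩

/-- Visiting a block of one arc. Its flow does not increase. -/
lemma leaf_spec (hf : Fits W M) (hl : Level W M σ S a a 1 d N) :
    WP W visitBody (fun ω k' => Level W M ω S a (a + 1) 1 d N ∧
      Change σ ω (Finset.Ico S N ∪ Finset.Ico a (a + 1)) N d ∧ ω.rArr 5 a ≤ 0 ∧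
      k' ≤ k + 550) σ k := by
  have h1 := hl.end_le
  have hf' := hf
  unfold Fits at hf'
  have haW : a + 1 < W := by nlinarith
  have ha0 : a ∈ Finset.Ico a (a + 1) := by simp
  obtain ⟨fa5, fa3, fa4, -⟩ := hl.future a ha0
  rw [visitBody, WP_seq]
  refine WP.mono (visitPrep_spec hf hl) ?_
  rintro τ₀ k₀ ⟨hτ₀, rfl⟩
  rw [WP_ite]
  refine ⟨fun _ => ?_, fun hn => absurd ?_ hn⟩
  swap
  · simp [Test.Holds, hτ₀, hl.cur]
  rw [WP_seq, WP_instr, WP_ite]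
  refine ⟨fun _ => ?_, fun hn => absurd ?_ hn⟩
  swap
  · simp [Test.Holds, Instr.exec, hτ₀, hl.size, hl.one]
  -- an inactive arc is skipped
  have hskip : ∀ ω : State, ω.wArr = σ.wArr → ω.rArr = σ.rArr → (∀ r < 11, ω.wReg r = σ.wReg r) →
      ω.wReg 18 = 0 → ¬ (0 < σ.rArr 3 a ∧ 0 < σ.rArr 4 a) →
      Level W M (ω.setW 8 (a + 1)) S a (a + 1) 1 d N ∧
      Change σ (ω.setW 8 (a + 1)) (Finset.Ico S N ∪ Finset.Ico a (a + 1)) N d ∧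
      (ω.setW 8 (a + 1)).rArr 5 a ≤ 0 := by
    intro ω ew er hr h18 hina
    have hact : actS σ (Finset.Ico S N ∪ Finset.Ico a (a + 1)) =
        actS σ (Finset.Ico S N ∪ Finset.Ico a a) := by
      ext e
      simp only [mem_actS, Finset.mem_union, Finset.mem_Ico]
      constructor
      · rintro ⟨he | he, hu⟩
        · exact ⟨.inl he, hu⟩
        · obtain rfl : e = a := by omega
          rw [upRes, dnRes, fa5, sub_zero, add_zero] at hu
          exact absurd hu hina
      · rintro ⟨he, hu⟩
        exact ⟨by omega, hu⟩
    refine ⟨⟨by simp [hr, hl.one], by simp [h18], by simp [hr, hl.run], by simp [hr, hl.dep],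
      by simp [hr, hl.size], by simp, by simp [hr, hl.top], by simp [ew, hl.base],
      by simp [ew, hl.blk], by omega, by omega, h1, hl.le_base, hl.base_le, hl.top_le, hl.room,
      hl.depth, hl.sz_pos, by simp [ew, hl.deg], by simp [ew, hl.sum], by simp [ew, hl.key],
      by simp [ew, hl.pend], by rw [setW_wArr, ew]; exact hl.par, ?_, ?_, by simp⟩,
      ⟨?_, ?_, ?_, ?_, ?_, ?_, fun r h => ?_, ?_⟩, ?_⟩
    · rw [actS_congr (show (ω.setW 8 (a + 1)).rArr = σ.rArr from er), hact, setW_wArr, ew]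
      exact hl.acyc
    · intro e he
      simp only [upRes, dnRes, setW_rArr, er]
      rcases Finset.mem_union.1 he with he | he
      · exact hl.bdd e (Finset.mem_union_left _ he)
      · obtain rfl : e = a := by simpa using he
        rw [fa5, sub_zero, add_zero]
        exact ⟨fa3, fa4⟩
    · intro r h
      simp [ew, er]
    · intro r h
      simp [ew, er]
    · intro r h
      simp [ew, er]
    · simp [ew]
    · simp [ew]
    · simp [er]
    · simp [hr r (by omega), show r ≠ 8 by omega]
    · simp [er]
    · simp [er, fa5]
  simp only [leaf, WP_seq, WP_instr, WP_ite, WP_skip]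
  obtain ⟨τ₁, hτ₁⟩ : ∃ τ₁, τ₁ = (Instr.rConst 0 0).exec W ((Instr.rLoad 2 4 8).exec W
    ((Instr.rLoad 1 3 8).exec W ((Instr.wCopy 19 9).exec W τ₀))) := ⟨_, rfl⟩
  simp only [← hτ₁]
  have ew : τ₁.wArr = σ.wArr := by simp [hτ₁, Instr.exec, hτ₀]
  have er : τ₁.rArr = σ.rArr := by simp [hτ₁, Instr.exec, hτ₀]
  have hr : ∀ r < 11, τ₁.wReg r = σ.wReg r := by
    intro r h
    simp [hτ₁, Instr.exec, hτ₀, show r ≠ 19 by omega, show r ≠ 11 by omega, show r ≠ 12 by omega,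
      show r ≠ 13 by omega, show r ≠ 14 by omega, show r ≠ 22 by omega]
  have h18 : τ₁.wReg 18 = 0 := by simp [hτ₁, Instr.exec, hτ₀, hl.zero]
  have t1 : (Test.rLt 0 1).Holds τ₁ ↔ 0 < σ.rArr 3 a := by
    simp [Test.Holds, hτ₁, Instr.exec, hτ₀, hl.cur]
  have t2 : (Test.rLt 0 2).Holds τ₁ ↔ 0 < σ.rArr 4 a := by
    simp [Test.Holds, hτ₁, Instr.exec, hτ₀, hl.cur]
  rw [t1, t2]
  have hstep : ∀ ω : State, (∀ r < 11, ω.wReg r = σ.wReg r) →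
      (Instr.wAdd 8 8 4).exec W ω = ω.setW 8 (a + 1) := by
    intro ω hω
    simp [Instr.exec, hω, hl.cur, hl.one, Nat.mod_eq_of_lt haW]
  refine ⟨fun p3 => ⟨fun p4 => ?_, fun p4 => ?_⟩, fun p3 => ?_⟩
  · refine WP.mono (insertArc_spec hf hl ⟨p3, p4⟩ ew er hr (by simp [hτ₁, Instr.exec, hτ₀])
      (by simp [hτ₁, Instr.exec, hτ₀]) (by simp [hτ₁, Instr.exec, hτ₀])
      (by simp [hτ₁, Instr.exec, hτ₀]) h18 (by simp [hτ₁, Instr.exec, hτ₀, hl.top])) ?_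
    rintro ω k' ⟨hω, h18', hcont, hk'⟩
    rw [WP_instr, hstep ω hω]
    obtain ⟨c1, c2, c3⟩ := hcont (ω.setW 8 (a + 1)) rfl rfl (by simp [h18'])
      (by simp [hω, hl.run]) (by simp [hω, hl.dep]) (by simp [hω, hl.size]) (by simp)
      (by simp [hω, hl.top]) (fun r h => by simp [hω r (by omega), show r ≠ 8 by omega])
    exact ⟨c1, c2, c3, by omega⟩
  · rw [hstep τ₁ hr]
    obtain ⟨c1, c2, c3⟩ := hskip τ₁ ew er hr h18 fun h => p4 h.2
    exact ⟨c1, c2, c3, by omega⟩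
  · rw [hstep τ₁ hr]
    obtain ⟨c1, c2, c3⟩ := hskip τ₁ ew er hr h18 fun h => p3 h.1
    exact ⟨c1, c2, c3, by omega⟩

/-! ### The traversal -/

/-- Visiting a whole block: its arcs are inserted into the forest, the last one with a
non-positive change of flow. -/
lemma visit_spec (hf : Fits W M) {Q : State → ℕ → Prop} (j : ℕ) :
    ∀ {σ : State} {S a d N k : ℕ}, Level W M σ S a a (2 ^ j) d N →
      (∀ ω k', Level W M ω S a (a + 2 ^ j) (2 ^ j) d N →
        Change σ ω (Finset.Ico S N ∪ Finset.Ico a (a + 2 ^ j)) N d →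
        ω.rArr 5 (a + 2 ^ j - 1) ≤ 0 → k' ≤ k + 1200 * (2 ^ j * (j + 1)) →
        WP W visitAll Q ω k') →
      WP W visitAll Q σ k := by
  induction j with
  | zero =>
    intro σ S a d N k hl hQ
    rw [visitAll, WP_loop]
    refine ⟨fun _ => ?_, fun hn => absurd ?_ hn⟩
    swap
    · simp [Test.Holds, hl.zero, hl.run]
    refine WP.mono (leaf_spec hf hl) ?_
    rintro ω k' ⟨h1, h2, h3, h4⟩
    exact hQ ω k' h1 h2 (by simpa using h3) (by omega)
  | succ j ih =>
    intro σ S a d N k hl hQ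
    have hpos : 0 < 2 ^ j := by positivity
    have h2j : 2 ^ (j + 1) = 2 * 2 ^ j := by ring
    -- visiting the half of the block that begins with the arc `p`
    have half : ∀ {σ₀ : State} {p k : ℕ}, Level W M σ₀ S a p (2 * 2 ^ j) d N →
        p + 2 ^ j ≤ a + 2 * 2 ^ j →
        (∀ ω k', Level W M ω S a (p + 2 ^ j) (2 * 2 ^ j) d N →
          Change σ₀ ω (Finset.Ico S N ∪ Finset.Ico a (p + 2 ^ j)) N d →
          ω.rArr 5 (p + 2 ^ j - 1) ≤ 0 →
          k' ≤ k + 1200 * (2 ^ j * (j + 1)) + 1152 * 2 ^ j → WP W visitAll Q ω k') →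
        WP W visitAll Q σ₀ k := by
      intro σ₀ p k hl hp hQ
      rw [visitAll, WP_loop]
      refine ⟨fun _ => ?_, fun hn => absurd ?_ hn⟩
      swap
      · simp [Test.Holds, hl.zero, hl.run]
      refine WP.mono (down_spec hf hl hpos hp) ?_
      rintro τ k₁ ⟨nx, hl', hd, hk₁⟩
      refine ih hl' ?_
      intro ρ k₂ hlρ hc hneg hk₂
      rw [visitAll, WP_loop]
      refine ⟨fun _ => ?_, fun hn => absurd ?_ hn⟩
      swap
      · simp [Test.Holds, hlρ.zero, hlρ.run]
      refine WP.mono (up_spec hf hl hp hd hlρ hc) ?_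
      rintro ω k₃ ⟨hω, hcω, hflow, hk₃⟩
      refine hQ ω k₃ hω hcω ?_ (by omega)
      rw [hflow _ (Finset.mem_Ico.2 (by omega))]
      exact hneg
    rw [h2j] at hl
    refine half hl (by omega) ?_
    intro ρ k₁ hlρ hcρ _ hk₁
    refine half hlρ (by omega) ?_
    intro ω k₂ hlω hcω hneg hk₂
    have hadd : a + 2 ^ j + 2 ^ j = a + 2 ^ (j + 1) := by omega
    rw [hadd] at hlω hcω hneg
    have hmem : ∀ e ∈ Finset.Ico S N ∪ Finset.Ico a (a + 2 ^ (j + 1)), e < N :=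
      fun e he => hl.lt_top (by rwa [← h2j])
    refine hQ ω k₂ (by rwa [← h2j] at hlω) ((hcρ.mono ?_ hmem).trans hcω hmem) hneg ?_
    · exact Finset.union_subset_union_right (Finset.Ico_subset_Ico_right (by omega))
    · have : 2 ^ (j + 1) * (j + 1 + 1) = 2 * (2 ^ j * (j + 1)) + 2 * 2 ^ j := by ring
      omega

end RealRAM

namespace FlowRounding

/-! ### Integrality -/

/-- A circulation between the roundings of `b` whose fractional arcs form a forest is integral: the
fractional arc at a leaf of the forest would carry an integer. -/
lemma integral_of_acyc {E₀ E₁ : ℕ → ℕ} {T : Finset ℕ} {b g : ℕ → ℝ}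
    (hc : ∀ v, ∑ e ∈ T, g e * bd E₀ E₁ e v = 0)
    (hb : ∀ e ∈ T, (⌊b e⌋ : ℝ) ≤ g e ∧ g e ≤ ⌈b e⌉)
    (hac : Acyc E₀ E₁ (T.filter fun e => (⌊b e⌋ : ℝ) < g e ∧ g e < ⌈b e⌉)) :
    ∀ e ∈ T, ∃ z : ℤ, g e = z := by
  set R := T.filter fun e => (⌊b e⌋ : ℝ) < g e ∧ g e < ⌈b e⌉ with hR
  have hout : ∀ e ∈ T, e ∉ R → ∃ z : ℤ, g e = z := by
    intro e he heR
    obtain ⟨h1, h2⟩ := hb e he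
    rcases h1.eq_or_lt with h | h
    · exact ⟨_, h.symm⟩
    rcases h2.eq_or_lt with h' | h'
    · exact ⟨_, h'⟩
    · exact absurd (Finset.mem_filter.2 ⟨he, h, h'⟩) heR
  have hRe : R = ∅ := by
    by_contra hne
    obtain ⟨v, -, hv⟩ := hac.exists_leaf (Finset.nonempty_iff_ne_empty.2 hne) 0
    obtain ⟨e, he⟩ := Finset.card_eq_one.1 hv
    have hee : e ∈ inc E₀ E₁ R v := by simp [he]
    obtain ⟨heR, hinc⟩ := mem_inc.1 hee
    have heT : e ∈ T := (Finset.mem_filter.1 heR).1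
    have hne' := hac.ne heR
    have hint : ∃ z : ℤ, ∑ e' ∈ T.erase e, g e' * bd E₀ E₁ e' v = z := by
      refine Finset.sum_induction _ (fun x : ℝ => ∃ z : ℤ, x = z) ?_ ⟨0, by simp⟩ ?_
      · rintro x y ⟨z, rfl⟩ ⟨w, rfl⟩
        exact ⟨z + w, by push_cast; ring⟩
      · intro e' he'
        obtain ⟨hne, heT'⟩ := Finset.mem_erase.1 he'
        by_cases hi : E₀ e' = v ∨ E₁ e' = v
        · have : e' ∉ R := fun h => hne (by
            have : e' ∈ inc E₀ E₁ R v := mem_inc.2 ⟨h, hi⟩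
            simpa [he] using this)
          obtain ⟨z, hz⟩ := hout e' heT' this
          refine ⟨z * ((if E₁ e' = v then 1 else 0) - (if E₀ e' = v then 1 else 0)), ?_⟩
          rw [hz, bd]
          push_cast
          rfl
        · rw [not_or] at hi
          exact ⟨0, by simp [bd, hi.1, hi.2]⟩
    obtain ⟨z, hz⟩ := hint
    have hsum := hc v
    rw [← Finset.add_sum_erase T _ heT, hz] at hsum
    have hge : ∃ w : ℤ, g e = w := by
      rcases hinc with h | h
      · refine ⟨z, ?_⟩
        have h' : E₁ e ≠ v := fun h' => hne' (h.trans h'.symm)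
        simp only [bd, h, h', if_true, if_false] at hsum
        linarith
      · refine ⟨-z, ?_⟩
        have h' : E₀ e ≠ v := fun h' => hne' (h'.trans h.symm)
        simp only [bd, h, h', if_true, if_false] at hsum
        push_cast
        linarith
    obtain ⟨w, hw⟩ := hge
    obtain ⟨-, h1, h2⟩ := Finset.mem_filter.1 heR
    rw [hw] at h1 h2
    have h3 : ⌊b e⌋ < w := by exact_mod_cast h1
    have h4 : w < ⌈b e⌉ := by exact_mod_cast h2
    have := Int.ceil_le_floor_add_one (b e)
    omega
  exact fun e he => hout e he (by rw [hRe]; simp)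

end FlowRounding

namespace RealRAM
open FlowRounding

variable {W M : ℕ} {σ τ ρ ω : State} {k : ℕ}

/-! ### Preparing the input and producing the output -/

lemma lt_clog {x i : ℕ} : i < Nat.clog 2 x ↔ 2 ^ i < x := Nat.lt_clog_iff_pow_lt (by norm_num)

lemma pow_clog_le (x : ℕ) (hx : 0 < x) : 2 ^ Nat.clog 2 x ≤ 2 * x := by
  rcases Nat.eq_zero_or_pos (Nat.clog 2 x) with h | h
  · rw [h]; omega
  · have := lt_clog.1 (Nat.sub_lt h one_pos)
    obtain ⟨j, hj⟩ := Nat.exists_eq_succ_of_ne_zero h.ne'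
    rw [hj] at this ⊢
    rw [Nat.succ_sub_one] at this
    rw [pow_succ]
    omega

lemma powerOfTwo_spec {m : ℕ} (hm : σ.wReg 1 = m) (hW : 2 * (m + 1) < W) :
    WP W powerOfTwo (fun τ k' =>
      τ = ((σ.setW 4 1).setW 22 (m + 1)).setW 5 (2 ^ Nat.clog 2 (m + 1)) ∧
      k' = k + 2 * Nat.clog 2 (m + 1) + 4) σ k := by
  have h1 : 1 % W = 1 := Nat.mod_eq_of_lt (by omega)
  have h2 : (m + 1) % W = m + 1 := Nat.mod_eq_of_lt (by omega)
  set J := Nat.clog 2 (m + 1) with hJ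
  have loop : ∀ r i k, i + r = J → WP W (.loop (.wLt 5 22) (.instr (.wAdd 5 5 5)))
      (fun τ k' => τ = ((σ.setW 4 1).setW 22 (m + 1)).setW 5 (2 ^ J) ∧ k' = k + 2 * r + 1)
      (((σ.setW 4 1).setW 22 (m + 1)).setW 5 (2 ^ i)) k := by
    intro r
    induction r with
    | zero =>
      intro i k hi
      obtain rfl : i = J := by omega
      rw [WP_loop]
      refine ⟨fun h => absurd h ?_, fun _ => ⟨rfl, by omega⟩⟩
      have := Nat.le_pow_clog (b := 2) (by norm_num) (m + 1)
      simpa [Test.Holds, hJ] using this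
    | succ r ih =>
      intro i k hi
      have hlt := lt_clog.1 (show i < Nat.clog 2 (m + 1) by omega)
      rw [WP_loop]
      refine ⟨fun _ => ?_, fun h => absurd ?_ h⟩
      swap
      · simpa [Test.Holds] using hlt
      rw [WP_instr]
      have he : (Instr.wAdd 5 5 5).exec W (((σ.setW 4 1).setW 22 (m + 1)).setW 5 (2 ^ i)) =
          ((σ.setW 4 1).setW 22 (m + 1)).setW 5 (2 ^ (i + 1)) := by
        have : (2 ^ i + 2 ^ i) % W = 2 ^ (i + 1) := by
          rw [Nat.mod_eq_of_lt (by omega), pow_succ]; omega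
        simp [Instr.exec, this, State.setW]
      rw [he]
      refine WP.mono (ih (i + 1) (k + 1 + 1) (by omega)) ?_
      rintro τ k' ⟨h, h'⟩
      exact ⟨h, by omega⟩
  simp only [powerOfTwo, WP_seq, WP_instr, Instr.exec]
  have hst : (((σ.setW 4 (1 % W)).setW 5 ((σ.setW 4 (1 % W)).wReg 4)).setW 22
      ((((σ.setW 4 (1 % W)).setW 5 ((σ.setW 4 (1 % W)).wReg 4)).wReg 1 +
        ((σ.setW 4 (1 % W)).setW 5 ((σ.setW 4 (1 % W)).wReg 4)).wReg 4) % W)) =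
      ((σ.setW 4 1).setW 22 (m + 1)).setW 5 (2 ^ 0) := by
    simp [h1, h2, hm, State.setW]
    rw [Function.update_comm (by norm_num)]
  rw [hst]
  refine WP.mono (loop J 0 _ (by omega)) ?_
  rintro τ k' ⟨h, h'⟩
  exact ⟨h, by omega⟩

/-- The flow to be rounded: the given one, already rounded down on loops. -/
noncomputable def baseFlow (σ : State) (e : ℕ) : ℝ :=
  if σ.wArr 0 e = σ.wArr 1 e then (⌊σ.rArr 1 e⌋ : ℝ) else σ.rArr 1 e

/-- A loop keeps the capacities `0`, as the flow on it is rounded at once. In the net inflow at the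
sink loops cancel. -/
lemma prepLoop_spec {m : ℕ} (h4 : σ.wReg 4 = 1) (h18 : σ.wReg 18 = 0) (hm : σ.wReg 1 = m)
    (hW : m < W) (hz3 : ∀ e, σ.rArr 3 e = 0) (hz4 : ∀ e, σ.rArr 4 e = 0) (hz : σ.rReg 10 = 0) :
    WP W (forRange 18 1 prepBody) (fun τ k' => Fr σ τ ∧ τ.wArr = σ.wArr ∧
      (∀ a, a ≠ 1 → a ≠ 3 → a ≠ 4 → τ.rArr a = σ.rArr a) ∧
      (∀ e, τ.rArr 1 e = if e ∈ Finset.Ico 0 m then baseFlow σ e else σ.rArr 1 e) ∧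
      (∀ e, τ.rArr 3 e = if e ∈ Finset.Ico 0 m then ⌈baseFlow σ e⌉ - baseFlow σ e else 0) ∧
      (∀ e, τ.rArr 4 e = if e ∈ Finset.Ico 0 m then baseFlow σ e - ⌊baseFlow σ e⌋ else 0) ∧
      τ.rReg 10 = ∑ e ∈ Finset.Ico 0 m, σ.rArr 1 e * bd (σ.wArr 0) (σ.wArr 1) e (σ.wReg 3) ∧
      k' ≤ k + 20 * m + 2) σ k := by
  let J : Finset ℕ → State → ℕ → Prop := fun T τ l => τ.wArr = σ.wArr ∧
      (∀ a, a ≠ 1 → a ≠ 3 → a ≠ 4 → τ.rArr a = σ.rArr a) ∧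
      (∀ e, τ.rArr 1 e = if e ∈ T then baseFlow σ e else σ.rArr 1 e) ∧
      (∀ e, τ.rArr 3 e = if e ∈ T then ⌈baseFlow σ e⌉ - baseFlow σ e else 0) ∧
      (∀ e, τ.rArr 4 e = if e ∈ T then baseFlow σ e - ⌊baseFlow σ e⌋ else 0) ∧
      τ.rReg 10 = ∑ e ∈ T, σ.rArr 1 e * bd (σ.wArr 0) (σ.wArr 1) e (σ.wReg 3) ∧
      l ≤ k + 20 * T.card
  refine WP.mono (WP_forRange (J := J) (T₀ := ∅) (lo := 0) (hi := m) (by norm_num) h18 hm h4 hW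
    (Nat.zero_le _) (by simp) ?_ ?_ ?_) ?_
  · intro T τ l v h
    exact h
  · exact ⟨rfl, fun _ _ _ _ => rfl, by simp, by simpa using hz3, by simpa using hz4,
      by simpa using hz, by simp⟩
  · rintro T τ l e hfr he heT hTE h20 ⟨hw, hr, h1, h3, h4, h10, hl⟩
    have hc : (insert e T).card = T.card + 1 := Finset.card_insert_of_notMem heT
    have h3' : τ.wReg 3 = σ.wReg 3 := hfr 3 (by norm_num)
    have f1 : τ.rArr 1 e = σ.rArr 1 e := by rw [h1, if_neg heT]
    have f3 : τ.rArr 3 e = 0 := by rw [h3, if_neg heT]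
    have f4 : τ.rArr 4 e = 0 := by rw [h4, if_neg heT]
    simp only [prepBody, WP_seq, WP_instr, WP_ite, WP_skip, Instr.exec, Test.Holds]
    refine ⟨fun hloop => ?_, fun hloop => ⟨fun hh => ⟨fun ht => ?_, fun ht => ?_⟩,
      fun hh => ⟨fun ht => ?_, fun ht => ?_⟩⟩⟩
    · simp [h20, hw] at hloop
      have hb : baseFlow σ e = ⌊σ.rArr 1 e⌋ := if_pos hloop
      refine ⟨by simp [Fr.refl], by simp [h20], by simp [hw], fun a a1 a3 a4 => by
        simp [a1, hr a a1 a3 a4], fun e' => ?_, fun e' => ?_, fun e' => ?_, ?_, by omega⟩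
      · by_cases hee : e' = e
        · subst hee; simp [h20, f1, hb]
        · simp [hee, h1, h20]
      · by_cases hee : e' = e
        · subst hee; simp [f3, hb]
        · simp [hee, h3]
      · by_cases hee : e' = e
        · subst hee; simp [f4, hb]
        · simp [hee, h4]
      · simp [h10, Finset.sum_insert heT, bd, hloop]
    all_goals
      simp [h20, hw, h3'] at hloop hh ht
      have hb : baseFlow σ e = σ.rArr 1 e := if_neg hloop
      refine ⟨by simp [Fr.refl], by simp [h20], by simp [hw], fun a a1 a3 a4 => by
        simp [a3, a4, hr a a1 a3 a4], fun e' => ?_, fun e' => ?_, fun e' => ?_, ?_, by omega⟩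
      · by_cases hee : e' = e
        · subst hee; simp [f1, hb]
        · simp [hee, h1]
      · by_cases hee : e' = e
        · subst hee; simp [h20, f1, hb, Int.floor_neg]
        · simp [hee, h3, h20]
      · by_cases hee : e' = e
        · subst hee; simp [h20, f1, hb]
        · simp [hee, h4, h20]
      · simp [h10, Finset.sum_insert heT, bd, hh, ht, h20, f1]
        try ring
  · rintro τ k' ⟨hfr, l, ⟨h1, h2, h3, h4, h5, h6, h7⟩, rfl⟩
    rw [Finset.empty_union] at h3 h4 h5 h6 h7
    rw [Nat.card_Ico] at h7
    exact ⟨hfr, h1, h2, h3, h4, h5, h6, by omega⟩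

lemma outLoop_spec {m : ℕ} (h4 : σ.wReg 4 = 1) (h18 : σ.wReg 18 = 0) (hm : σ.wReg 1 = m)
    (hW : m < W) :
    WP W (forRange 18 1 outBody) (fun τ k' => (∀ e < m, τ.rArr 2 e = σ.rArr 1 e + σ.rArr 5 e) ∧
      k' ≤ k + 8 * m + 2) σ k := by
  let J : Finset ℕ → State → ℕ → Prop := fun T τ l => τ.rArr 1 = σ.rArr 1 ∧ τ.rArr 5 = σ.rArr 5 ∧
    (∀ e ∈ T, τ.rArr 2 e = σ.rArr 1 e + σ.rArr 5 e) ∧ l ≤ k + 8 * T.card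
  refine WP.mono (WP_forRange (J := J) (T₀ := ∅) (lo := 0) (hi := m) (by norm_num) h18 hm h4 hW
    (Nat.zero_le _) (by simp) ?_ ?_ ?_) ?_
  · intro T τ l v h
    exact h
  · exact ⟨rfl, rfl, by simp, by simp⟩
  · rintro T τ l e hfr he heT hTE h20 ⟨h1, h5, h2, hl⟩
    have hc : (insert e T).card = T.card + 1 := Finset.card_insert_of_notMem heT
    simp only [outBody, WP_seq, WP_instr, Instr.exec]
    refine ⟨by simp [Fr.refl], by simp [h20], by simp [h1], by simp [h5], fun e' he' => ?_,
      by omega⟩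
    by_cases hee : e' = e
    · subst hee; simp [h20, h1, h5]
    · simp [hee, h20, h2 e' ((Finset.mem_insert.1 he').resolve_left hee)]
  · rintro τ k' ⟨-, l, ⟨-, -, h, hl⟩, rfl⟩
    rw [Finset.empty_union] at h hl
    rw [Nat.card_Ico] at hl
    exact ⟨fun e he => h e (by simp [he]), by omega⟩

/-- The traversal ends when the whole block at depth `0` has been treated. -/
lemma finish_spec (hf : Fits W M) {S a sz N : ℕ} (hl : Level W M σ S a (a + sz) sz 0 N)
    {Q : State → ℕ → Prop}
    (hQ : ∀ ω, ω.wArr = σ.wArr → ω.rArr = σ.rArr → (∀ r < 6, ω.wReg r = σ.wReg r) →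
      ω.wReg 18 = 0 → Q ω (k + 10)) : WP W visitAll Q σ k := by
  rw [visitAll, WP_loop]
  refine ⟨fun _ => ?_, fun hn => absurd ?_ hn⟩
  swap
  · simp [Test.Holds, hl.zero, hl.run]
  rw [visitBody, WP_seq]
  refine WP.mono (visitPrep_spec hf hl) ?_
  rintro τ₀ k₀ ⟨hτ₀, rfl⟩
  rw [WP_ite]
  refine ⟨fun hn => absurd hn ?_, fun _ => ?_⟩
  · simp [Test.Holds, hτ₀, hl.cur]
  rw [WP_ite]
  refine ⟨fun _ => ?_, fun hn => absurd ?_ hn⟩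
  swap
  · simp [Test.Holds, hτ₀, hl.dep, hl.zero]
  rw [WP_instr, WP_loop]
  refine ⟨fun hn => absurd hn ?_, fun _ => ?_⟩
  · simp [Test.Holds, Instr.exec, hτ₀, hl.zero]
  refine hQ _ (by simp [Instr.exec, hτ₀]) (by simp [Instr.exec, hτ₀]) (fun r hr => ?_)
    (by simp [Instr.exec, hτ₀, hl.zero])
  simp [Instr.exec, hτ₀, show r ≠ 10 by omega, show r ≠ 11 by omega, show r ≠ 12 by omega,
    show r ≠ 13 by omega, show r ≠ 14 by omega, show r ≠ 22 by omega]

end RealRAM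

namespace RealRAM
open FlowRounding

variable {W M : ℕ} {σ τ ρ ω : State} {k : ℕ}

/-! ### The whole program -/

lemma returnArc_spec (h4 : σ.wReg 4 = 1) (h5 : σ.wReg 5 = M) :
    WP W returnArc (fun τ k' => (∀ r < 19, τ.wReg r = σ.wReg r) ∧
      τ.wArr 0 = Function.update (σ.wArr 0) (M - 1) (σ.wReg 3) ∧
      τ.wArr 1 = Function.update (σ.wArr 1) (M - 1) (σ.wReg 2) ∧
      τ.rArr 3 = Function.update (σ.rArr 3) (M - 1) (⌈σ.rReg 10⌉ - σ.rReg 10) ∧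
      τ.rArr 4 = Function.update (σ.rArr 4) (M - 1) (σ.rReg 10 - ⌊σ.rReg 10⌋) ∧
      (∀ a, a ≠ 0 → a ≠ 1 → τ.wArr a = σ.wArr a) ∧
      (∀ a, a ≠ 3 → a ≠ 4 → τ.rArr a = σ.rArr a) ∧ k' = k + 12) σ k := by
  simp only [returnArc, WP_seq, WP_instr, Instr.exec]
  refine ⟨fun r hr => by simp [show r ≠ 20 by omega], by simp [h4, h5], by simp [h4, h5],
    by simp [h4, h5, Int.floor_neg], by simp [h4, h5], fun a h h' => by simp [h, h'],
    fun a h h' => by simp [h, h'], by simp⟩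

/-- The specification of the program on an abstract memory. Arcs from `m` to `M - 2` are padding
without capacity; they are inactive throughout. -/
lemma roundFlow_spec {m s t : ℕ} {F : ℝ} (hf : Fits W (2 ^ Nat.clog 2 (m + 1)))
    (hW : 2 * (m + 1) < W) (r1 : σ.wReg 1 = m) (r2 : σ.wReg 2 = s) (r3 : σ.wReg 3 = t)
    (r0 : ∀ r, 4 ≤ r → σ.wReg r = 0) (rr : σ.rReg 10 = 0) (hw : ∀ a, 2 ≤ a → σ.wArr a = fun _ => 0)
    (hr : ∀ a, 2 ≤ a → σ.rArr a = fun _ => 0)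
    (hpad : ∀ e, m ≤ e → σ.wArr 0 e = 0 ∧ σ.wArr 1 e = 0 ∧ σ.rArr 1 e = 0) (hst : s ≠ t)
    (hflow : ∀ v, ∑ e ∈ Finset.Ico 0 m, σ.rArr 1 e * bd (σ.wArr 0) (σ.wArr 1) e v =
      F * ((if t = v then 1 else 0) - (if s = v then 1 else 0))) :
    WP W roundFlow (fun τ k' =>
      (∀ e < m, ∃ z : ℤ, τ.rArr 2 e = z) ∧
      (∀ e < m, (⌊baseFlow σ e⌋ : ℝ) ≤ τ.rArr 2 e ∧ τ.rArr 2 e ≤ ⌈baseFlow σ e⌉) ∧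
      (∀ v, ∑ e ∈ Finset.Ico 0 m, τ.rArr 2 e * bd (σ.wArr 0) (σ.wArr 1) e v =
        ⌊F⌋ * ((if t = v then 1 else 0) - (if s = v then 1 else 0))) ∧
      k' ≤ k + 5000 * ((m + 1) * (Nat.clog 2 (m + 1) + 1))) σ k := by
  obtain ⟨J, hJ⟩ : ∃ J, J = Nat.clog 2 (m + 1) := ⟨_, rfl⟩
  obtain ⟨M, hM⟩ : ∃ M, M = 2 ^ J := ⟨_, rfl⟩
  have hMm : m + 1 ≤ M := by
    rw [hM, hJ]
    exact Nat.le_pow_clog (by norm_num) _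
  have hM2 : M ≤ 2 * (m + 1) := by
    rw [hM, hJ]
    exact pow_clog_le _ (by omega)
  rw [← hJ, ← hM] at hf
  have hf' := hf
  unfold Fits at hf'
  rw [roundFlow, WP_seq]
  refine WP.mono (powerOfTwo_spec r1 hW) ?_
  rintro σ₁ k₁ ⟨hσ₁, hk₁⟩
  rw [← hJ, ← hM] at hσ₁
  rw [← hJ] at hk₁
  have w1 : σ₁.wArr = σ.wArr := by simp [hσ₁]
  have a1 : σ₁.rArr = σ.rArr := by simp [hσ₁]
  have hbase : baseFlow σ₁ = baseFlow σ := by funext e; simp [baseFlow, w1, a1]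
  rw [WP_seq]
  refine WP.mono (prepLoop_spec (m := m) (by simp [hσ₁]) (by simp [hσ₁, r0]) (by simp [hσ₁, r1])
    (by omega) (by simp [a1, hr]) (by simp [a1, hr]) (by rw [hσ₁]; exact rr)) ?_
  rintro σ₂ k₂ ⟨hfr₂, hw₂, hr₂, hr1, hr3, hr4, hr10, hk₂⟩
  rw [hbase] at hr1 hr3 hr4
  have hF : σ₂.rReg 10 = F := by
    rw [hr10, w1, a1, hflow, hσ₁]
    simp [r3, hst]
  rw [WP_seq]
  refine WP.mono (returnArc_spec (M := M) (by rw [hfr₂ 4 (by norm_num)]; simp [hσ₁])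
    (by rw [hfr₂ 5 (by norm_num)]; simp [hσ₁])) ?_
  rintro σ₃ k₃ ⟨hfr₃, hE0, hE1, hA, hB, hw₃, hr₃, hk₃⟩
  have hreg : ∀ r < 19, r ≠ 4 → r ≠ 5 → σ₃.wReg r = σ.wReg r := fun r hr h4 h5 => by
    rw [hfr₃ r hr, hfr₂ r hr, hσ₁]
    simp [h4, h5, show r ≠ 22 by omega]
  have hreg4 : σ₃.wReg 4 = 1 := by rw [hfr₃ 4 (by norm_num), hfr₂ 4 (by norm_num)]; simp [hσ₁]
  have hreg5 : σ₃.wReg 5 = M := by rw [hfr₃ 5 (by norm_num), hfr₂ 5 (by norm_num)]; simp [hσ₁]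
  rw [hw₂, w1, hfr₂ 3 (by norm_num), show σ₁.wReg 3 = t by simp [hσ₁, r3]] at hE0
  rw [hw₂, w1, hfr₂ 2 (by norm_num), show σ₁.wReg 2 = s by simp [hσ₁, r2]] at hE1
  rw [hF] at hA hB
  set b : ℕ → ℝ := Function.update (baseFlow σ) (M - 1) F with hb
  have hpad0 : ∀ e, m ≤ e → baseFlow σ e = 0 := fun e he => by
    obtain ⟨p0, p1, p2⟩ := hpad e he
    simp [baseFlow, p0, p1, p2]
  have hA' : ∀ e, σ₃.rArr 3 e = ⌈b e⌉ - b e := by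
    intro e
    rw [hA, hb]
    by_cases he : e = M - 1
    · subst he; simp
    · rw [Function.update_of_ne he, Function.update_of_ne he, hr3]
      split_ifs with h
      · rfl
      · rw [hpad0 e (by simpa using h)]; simp
  have hB' : ∀ e, σ₃.rArr 4 e = b e - ⌊b e⌋ := by
    intro e
    rw [hB, hb]
    by_cases he : e = M - 1
    · subst he; simp
    · rw [Function.update_of_ne he, Function.update_of_ne he, hr4]
      split_ifs with h
      · rfl
      · rw [hpad0 e (by simpa using h)]; simp
  have hD' : ∀ e, σ₃.rArr 5 e = 0 := fun e => by
    rw [hr₃ 5 (by norm_num) (by norm_num), hr₂ 5 (by norm_num) (by norm_num) (by norm_num), a1,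
      hr 5 (by norm_num)]
  have hout1 : ∀ e < m, σ₃.rArr 1 e = b e := fun e he => by
    rw [hr₃ 1 (by norm_num) (by norm_num), hr1, if_pos (by simpa using he), hb,
      Function.update_of_ne (by omega)]
  have hwz : ∀ a, 2 ≤ a → σ₃.wArr a = fun _ => 0 := fun a ha => by
    rw [hw₃ a (by omega) (by omega), hw₂, w1, hw a ha]
  -- the net inflows in the network with and without the return arc
  have hsplit : ∀ (x : ℕ → ℝ) (v : ℕ),
      ∑ e ∈ Finset.Ico 0 M, x e * bd (σ₃.wArr 0) (σ₃.wArr 1) e v =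
      ∑ e ∈ Finset.Ico 0 m, x e * bd (σ.wArr 0) (σ.wArr 1) e v +
        x (M - 1) * ((if s = v then 1 else 0) - (if t = v then 1 else 0)) := by
    intro x v
    have hI : Finset.Ico 0 M = insert (M - 1) (Finset.Ico 0 (M - 1)) := by
      ext e
      simp only [Finset.mem_insert, Finset.mem_Ico]
      omega
    rw [hI, Finset.sum_insert (by simp), add_comm]
    congr 1
    · rw [← Finset.sum_subset (Finset.Ico_subset_Ico_right (show m ≤ M - 1 by omega))]
      · refine Finset.sum_congr rfl fun e he => ?_
        have := (Finset.mem_Ico.1 he).2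
        rw [bd_congr (E₀ := σ.wArr 0) (E₁ := σ.wArr 1)] <;> simp only [hE0, hE1] <;>
          rw [Function.update_of_ne (by omega)]
      · intro e he he'
        simp only [Finset.mem_Ico] at he he'
        obtain ⟨p0, p1, -⟩ := hpad e (by omega)
        have hne : e ≠ M - 1 := by omega
        simp [bd, hE0, hE1, hne, p0, p1]
    · simp [bd, hE0, hE1]
  have hcirc : ∀ v, ∑ e ∈ Finset.Ico 0 M, b e * bd (σ₃.wArr 0) (σ₃.wArr 1) e v = 0 := by
    intro v
    have hbM : b (M - 1) = F := by simp [hb]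
    rw [hsplit, hbM]
    have : ∑ e ∈ Finset.Ico 0 m, b e * bd (σ.wArr 0) (σ.wArr 1) e v =
        ∑ e ∈ Finset.Ico 0 m, σ.rArr 1 e * bd (σ.wArr 0) (σ.wArr 1) e v := by
      refine Finset.sum_congr rfl fun e he => ?_
      have := (Finset.mem_Ico.1 he).2
      rw [hb, Function.update_of_ne (by omega), baseFlow]
      split_ifs with h
      · simp [bd, h]
      · rfl
    rw [this, hflow]
    ring
  simp only [WP_seq, WP_instr]
  obtain ⟨σ₄, hσ₄⟩ : ∃ σ₄, σ₄ = (((σ₃.setW 7 M).setW 9 M).setWArr 8 0 M).setW 10 1 := ⟨_, rfl⟩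
  have hexec : (Instr.wCopy 10 4).exec W ((Instr.wStore 8 6 5).exec W ((Instr.wCopy 9 5).exec W
      ((Instr.wCopy 7 5).exec W σ₃))) = σ₄ := by
    rw [hσ₄]
    simp [Instr.exec, hreg5, hreg4, hreg 6, r0]
  rw [hexec]
  have w4 : ∀ a, a ≠ 8 → σ₄.wArr a = σ₃.wArr a := fun a ha => by simp [hσ₄, ha]
  have a4 : σ₄.rArr = σ₃.rArr := by simp [hσ₄]
  have hl : Level W M σ₄ M 0 0 (2 ^ J) 0 M := by
    rw [← hM]
    refine ⟨by simp [hσ₄, hreg4], by simp [hσ₄, hreg 18, r0], by simp [hσ₄],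
      by simp [hσ₄, hreg 6, r0], by simp [hσ₄], by simp [hσ₄, hreg 8, r0], by simp [hσ₄],
      by simp [hσ₄], by simp [hσ₄, hwz 9], le_rfl, by omega, by omega, le_rfl, le_rfl, by omega,
      by omega, by omega, by omega, by rw [w4 2 (by norm_num), hwz 2 (by norm_num)],
      by rw [w4 3 (by norm_num), hwz 3 (by norm_num)],
      by rw [w4 4 (by norm_num), hwz 4 (by norm_num)],
      by rw [w4 5 (by norm_num), hwz 5 (by norm_num)],
      fun e _ => by rw [w4 6 (by norm_num), hwz 6 (by norm_num)], ?_, by simp, ?_⟩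
    · intro c _ e he
      simp [actS] at he
    · intro e _
      rw [a4, hD', hA', hB', w4 0 (by norm_num), w4 1 (by norm_num)]
      have h1 := Int.le_ceil (b e)
      have h2 := Int.floor_le (b e)
      refine ⟨rfl, by linarith, by linarith, fun h3 _ => ?_⟩
      by_cases he : e = M - 1
      · rw [hE0, hE1, he]
        simpa using hst.symm
      · rw [hE0, hE1, Function.update_of_ne he, Function.update_of_ne he]
        intro hloop
        rw [hb, Function.update_of_ne he, baseFlow, if_pos hloop] at h3
        simp at h3
  refine visit_spec hf J hl ?_
  intro ω k₄ hlω hc hneg hk₄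
  refine finish_spec hf hlω ?_
  intro ω' ew er hreg' h18
  rw [← hM, Finset.Ico_self, Finset.empty_union, zero_add] at hc
  rw [← hM, zero_add] at hlω
  rw [← hM, zero_add] at hneg
  refine WP.mono (outLoop_spec (m := m)
    (by rw [hreg' 4 (by norm_num), hc.regs 4 (by norm_num)]; simp [hσ₄, hreg4]) h18
    (by rw [hreg' 1 (by norm_num), hc.regs 1 (by norm_num)]; simp [hσ₄, hreg 1, r1]) (by omega)) ?_
  rintro τ k₅ ⟨hout, hk₅⟩
  set g : ℕ → ℝ := fun e => b e + ω.rArr 5 e with hg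
  have houtg : ∀ e < m, τ.rArr 2 e = g e := by
    intro e he
    rw [hout e he, er, hc.rother 1 (by norm_num) (by norm_num) (by norm_num), a4, hout1 e he]
  have hcap : ∀ e < M, upRes ω e = ⌈b e⌉ - g e ∧ dnRes ω e = g e - ⌊b e⌋ := by
    intro e he
    obtain ⟨-, -, c3, c4⟩ := hc.same e he
    rw [upRes, dnRes, c3, c4, a4, hA', hB', hg]
    constructor <;> ring
  have hgc : ∀ v, ∑ e ∈ Finset.Ico 0 M, g e * bd (σ₃.wArr 0) (σ₃.wArr 1) e v = 0 := by
    intro v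
    have h1 := hc.cons v
    rw [w4 0 (by norm_num), w4 1 (by norm_num)] at h1
    rw [← add_zero (0 : ℝ)]
    nth_rewrite 1 [← hcirc v]
    rw [← h1, ← Finset.sum_add_distrib]
    refine Finset.sum_congr rfl fun e _ => ?_
    rw [a4, hD', hg]
    ring
  have hgb : ∀ e ∈ Finset.Ico 0 M, (⌊b e⌋ : ℝ) ≤ g e ∧ g e ≤ ⌈b e⌉ := by
    intro e he
    obtain ⟨h1, h2⟩ := hcap e (Finset.mem_Ico.1 he).2
    obtain ⟨h3, h4⟩ := hlω.bdd e (Finset.mem_union_right _ he)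
    constructor <;> linarith
  have hint := integral_of_acyc hgc hgb (by
    refine (hlω.acyc.subset ?_).congr (fun e he => ?_) (fun e he => ?_)
    · intro e he
      obtain ⟨he, h1, h2⟩ := Finset.mem_filter.1 he
      obtain ⟨h3, h4⟩ := hcap e (Finset.mem_Ico.1 he).2
      exact mem_actS.2 ⟨Finset.mem_union_right _ he, by linarith, by linarith⟩
    · have := (Finset.mem_Ico.1 (Finset.mem_filter.1 he).1).2
      rw [(hc.same e this).1, w4 0 (by norm_num)]
    · have := (Finset.mem_Ico.1 (Finset.mem_filter.1 he).1).2
      rw [(hc.same e this).2.1, w4 1 (by norm_num)])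
  have hbase' : ∀ e < m, b e = baseFlow σ e := fun e he => by
    rw [hb, Function.update_of_ne (by omega)]
  have hgM : g (M - 1) = ⌊F⌋ := by
    have hm : M - 1 ∈ Finset.Ico 0 M := by simp; omega
    obtain ⟨z, hz⟩ := hint _ hm
    obtain ⟨h1, -⟩ := hgb _ hm
    have hbM : b (M - 1) = F := by simp [hb]
    have h2 : g (M - 1) ≤ F := by simp only [hg, hbM]; linarith
    rw [hbM, hz] at h1
    rw [hz] at h2 ⊢
    have h3 : ⌊F⌋ ≤ z := by exact_mod_cast h1
    have h4 : z ≤ ⌊F⌋ := Int.le_floor.2 h2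
    exact_mod_cast le_antisymm h4 h3
  refine ⟨fun e he => ?_, fun e he => ?_, fun v => ?_, ?_⟩
  · rw [houtg e he]
    exact hint e (by simp; omega)
  · rw [houtg e he, ← hbase' e he]
    exact hgb e (by simp; omega)
  · have h1 := hsplit g v
    rw [hgc, hgM] at h1
    rw [Finset.sum_congr rfl fun e he => by rw [houtg e (Finset.mem_Ico.1 he).2]]
    linarith
  · rw [← hM] at hk₄
    rw [← hJ]
    have e1 : M * (J + 1) ≤ 2 * ((m + 1) * (J + 1)) := by
      rw [← mul_assoc]
      exact Nat.mul_le_mul_right _ hM2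
    have e2 : m + 1 + J ≤ (m + 1) * (J + 1) := by
      have : (m + 1) * (J + 1) = m * J + m + J + 1 := by ring
      have := Nat.zero_le (m * J)
      omega
    omega

/-! ### Networks as memory contents -/

lemma sum_bd_eq_netInflow {n m : ℕ} (G : FlowNetwork n m) (s t : Fin n) (f : Fin m → ℝ)
    (x : ℕ → ℝ) (v : Fin n) :
    ∑ e ∈ Finset.Ico 0 m, x e * bd ((inputState G s t f).wArr 0) ((inputState G s t f).wArr 1) e v =
      G.netInflow (fun e => x e) v := by
  rw [← Finset.range_eq_Ico, Finset.sum_range, FlowNetwork.netInflow, Finset.sum_filter,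
    Finset.sum_filter, ← Finset.sum_sub_distrib]
  refine Finset.sum_congr rfl fun e _ => ?_
  simp only [bd, inputState, e.2, dif_pos, if_true, Fin.eta, one_ne_zero, if_false, Fin.val_inj]
  split_ifs <;> ring

lemma stDemand_eq {n : ℕ} {s t : Fin n} (hst : s ≠ t) (v : Fin n) :
    FlowNetwork.stDemand s t v =
      (if (t : ℕ) = v then 1 else 0) - (if (s : ℕ) = v then 1 else 0) := by
  simp only [FlowNetwork.stDemand, Fin.val_inj]
  rcases eq_or_ne v s with rfl | h
  · simp [hst.symm]
  · rcases eq_or_ne v t with rfl | h'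
    · simp [h, hst]
    · simp [h, h', h.symm, h'.symm]

lemma fits_of_le {n m W : ℕ} (hn : 2 ≤ n) (hW : (n + m + 2) ^ 7 ≤ W) :
    Fits W (2 ^ Nat.clog 2 (m + 1)) ∧ 2 * (m + 1) < W := by
  have hM := pow_clog_le (m + 1) (by omega)
  set M := 2 ^ Nat.clog 2 (m + 1)
  have h1 : (m + 4) ^ 7 ≤ W := (Nat.pow_le_pow_left (by omega) 7).trans hW
  have h2 : 4 ^ 5 * (m + 4) ^ 2 ≤ (m + 4) ^ 7 := by
    rw [show (m + 4) ^ 7 = (m + 4) ^ 5 * (m + 4) ^ 2 by ring]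
    exact Nat.mul_le_mul_right _ (Nat.pow_le_pow_left (by omega) 5)
  have h3 : M * M ≤ (2 * (m + 1)) * (2 * (m + 1)) := Nat.mul_le_mul hM hM
  constructor
  · unfold Fits
    nlinarith
  · nlinarith

/-- A bound for the running time of the rounding program on networks with `m` arcs. -/
def timeBound (m : ℕ) : ℕ := 5000 * ((m + 1) * (Nat.clog 2 (m + 1) + 1))

lemma isSoftO_timeBound : IsSoftO (fun m => (timeBound m : ℝ)) (fun m => (m : ℝ)) := by
  refine ⟨1, IsBigO.of_bound 100000 ?_⟩
  filter_upwards [eventually_ge_atTop 3] with m hm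
  have hm' : (3 : ℝ) ≤ m := by exact_mod_cast hm
  have hlog : 1 ≤ Real.log m := by
    rw [Real.le_log_iff_exp_le (by linarith)]
    have := Real.exp_one_lt_d9
    linarith
  have hJ : (Nat.clog 2 (m + 1) : ℝ) ≤ 1 + 4 * Real.log m := by
    have h1 := pow_clog_le (m + 1) (by omega)
    have h2 : (2 : ℝ) ^ Nat.clog 2 (m + 1) ≤ 2 * (m + 1) := by exact_mod_cast h1
    have h3 : (2 : ℝ) ^ Nat.clog 2 (m + 1) ≤ 2 * (m * m) := h2.trans (by nlinarith)
    have h4 := Real.log_le_log (by positivity) h3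
    rw [Real.log_pow, Real.log_mul (by norm_num) (by positivity),
      Real.log_mul (by positivity) (by positivity)] at h4
    have h5 := Real.log_two_gt_d9
    have h6 : (Nat.clog 2 (m + 1) - 1 : ℝ) * Real.log 2 ≤ 2 * Real.log m := by linarith
    by_contra! hcon
    nlinarith
  rw [Real.norm_of_nonneg (by positivity), Real.norm_of_nonneg (by positivity), pow_one, timeBound]
  push_cast
  have h7 : (m + 1 : ℝ) ≤ 2 * m := by linarith
  have h8 : (Nat.clog 2 (m + 1) + 1 : ℝ) ≤ 6 * Real.log m := by linarith
  have h9 : (m + 1 : ℝ) * (Nat.clog 2 (m + 1) + 1) ≤ 2 * m * (6 * Real.log m) :=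
    mul_le_mul h7 h8 (by positivity) (by positivity)
  have h10 : 0 ≤ (m : ℝ) * Real.log m := by positivity
  linarith

end RealRAM

/-- One fixed program rounds every feasible fractional `s`-`t` flow of value `F` to a feasible
integral one of value `⌊F⌋`. Its worst-case running time is soft-O of the number `m` of arcs, using
words of `O(log (n + m))` bits, and depends neither on the capacities nor on the flow. -/
theorem corollary7 :
    ∃ (P : RealRAM.Program) (κ : ℕ) (T : ℕ → ℕ),
      IsSoftO (fun m => (T m : ℝ)) (fun m => (m : ℝ)) ∧
      ∀ (n m : ℕ) (G : FlowNetwork n m) (s t : Fin n) (f : Fin m → ℝ) (F : ℝ),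
        s ≠ t → G.IsSTFlow s t f F → G.Feasible f →
        ∀ W : ℕ, (n + m + 2) ^ κ ≤ W →
          ∃ (k : ℕ) (τ : RealRAM.State),
            RealRAM.Run W P (RealRAM.inputState G s t f) k τ ∧
            k ≤ T m ∧
            IsIntegralVec (RealRAM.output m τ) ∧
            G.Feasible (RealRAM.output m τ) ∧
            G.IsSTFlow s t (RealRAM.output m τ) (⌊F⌋ : ℝ) := by
  refine ⟨RealRAM.roundFlow, 7, RealRAM.timeBound, RealRAM.isSoftO_timeBound, ?_⟩
  intro n m G s t f F hst hflow hfeas W hW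
  have hn : 2 ≤ n := by
    have h1 := s.2
    have h2 := t.2
    have h3 : (s : ℕ) ≠ t := fun h => hst (Fin.ext h)
    omega
  obtain ⟨hfits, hW'⟩ := RealRAM.fits_of_le hn hW
  set σ := RealRAM.inputState G s t f with hσ
  have hin : ∀ (e : ℕ) (he : e < m), σ.wArr 0 e = G.tail ⟨e, he⟩ ∧ σ.wArr 1 e = G.head ⟨e, he⟩ ∧
      σ.rArr 1 e = f ⟨e, he⟩ := by
    intro e he
    simp [hσ, RealRAM.inputState, he]
  have hf1 : (fun e : Fin m => σ.rArr 1 e) = f := by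
    funext e
    simp [hσ, RealRAM.inputState]
  have hsum : ∀ v, ∑ e ∈ Finset.Ico 0 m, σ.rArr 1 e *
      FlowRounding.bd (σ.wArr 0) (σ.wArr 1) e v =
      F * ((if (t : ℕ) = v then 1 else 0) - (if (s : ℕ) = v then 1 else 0)) := by
    intro v
    by_cases hv : v < n
    · have := RealRAM.sum_bd_eq_netInflow G s t f (σ.rArr 1) ⟨v, hv⟩
      rw [hf1, hflow.2 ⟨v, hv⟩] at this
      beta_reduce at this
      rw [RealRAM.stDemand_eq hst] at this
      exact this
    · have h1 : (t : ℕ) ≠ v := by have := t.2; omega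
      have h2 : (s : ℕ) ≠ v := by have := s.2; omega
      rw [if_neg h1, if_neg h2, sub_zero, mul_zero]
      refine Finset.sum_eq_zero fun e he => ?_
      obtain ⟨g0, g1, -⟩ := hin e (Finset.mem_Ico.1 he).2
      have h3 : (G.tail ⟨e, (Finset.mem_Ico.1 he).2⟩ : ℕ) ≠ v := by
        have := (G.tail ⟨e, (Finset.mem_Ico.1 he).2⟩).2; omega
      have h4 : (G.head ⟨e, (Finset.mem_Ico.1 he).2⟩ : ℕ) ≠ v := by
        have := (G.head ⟨e, (Finset.mem_Ico.1 he).2⟩).2; omega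
      simp [FlowRounding.bd, g0, g1, h3, h4]
  obtain ⟨k, τ, hrun, hint, hbd, hcons, hk⟩ := RealRAM.roundFlow_spec (σ := σ) (k := 0) hfits hW'
    (by simp [hσ, RealRAM.inputState]) (s := s) (by simp [hσ, RealRAM.inputState]) (t := t)
    (by simp [hσ, RealRAM.inputState])
    (fun r hr => by
      simp [hσ, RealRAM.inputState, show r ≠ 0 by omega, show r ≠ 1 by omega, show r ≠ 2 by omega,
        show r ≠ 3 by omega])
    rfl
    (fun a ha => by
      funext i
      simp [hσ, RealRAM.inputState, show a ≠ 0 by omega, show a ≠ 1 by omega])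
    (fun a ha => by
      funext i
      simp [hσ, RealRAM.inputState, show a ≠ 0 by omega, show a ≠ 1 by omega])
    (fun e he => by simp [hσ, RealRAM.inputState, he.not_gt])
    (fun h => hst (Fin.ext h)) hsum
  have hF0 : (0 : ℝ) ≤ ⌊F⌋ := by exact_mod_cast Int.floor_nonneg.2 hflow.1
  refine ⟨k, τ, hrun, by simpa [RealRAM.timeBound] using hk, fun e => hint e e.2, fun e => ?_,
    hF0, fun v => ?_⟩
  · obtain ⟨h1, h2⟩ := hbd e e.2
    obtain ⟨h3, h4⟩ := hfeas e
    obtain ⟨g0, g1, g2⟩ := hin e e.2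
    have h5 : 0 ≤ RealRAM.baseFlow σ e ∧ RealRAM.baseFlow σ e ≤ G.cap e := by
      rw [RealRAM.baseFlow, g2]
      split_ifs
      · exact ⟨by exact_mod_cast Int.floor_nonneg.2 h3, (Int.floor_le _).trans h4⟩
      · exact ⟨h3, h4⟩
    have h6 : (0 : ℝ) ≤ ⌊RealRAM.baseFlow σ e⌋ := by exact_mod_cast Int.floor_nonneg.2 h5.1
    have h7 : (⌈RealRAM.baseFlow σ e⌉ : ℝ) ≤ G.cap e := by
      have : ⌈RealRAM.baseFlow σ e⌉ ≤ (G.cap e : ℤ) := Int.ceil_le.2 (by exact_mod_cast h5.2)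
      exact_mod_cast this
    exact ⟨h6.trans h1, h2.trans h7⟩
  · have := RealRAM.sum_bd_eq_netInflow G s t f (τ.rArr 2) v
    rw [← hσ, hcons, ← RealRAM.stDemand_eq hst] at this
    exact this.symm
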